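/- Let $M$ be a smooth $n$-dimensional manifold with Poisson bivector field $\Pi$, locally $\pi^{ij}=\Pi(dx^i,dx^j)$, let $\langle\beta,\#\alpha\rangle=\Pi(\alpha,\beta)$, and let $[\alpha,\beta]=\mathcal L_{\#\alpha}\beta-\mathcal L_{\#\beta}\alpha-d\,\Pi(\alpha,\beta)$ be the Lie bracket of 1-forms. A contravariant connection on $T^*M$ is a bilinear map $(\alpha,\beta)\mapsto\nabla^\alpha\beta$ on 1-forms with $\nabla^{f\alpha}\beta=f\nabla^\alpha\beta$ and $\nabla^\alpha(f\beta)=f\nabla^\alpha\beta+(\#\alpha)(f)\,\beta$; locally $\nabla^{dx^i}dx^j=-\Gamma^{ij}_k\,dx^k$, and the dual connection on vector fields is given by $\nabla^{dx^i}\partial_j=\Gamma^{ik}_j\,\partial_k$. It is torsion-free if $\nabla^\alpha\beta-\nabla^\beta\alpha=[\alpha,\beta]$. Contravariant connections $\nabla,{}^\dagger\nabla$ are associated if ${}^\dagger\nabla^\alpha\#\beta-\nabla^\beta\#\alpha-\#[\alpha,\beta]=0$ for all 1-forms $\alpha,\beta$. Let $Z$ be the zero section of $T^*M$. Formal functions on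 $(T^*M,Z)$ are the formal sums $F=\sum_{s\ge 0}F^{(s)}$ of smooth functions $F^{(s)}$ on $T^*M$ that are homogeneous polynomials of degree $s$ on the fibres, i.e. formal power series in the fibre coordinates $\xi_i$ with smooth coefficients. Set $\mathcal E=\xi_k\,\partial/\partial\xi_k$, $\Omega=\frac12\pi^{ij}d\xi_i\wedge d\xi_j$, $\hat\alpha=\alpha_i\,\partial/\partial\xi_i$ for a 1-form $\alpha=\alpha_i\,dx^i$, and $$\bar\nabla^{\alpha}=\alpha_i\Big(\pi^{ij}\frac{\partial}{\partial x^j}+\Gamma^{ij}_k\,\xi_j\frac{\partial}{\partial\xi_k}\Big),\qquad R^{\bar\nabla}(\alpha,\beta)=[\bar\nabla^\alpha,\bar\nabla^\beta]-\bar\nabla^{[\alpha,\beta]},\qquad \bar Q(\alpha,\beta)=\tfrac12\,\Omega\big(\mathcal E,R^{\bar\nabla}(\alpha,\beta)\big).$$ A formal function $F$ is Hamiltonian if $\iota(H_F)\Omega=-d_\xi F$ for some vertical formal vector field $H_F$, where $d_\xi$ is the fibrewise differential; for Hamiltonian $F,G$ put $\{F,G\}_\Omega=H_FG$. For a global vertical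 1-form $U$ on $(T^*M,Z)$ put $U(\alpha)=\langle U,\hat\alpha\rangle$. The Fundamental Equation for $U$ is $$\Pi(\alpha,\beta)=\bar Q(\alpha,\beta)-\bar\nabla^\alpha U(\beta)+\bar\nabla^\beta U(\alpha)+U([\alpha,\beta])+\{U(\alpha),U(\beta)\}_\Omega\qquad\text{for all 1-forms }\alpha,\beta .$$ We say that $U$ has local potentials if $M$ is covered by coordinate charts over which there are formal functions $u_k(x,\xi)$ and $v^i_k(x,\xi)$ with $$\pi^{is}v^j_s=\pi^{js}\frac{\partial u_s}{\partial\xi_i},\qquad U(dx^i)=\pi^{ik}u_k,\qquad u_k=-\xi_k \pmod{\xi^2},\qquad v^i_k=\delta^i_k\pmod{\xi}$$ (then every $U(\alpha)$ is Hamiltonian, so that the bracket in the Fundamental Equation is defined). **Theorem.** Let $\nabla,{}^\dagger\nabla$ be associated contravariant connections on $T^*M$ such that ${}^\dagger\nabla$ is torsion-free. Then there is a unique global vertical 1-form $U$ on $(T^*M,Z)$ which has local potentials, satisfies the Fundamental Equation, and satisfies the normalization condition $\langle U,\mathcal E\rangle=0$. -/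

import Mathlib

open scoped Manifold ContDiff Topology

namespace FormalPoisson

noncomputable section

/-! ### Coordinate calculus on an open piece of `ℝⁿ` and on its cotangent bundle

A point of the base is `y : EuclideanSpace ℝ (Fin n)`, and `ξ : Fin n → ℝ` are the fibre
coordinates of a covector.  Tensors are given by their components, which are functions of `y`. -/

section Local

variable {n : ℕ}

/-- The partial derivative `∂f/∂y^j` of a function on `ℝⁿ`. -/
def pdBase (j : Fin n) (f : EuclideanSpace ℝ (Fin n) → ℝ) (y : EuclideanSpace ℝ (Fin n)) : ℝ :=
  fderiv ℝ f y (EuclideanSpace.single j 1)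

/-- The partial derivative `∂g/∂ξ_k` of a function of the fibre coordinates. -/
def pdFibre (k : Fin n) (g : (Fin n → ℝ) → ℝ) (ξ : Fin n → ℝ) : ℝ :=
  fderiv ℝ g ξ (Pi.single k 1)

/-- The carrier of local formal functions: `F s y ξ` is the homogeneous component `F^{(s)}` of
degree `s` in the fibre variables of the formal series `F = ∑ₛ F^{(s)}(y, ξ)`. -/
abbrev LocalFormal (n : ℕ) : Type :=
  ℕ → EuclideanSpace ℝ (Fin n) → (Fin n → ℝ) → ℝ

/-- `F` is a formal function over the open set `V`: each `F^{(s)}` is smooth on `V × ℝⁿ` and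
homogeneous of degree `s` in `ξ`.  (Being smooth at `ξ = 0`, it is then a homogeneous polynomial of
degree `s` in `ξ` with coefficients in `C^∞(V)`, so `F` is a formal power series in `ξ` over
`C^∞(V)`.) -/
def IsFormalOn (V : Set (EuclideanSpace ℝ (Fin n))) (F : LocalFormal n) : Prop :=
  ∀ s : ℕ,
    ContDiffOn ℝ ∞ (fun p : EuclideanSpace ℝ (Fin n) × (Fin n → ℝ) => F s p.1 p.2)
      (V ×ˢ Set.univ) ∧
    ∀ y ∈ V, ∀ (t : ℝ) (ξ : Fin n → ℝ), F s y (t • ξ) = t ^ s * F s y ξ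

/-- The formal function `∂F/∂ξ_k`; its component of degree `s` comes from `F^{(s+1)}`. -/
def LocalFormal.dFibre (k : Fin n) (F : LocalFormal n) : LocalFormal n :=
  fun s y => pdFibre k (F (s + 1) y)

/-- The fibre coordinate `ξ_k`, as a formal function. -/
def xiCoord (k : Fin n) : LocalFormal n :=
  fun s _ ξ => if s = 1 then ξ k else 0

/-- The components of the vector field `#α`, where `⟨β, #α⟩ = Π(α, β)`. -/
def sharpCoeff (π : Fin n → Fin n → EuclideanSpace ℝ (Fin n) → ℝ)
    (α : Fin n → EuclideanSpace ℝ (Fin n) → ℝ) : Fin n → EuclideanSpace ℝ (Fin n) → ℝ :=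
  fun j y => ∑ i, α i y * π i j y

/-- The components of the Lie derivative `𝓛_X β` of a 1-form `β` along a vector field `X`. -/
def lieDerivCoeff (X β : Fin n → EuclideanSpace ℝ (Fin n) → ℝ) :
    Fin n → EuclideanSpace ℝ (Fin n) → ℝ :=
  fun k y => ∑ j, (X j y * pdBase j (β k) y + β j y * pdBase k (X j) y)

/-- The components of the Lie bracket `[α, β] = 𝓛_{#α} β - 𝓛_{#β} α - d Π(α, β)` of 1-forms. -/
def bracketCoeff (π : Fin n → Fin n → EuclideanSpace ℝ (Fin n) → ℝ)
    (α β : Fin n → EuclideanSpace ℝ (Fin n) → ℝ) : Fin n → EuclideanSpace ℝ (Fin n) → ℝ :=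
  fun k y => lieDerivCoeff (sharpCoeff π α) β k y - lieDerivCoeff (sharpCoeff π β) α k y
    - pdBase k (fun z => ∑ i, ∑ j, π i j z * α i z * β j z) y

/-- The components of `∇^α X` for a vector field `X`, where `∇^{dx^i} ∂_j = Γ^{ik}_j ∂_k`;
`Γ i j k` stands for `Γ^{ij}_k`. -/
def connVectorCoeff (π : Fin n → Fin n → EuclideanSpace ℝ (Fin n) → ℝ)
    (Γ : Fin n → Fin n → Fin n → EuclideanSpace ℝ (Fin n) → ℝ)
    (α X : Fin n → EuclideanSpace ℝ (Fin n) → ℝ) : Fin n → EuclideanSpace ℝ (Fin n) → ℝ :=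
  fun k y => ∑ i, α i y * ∑ j, (π i j y * pdBase j (X k) y + Γ i k j y * X j y)

/-- The formal vector field
`∇̄^α = α_i (π^{ij} ∂/∂y^j + Γ^{ij}_k ξ_j ∂/∂ξ_k)`, acting on formal functions (it has degree 0). -/
def nablaBar (π : Fin n → Fin n → EuclideanSpace ℝ (Fin n) → ℝ)
    (Γ : Fin n → Fin n → Fin n → EuclideanSpace ℝ (Fin n) → ℝ)
    (α : Fin n → EuclideanSpace ℝ (Fin n) → ℝ) (F : LocalFormal n) : LocalFormal n :=
  fun s y ξ => ∑ i, α i y *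
    ((∑ j, π i j y * pdBase j (fun z => F s z ξ) y)
      + ∑ j, ∑ k, Γ i j k y * ξ j * pdFibre k (F s y) ξ)

/-- The components `R̄_k` of the vertical formal vector field
`R^{∇̄}(α, β) = [∇̄^α, ∇̄^β] - ∇̄^{[α, β]} = R̄_k ∂/∂ξ_k`, obtained by applying it to `ξ_k`. -/
def curvatureBar (π : Fin n → Fin n → EuclideanSpace ℝ (Fin n) → ℝ)
    (Γ : Fin n → Fin n → Fin n → EuclideanSpace ℝ (Fin n) → ℝ)
    (α β : Fin n → EuclideanSpace ℝ (Fin n) → ℝ) : Fin n → LocalFormal n :=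
  fun k s y ξ =>
    nablaBar π Γ α (nablaBar π Γ β (xiCoord k)) s y ξ
      - nablaBar π Γ β (nablaBar π Γ α (xiCoord k)) s y ξ
      - nablaBar π Γ (bracketCoeff π α β) (xiCoord k) s y ξ

/-- The function `Ω(X, Y) = π^{ij} X_i Y_j` for vertical formal vector fields `X = X_i ∂/∂ξ_i` and
`Y = Y_j ∂/∂ξ_j`, where `Ω = ½ π^{ij} dξ_i ∧ dξ_j`. -/
def omegaPairing (π : Fin n → Fin n → EuclideanSpace ℝ (Fin n) → ℝ)
    (X Y : Fin n → LocalFormal n) : LocalFormal n :=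
  fun s y ξ => ∑ p ∈ Finset.HasAntidiagonal.antidiagonal s, ∑ i, ∑ j, π i j y * X i p.1 y ξ * Y j p.2 y ξ

/-- `Q̄(α, β) = ½ Ω(𝓔, R^{∇̄}(α, β))`, where `𝓔 = ξ_k ∂/∂ξ_k` is the fibrewise Euler field. -/
def qBar (π : Fin n → Fin n → EuclideanSpace ℝ (Fin n) → ℝ)
    (Γ : Fin n → Fin n → Fin n → EuclideanSpace ℝ (Fin n) → ℝ)
    (α β : Fin n → EuclideanSpace ℝ (Fin n) → ℝ) : LocalFormal n :=
  fun s y ξ => (1 / 2 : ℝ) * omegaPairing π xiCoord (curvatureBar π Γ α β) s y ξ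

end Local

/-! ### Differential forms, Poisson structures and contravariant connections on a manifold -/

section Global

variable {n : ℕ} {M : Type*} [TopologicalSpace M] [ChartedSpace (EuclideanSpace ℝ (Fin n)) M]

/-- The cotangent space `T*_x M`. -/
abbrev Cot (n : ℕ) {M : Type*} [TopologicalSpace M] [ChartedSpace (EuclideanSpace ℝ (Fin n)) M]
    (x : M) : Type :=
  TangentSpace (𝓡 n) x →L[ℝ] ℝ

/-- The smooth coordinate charts of `M`. -/
abbrev smoothCharts (n : ℕ) (M : Type*) [TopologicalSpace M]
    [ChartedSpace (EuclideanSpace ℝ (Fin n)) M] :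
    Set (OpenPartialHomeomorph M (EuclideanSpace ℝ (Fin n))) :=
  IsManifold.maximalAtlas (𝓡 n) ∞ M

/-- The differential of a function at a point. -/
def differential (n : ℕ) {M : Type*} [TopologicalSpace M]
    [ChartedSpace (EuclideanSpace ℝ (Fin n)) M] (f : M → ℝ) (x : M) : Cot n x :=
  mfderiv (𝓡 n) 𝓘(ℝ, ℝ) f x

/-- The coordinate covector `dx^i` of the chart `e`, at the point `x`. -/
def coordCovector (e : OpenPartialHomeomorph M (EuclideanSpace ℝ (Fin n))) (i : Fin n) (x : M) :
    Cot n x :=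
  differential n (fun p => e p i) x

/-- The coordinate vector `∂_i` of the chart `e`, at the point with coordinates `y`. -/
def coordVector (e : OpenPartialHomeomorph M (EuclideanSpace ℝ (Fin n))) (i : Fin n)
    (y : EuclideanSpace ℝ (Fin n)) : TangentSpace (𝓡 n) (e.symm y) :=
  mfderiv (𝓡 n) (𝓡 n) e.symm y (EuclideanSpace.single i (1 : ℝ) : EuclideanSpace ℝ (Fin n))

/-- The covector `∑ₖ ξ_k dx^k` at the point `x`. -/
def covectorOf (e : OpenPartialHomeomorph M (EuclideanSpace ℝ (Fin n))) (x : M)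
    (ξ : Fin n → ℝ) : Cot n x :=
  ∑ k, ξ k • coordCovector e k x

/-- Smooth 1-forms on `M`: fields of covectors with smooth components in all charts. -/
structure OneForm (n : ℕ) (M : Type*) [TopologicalSpace M]
    [ChartedSpace (EuclideanSpace ℝ (Fin n)) M] where
  toFun : ∀ x : M, Cot n x
  smooth' : ∀ e ∈ smoothCharts n M, ∀ i : Fin n,
    ContDiffOn ℝ ∞ (fun y => toFun (e.symm y) (coordVector e i y)) e.target

namespace OneForm

instance : CoeFun (OneForm n M) (fun _ => ∀ x : M, Cot n x) := ⟨OneForm.toFun⟩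

/-- The components `α_i` of a 1-form in a chart. -/
def coeff (α : OneForm n M) (e : OpenPartialHomeomorph M (EuclideanSpace ℝ (Fin n))) (i : Fin n)
    (y : EuclideanSpace ℝ (Fin n)) : ℝ :=
  α (e.symm y) (coordVector e i y)

instance : Zero (OneForm n M) where
  zero :=
    { toFun := fun _ => 0
      smooth' := fun _ _ _ => contDiffOn_const }

instance : Add (OneForm n M) where
  add α β :=
    { toFun := fun x => α x + β x
      smooth' := fun e he i => (α.smooth' e he i).add (β.smooth' e he i) }

instance : SMul (C^∞⟮𝓡 n, M; ℝ⟯) (OneForm n M) where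
  smul f α :=
    { toFun := fun x => f x • α x
      smooth' := fun e he i => by
        have h : ContDiffOn ℝ ∞ (fun y => f (e.symm y)) e.target :=
          (f.contMDiff.comp_contMDiffOn
            (contMDiffOn_symm_of_mem_maximalAtlas he)).contDiffOn
        exact h.mul (α.smooth' e he i) }

end OneForm

/-- Near every point of a chart, `dx^i` is the restriction of a 1-form defined on all of `M`. -/
theorem exists_oneForm_eventuallyEq [IsManifold (𝓡 n) ∞ M] [T2Space M]
    {e : OpenPartialHomeomorph M (EuclideanSpace ℝ (Fin n))} (he : e ∈ smoothCharts n M)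
    {x : M} (hx : x ∈ e.source) (i : Fin n) :
    ∃ β : OneForm n M, ∀ᶠ p in 𝓝 x, β p = coordCovector e i p := by
  obtain ⟨χ, hχ, -⟩ := (SmoothBumpFunction.nhds_basis_support (I := 𝓡 n)
    (e.open_source.mem_nhds hx)).mem_iff.1 (e.open_source.mem_nhds hx)
  refine ⟨⟨fun p => χ p • coordCovector e i p, fun f hf j => ?_⟩, ?_⟩
  · intro y hy
    refine ContDiffAt.contDiffWithinAt ?_
    have hfc : ContinuousAt f.symm y := f.continuousAt_symm hy
    have hfs : ContMDiffOn (𝓡 n) (𝓡 n) ∞ f.symm f.target :=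
      contMDiffOn_symm_of_mem_maximalAtlas hf
    by_cases hs : f.symm y ∈ tsupport χ
    · have hW : IsOpen (f.target ∩ f.symm ⁻¹' e.source) :=
        f.symm.isOpen_inter_preimage e.open_source
      have hyW : y ∈ f.target ∩ f.symm ⁻¹' e.source := ⟨hy, hχ hs⟩
      have hcoord : ContMDiffOn (𝓡 n) 𝓘(ℝ, ℝ) ∞ (fun p => e p i) e.source := by
        have h1 : ContMDiff (𝓡 n) 𝓘(ℝ, ℝ) ∞
            (fun z : EuclideanSpace ℝ (Fin n) => z i) :=
          (EuclideanSpace.proj (𝕜 := ℝ) i).contDiff.contMDiff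
        exact h1.comp_contMDiffOn (contMDiffOn_of_mem_maximalAtlas he)
      have htr : ContDiffOn ℝ ∞ (fun z => e (f.symm z) i) (f.target ∩ f.symm ⁻¹' e.source) :=
        (hcoord.comp (hfs.mono Set.inter_subset_left) (fun z hz => hz.2)).contDiffOn
      have hd : ContDiffAt ℝ ∞ (fun z => χ (f.symm z) *
          fderiv ℝ (fun z => e (f.symm z) i) z (EuclideanSpace.single j 1)) y := by
        have h1 : ContDiffAt ℝ ∞ (fun z => χ (f.symm z)) y :=
          ((χ.contMDiff.comp_contMDiffOn hfs).contDiffOn).contDiffAt (f.open_target.mem_nhds hy)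
        have h2 : ContDiffAt ℝ ∞ (fderiv ℝ (fun z => e (f.symm z) i)) y :=
          (htr.contDiffAt (hW.mem_nhds hyW)).fderiv_right (by simp)
        exact h1.mul (h2.clm_apply contDiffAt_const)
      refine hd.congr_of_eventuallyEq ?_
      filter_upwards [hW.mem_nhds hyW] with z hz
      have hm1 : MDifferentiableAt (𝓡 n) 𝓘(ℝ, ℝ) (fun p => e p i) (f.symm z) :=
        (hcoord.contMDiffAt (e.open_source.mem_nhds hz.2)).mdifferentiableAt (by simp)
      have hm2 : MDifferentiableAt (𝓡 n) (𝓡 n) f.symm z :=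
        (hfs.contMDiffAt (f.open_target.mem_nhds hz.1)).mdifferentiableAt (by simp)
      have hc := mfderiv_comp z hm1 hm2
      have hc' : fderiv ℝ (fun z => e (f.symm z) i) z =
          mfderiv (𝓡 n) 𝓘(ℝ, ℝ) ((fun p => e p i) ∘ f.symm) z := mfderiv_eq_fderiv.symm
      rw [hc', hc]
      rfl
    · refine (contDiffAt_const (c := (0 : ℝ))).congr_of_eventuallyEq ?_
      have h0 : ∀ᶠ z in 𝓝 y, f.symm z ∈ (tsupport χ)ᶜ :=
        hfc ((isClosed_tsupport χ).isOpen_compl.mem_nhds hs)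
      filter_upwards [h0] with z hz
      have : χ (f.symm z) = 0 := image_eq_zero_of_notMem_tsupport hz
      simp [this]
  · filter_upwards [χ.eventuallyEq_one] with p hp
    rw [hp]
    exact one_smul ℝ _

/-- A 1-form on `M` that equals `dx^i` near the point `x` of the chart `e`. -/
def coordForm [IsManifold (𝓡 n) ∞ M] [T2Space M]
    (e : OpenPartialHomeomorph M (EuclideanSpace ℝ (Fin n))) (x : M) (i : Fin n) : OneForm n M :=
  open Classical in
  if h : e ∈ smoothCharts n M ∧ x ∈ e.source then
    (exists_oneForm_eventuallyEq h.1 h.2 i).choose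
  else 0

/-- The bracket `{f, g} = B(df, dg)` of functions defined by a field `B` of bilinear forms on the
cotangent spaces. -/
def functionBracket (B : ∀ x : M, Cot n x →ₗ[ℝ] Cot n x →ₗ[ℝ] ℝ) (f g : M → ℝ) (x : M) : ℝ :=
  B x (differential n f x) (differential n g x)

/-- A Poisson structure on `M`: a smooth bivector field `Π` such that `{f, g} = Π(df, dg)`
satisfies the Jacobi identity. -/
structure PoissonStructure (n : ℕ) (M : Type*) [TopologicalSpace M]
    [ChartedSpace (EuclideanSpace ℝ (Fin n)) M] where
  toFun : ∀ x : M, Cot n x →ₗ[ℝ] Cot n x →ₗ[ℝ] ℝ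
  alternating' : ∀ (x : M) (η : Cot n x), toFun x η η = 0
  smooth' : ∀ e ∈ smoothCharts n M, ∀ i j : Fin n,
    ContDiffOn ℝ ∞ (fun y => toFun (e.symm y) (coordCovector e i (e.symm y))
      (coordCovector e j (e.symm y))) e.target
  jacobi' : ∀ (f g h : C^∞⟮𝓡 n, M; ℝ⟯) (x : M),
    functionBracket toFun f (functionBracket toFun g h) x
      + functionBracket toFun g (functionBracket toFun h f) x
      + functionBracket toFun h (functionBracket toFun f g) x = 0

namespace PoissonStructure

instance : CoeFun (PoissonStructure n M)
    (fun _ => ∀ x : M, Cot n x →ₗ[ℝ] Cot n x →ₗ[ℝ] ℝ) := ⟨PoissonStructure.toFun⟩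

/-- The components `π^{ij} = Π(dx^i, dx^j)` in a chart. -/
def coeff (P : PoissonStructure n M) (e : OpenPartialHomeomorph M (EuclideanSpace ℝ (Fin n)))
    (i j : Fin n) (y : EuclideanSpace ℝ (Fin n)) : ℝ :=
  P (e.symm y) (coordCovector e i (e.symm y)) (coordCovector e j (e.symm y))

end PoissonStructure

/-- A contravariant connection on `T*M`, i.e. a biadditive map `(α, β) ↦ ∇^α β` with
`∇^{fα} β = f ∇^α β` and `∇^α (fβ) = f ∇^α β + (#α)(f) β`, where `(#α)(f) = Π(α, df)`. -/
structure ContravariantConnection (P : PoissonStructure n M) where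
  toFun : OneForm n M → OneForm n M → OneForm n M
  add_left' : ∀ α α' β : OneForm n M, toFun (α + α') β = toFun α β + toFun α' β
  add_right' : ∀ α β β' : OneForm n M, toFun α (β + β') = toFun α β + toFun α β'
  smul_left' : ∀ (f : C^∞⟮𝓡 n, M; ℝ⟯) (α β : OneForm n M), toFun (f • α) β = f • toFun α β
  leibniz' : ∀ (f : C^∞⟮𝓡 n, M; ℝ⟯) (α β : OneForm n M) (x : M),
    toFun α (f • β) x = f x • toFun α β x + P x (α x) (differential n f x) • β x

namespace ContravariantConnection

variable {P : PoissonStructure n M}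

instance : CoeFun (ContravariantConnection P)
    (fun _ => OneForm n M → OneForm n M → OneForm n M) := ⟨ContravariantConnection.toFun⟩

/-- The Christoffel symbols `Γ^{ij}_k` in a chart: `∇^{dx^i} dx^j = - Γ^{ij}_k dx^k`. -/
def christoffel [IsManifold (𝓡 n) ∞ M] [T2Space M] (D : ContravariantConnection P)
    (e : OpenPartialHomeomorph M (EuclideanSpace ℝ (Fin n)))
    (i j k : Fin n) (y : EuclideanSpace ℝ (Fin n)) : ℝ :=
  - (D (coordForm e (e.symm y) i) (coordForm e (e.symm y) j)).coeff e k y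

/-- The torsion `∇^α β - ∇^β α - [α, β]` vanishes. -/
def TorsionFree (D : ContravariantConnection P) : Prop :=
  ∀ α β : OneForm n M, ∀ e ∈ smoothCharts n M, ∀ y ∈ e.target, ∀ k : Fin n,
    (D α β).coeff e k y - (D β α).coeff e k y
      - bracketCoeff (P.coeff e) (α.coeff e) (β.coeff e) k y = 0

/-- The connections `D = ∇` and `D' = †∇` are associated:
`†∇^α #β - ∇^β #α - #[α, β] = 0` for all 1-forms `α`, `β`, where both connections act on vector
fields through the dual connections. -/
def Associated [IsManifold (𝓡 n) ∞ M] [T2Space M] (D D' : ContravariantConnection P) : Prop :=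
  ∀ α β : OneForm n M, ∀ e ∈ smoothCharts n M, ∀ y ∈ e.target, ∀ k : Fin n,
    connVectorCoeff (P.coeff e) (D'.christoffel e) (α.coeff e)
        (sharpCoeff (P.coeff e) (β.coeff e)) k y
      - connVectorCoeff (P.coeff e) (D.christoffel e) (β.coeff e)
        (sharpCoeff (P.coeff e) (α.coeff e)) k y
      - sharpCoeff (P.coeff e) (bracketCoeff (P.coeff e) (α.coeff e) (β.coeff e)) k y = 0

end ContravariantConnection

/-! ### Formal objects on the formal neighbourhood `(T*M, Z)` of the zero section

The tangent space of the fibre `T*_x M` at any of its points is `T*_x M` itself.  Formal functions,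
vertical vector fields and vertical 1-forms are given by the sequence of their components
`s ↦ F^{(s)}` that are homogeneous of degree `s` in the fibre variable `ξ ∈ T*_x M`. -/

/-- The carrier of formal functions on `(T*M, Z)`. -/
abbrev FormalFn (n : ℕ) (M : Type*) [TopologicalSpace M]
    [ChartedSpace (EuclideanSpace ℝ (Fin n)) M] : Type _ :=
  ℕ → ∀ x : M, Cot n x → ℝ

/-- The carrier of vertical formal vector fields on `(T*M, Z)`. -/
abbrev VerticalField (n : ℕ) (M : Type*) [TopologicalSpace M]
    [ChartedSpace (EuclideanSpace ℝ (Fin n)) M] : Type _ :=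
  ℕ → ∀ x : M, Cot n x → Cot n x

/-- The expression of a formal function in a chart and the dual fibre coordinates. -/
def FormalFn.inChart (F : FormalFn n M)
    (e : OpenPartialHomeomorph M (EuclideanSpace ℝ (Fin n))) : LocalFormal n :=
  fun s y ξ => F s (e.symm y) (covectorOf e (e.symm y) ξ)

/-- The derivative at `ξ` of the component `F^{(s)}` along the fibre, in the direction `η`. -/
def FormalFn.fibreDeriv (F : FormalFn n M) (s : ℕ) (x : M) (ξ η : Cot n x) : ℝ :=
  deriv (fun t : ℝ => F s x (ξ + t • η)) 0

/-- Global vertical 1-forms `U` on `(T*M, Z)`; the component `U^{(s)}` at `ξ ∈ T*_x M` is a linear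
functional on the vertical tangent space `T*_x M`.  The functions `⟨U, ∂/∂ξ_i⟩` have to be formal
functions in every chart. -/
@[ext]
structure VerticalOneForm (n : ℕ) (M : Type*) [TopologicalSpace M]
    [ChartedSpace (EuclideanSpace ℝ (Fin n)) M] where
  toFun : ℕ → ∀ x : M, Cot n x → (Cot n x →ₗ[ℝ] ℝ)
  formal' : ∀ e ∈ smoothCharts n M, ∀ i : Fin n, IsFormalOn e.target
    (FormalFn.inChart (fun s x ξ => toFun s x ξ (coordCovector e i x)) e)

/-- The vertical vector field `α̂ = α_i ∂/∂ξ_i` of degree `0` in `ξ` defined by a 1-form. -/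
def OneForm.hat (α : OneForm n M) : VerticalField n M :=
  fun s x _ => if s = 0 then α x else 0

/-- The fibrewise Euler vector field `𝓔 = ξ_k ∂/∂ξ_k`. -/
def eulerField (n : ℕ) (M : Type*) [TopologicalSpace M]
    [ChartedSpace (EuclideanSpace ℝ (Fin n)) M] : VerticalField n M :=
  fun s _ ξ => if s = 1 then ξ else 0

namespace VerticalOneForm

/-- The formal function `⟨U, X⟩`. -/
def pairing (U : VerticalOneForm n M) (X : VerticalField n M) : FormalFn n M :=
  fun s x ξ => ∑ p ∈ Finset.HasAntidiagonal.antidiagonal s, U.toFun p.1 x ξ (X p.2 x ξ)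

/-- `U(α) = ⟨U, α̂⟩`. -/
def eval (U : VerticalOneForm n M) (α : OneForm n M) : FormalFn n M :=
  U.pairing α.hat

/-- The expression in a chart of `U(dx^k) = ⟨U, ∂/∂ξ_k⟩`. -/
def coeff (U : VerticalOneForm n M) (e : OpenPartialHomeomorph M (EuclideanSpace ℝ (Fin n)))
    (k : Fin n) : LocalFormal n :=
  FormalFn.inChart (fun s x ξ => U.toFun s x ξ (coordCovector e k x)) e

end VerticalOneForm

namespace PoissonStructure

/-- `X` is, on the fibre over `x`, a Hamiltonian vector field of `F` for the fibrewise presymplectic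
form `Ω = ½ π^{ij} dξ_i ∧ dξ_j`, that is, `ι(X) Ω = - d_ξ F`.  On vertical vectors `Ω` is `Π`. -/
def IsHamiltonianAt (P : PoissonStructure n M) (F : FormalFn n M) (x : M)
    (X : ℕ → Cot n x → Cot n x) : Prop :=
  ∀ (s : ℕ) (ξ η : Cot n x), P x (X s ξ) η = - F.fibreDeriv (s + 1) x ξ η

/-- The Poisson bracket `{F, G}_Ω = H_F G` of Hamiltonian functions of `Ω`, where `H_F` is any
Hamiltonian vector field of `F`.  For Hamiltonian `F`, `G` the value does not depend on the choice
of `H_F`, so the choice can be made fibre by fibre. -/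
def bracketOmega (P : PoissonStructure n M) (F G : FormalFn n M) : FormalFn n M :=
  open Classical in
  fun s x ξ =>
    if h : ∃ X : ℕ → Cot n x → Cot n x, P.IsHamiltonianAt F x X then
      ∑ p ∈ Finset.HasAntidiagonal.antidiagonal s, G.fibreDeriv (p.2 + 1) x ξ (h.choose p.1 ξ)
    else 0

end PoissonStructure

/-- The Fundamental Equation
`Π(α, β) = Q̄(α, β) - ∇̄^α U(β) + ∇̄^β U(α) + U([α, β]) + {U(α), U(β)}_Ω`
for all 1-forms `α`, `β` on `M`, as an equality of formal functions on `(T*M, Z)`. -/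
def FundamentalEquation [IsManifold (𝓡 n) ∞ M] [T2Space M] {P : PoissonStructure n M}
    (D : ContravariantConnection P) (U : VerticalOneForm n M) : Prop :=
  ∀ α β : OneForm n M, ∀ e ∈ smoothCharts n M, ∀ y ∈ e.target, ∀ (s : ℕ) (ξ : Fin n → ℝ),
    (if s = 0 then P (e.symm y) (α (e.symm y)) (β (e.symm y)) else 0) =
      qBar (P.coeff e) (D.christoffel e) (α.coeff e) (β.coeff e) s y ξ
      - nablaBar (P.coeff e) (D.christoffel e) (α.coeff e) ((U.eval β).inChart e) s y ξ
      + nablaBar (P.coeff e) (D.christoffel e) (β.coeff e) ((U.eval α).inChart e) s y ξ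
      + (∑ k, bracketCoeff (P.coeff e) (α.coeff e) (β.coeff e) k y * U.coeff e k s y ξ)
      + (P.bracketOmega (U.eval α) (U.eval β)).inChart e s y ξ

/-- The families `u k = u_k` and `v i k = v^i_k` of formal functions over the chart `e` are local
potentials of `U`:
`π^{is} v^j_s = π^{js} ∂u_s/∂ξ_i`, `U(dx^i) = π^{ik} u_k`, `u_k = - ξ_k (mod ξ²)` and
`v^i_k = δ^i_k (mod ξ)`. -/
structure IsLocalPotential (P : PoissonStructure n M) (U : VerticalOneForm n M)
    (e : OpenPartialHomeomorph M (EuclideanSpace ℝ (Fin n)))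
    (u : Fin n → LocalFormal n) (v : Fin n → Fin n → LocalFormal n) : Prop where
  formal_u : ∀ k, IsFormalOn e.target (u k)
  formal_v : ∀ i k, IsFormalOn e.target (v i k)
  compatible : ∀ (i j : Fin n) (d : ℕ), ∀ y ∈ e.target, ∀ ξ : Fin n → ℝ,
    ∑ s, P.coeff e i s y * v j s d y ξ = ∑ s, P.coeff e j s y * (u s).dFibre i d y ξ
  eval_eq : ∀ (i : Fin n) (d : ℕ), ∀ y ∈ e.target, ∀ ξ : Fin n → ℝ,
    U.coeff e i d y ξ = ∑ k, P.coeff e i k y * u k d y ξ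
  u_zero : ∀ k : Fin n, ∀ y ∈ e.target, ∀ ξ : Fin n → ℝ, u k 0 y ξ = 0
  u_one : ∀ k : Fin n, ∀ y ∈ e.target, ∀ ξ : Fin n → ℝ, u k 1 y ξ = - ξ k
  v_zero : ∀ i k : Fin n, ∀ y ∈ e.target, ∀ ξ : Fin n → ℝ,
    v i k 0 y ξ = if i = k then 1 else 0

/-- `U` has local potentials on a covering of `M` by coordinate charts. -/
def HasLocalPotentials (P : PoissonStructure n M) (U : VerticalOneForm n M) : Prop :=
  ∀ x : M, ∃ e ∈ smoothCharts n M, x ∈ e.source ∧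
    ∃ (u : Fin n → LocalFormal n) (v : Fin n → Fin n → LocalFormal n),
      IsLocalPotential P U e u v

/-- The normalization condition `⟨U, 𝓔⟩ = 0`. -/
def IsNormalized (U : VerticalOneForm n M) : Prop :=
  ∀ (s : ℕ) (x : M) (ξ : Cot n x), U.pairing (eulerField n M) s x ξ = 0

end Global

end

end FormalPoisson

/-! Write U_j = U(dx^j), and let the defect E_{jk} be the right side minus the left side of the
Fundamental Equation on dx^j, dx^k. Since U_j = -π^{jk} ξ_k + ..., its Hamiltonian field is ∂/∂ξ_j +
.... Hence a change δU of U in fibre degree N+1 ≥ 2 changes E in degree N exactly by the fibrewise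
differential d_ξ δU, and all its other effects are of higher degree. The equation can thus be solved
degree by degree as soon as the lowest component C of E is d_ξ-closed: the Poincaré lemma for the
Euler field gives δU = -ι(𝓔)C/(N+2), and ⟨δU, 𝓔⟩ = 0 comes for free.

Closedness of C is the lowest part of a Bianchi identity for E, `Compatible.defect_bianchi`.
Association and absence of torsion together say that ∇̄ preserves Ω (`nab_pi`). Therefore the
curvature of ∇̄ is a Hamiltonian vertical field with Hamiltonian Q̄ (`curvTensor_symm`, `fd_Q`), and
∇̄ is a derivation of the fibrewise bracket (`Compatible.nab_ham`). With the Bianchi identities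
`curv_bianchi`, `Q_bianchi` and the Jacobi identities of π and of the fibrewise bracket, the cyclic
sum cancels.

Since π may be degenerate, an arbitrary δU would destroy the local potentials. However, E_{ij} =
π^{jk} c_{ik} for suitable c (`Compatible.inImage_defect`, again by association), and c yields the
corrections of u and of v (`IsGeometric.exists_next`). The limit of these corrections is a solution
over the chart (`IsGeometric.exists_solution`).

For uniqueness, the component U^{(N+1)} enters degree N of the equation only through the bracket. At
ξ = α(x) Euler's identity and the normalization turn its contribution into (N+2) U^{(N+1)}(ξ)(β)
(`IsAdmissibleAt.bracket_sub`), so the lower components determine it. This argument is local. It is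
applied to a chart-free form of the equation, obtained by evaluating along sections Ξ of T*M
(`defectOn`, `feDefect_section`). So solutions over different charts agree on overlaps and glue
(`exists_global_solution`), and the same argument on all of M gives uniqueness. -/

namespace FormalPoisson

noncomputable section

/-! ### Algebra of the connection ∇̄, its curvature and Q̄ in coordinates. -/

/-- Commuting base and fibre derivations on a commutative algebra, with fibre coordinates, a Poisson
tensor and the Christoffel symbols of two associated connections, the second one torsion-free. -/
structure FibreCalculus (ι H : Type*) [Fintype ι] [DecidableEq ι] [CommRing H] [Algebra ℝ H] where
  bd : ι → Derivation ℝ H H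
  fd : ι → Derivation ℝ H H
  xi : ι → H
  π : ι → ι → H
  Γ : ι → ι → ι → H
  Γ' : ι → ι → ι → H
  bd_comm : ∀ i j F, bd i (bd j F) = bd j (bd i F)
  fd_comm : ∀ i j F, fd i (fd j F) = fd j (fd i F)
  fd_bd : ∀ i j F, fd i (bd j F) = bd j (fd i F)
  fd_xi : ∀ i j, fd i (xi j) = if i = j then 1 else 0
  bd_xi : ∀ i j, bd i (xi j) = 0
  fd_π : ∀ s i j, fd s (π i j) = 0
  fd_Γ : ∀ s i j k, fd s (Γ i j k) = 0
  antisymm : ∀ i j, π i j = - π j i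
  jacobi : ∀ i j k, ∑ l, π i l * bd l (π j k) + ∑ l, π j l * bd l (π k i)
    + ∑ l, π k l * bd l (π i j) = 0
  assoc : ∀ i j k, ∑ l, π i l * Γ j k l = ∑ l, π j l * Γ' i k l
  torsion : ∀ i j k, Γ' j i k - Γ' i j k = bd k (π i j)

namespace FibreCalculus

variable {ι H : Type*} [Fintype ι] [DecidableEq ι] [CommRing H] [Algebra ℝ H]
  (S : FibreCalculus ι H)

/-- The value `∇̄^i ξ_k = Γ^{ij}_k ξ_j`. -/
def G (i k : ι) : H := ∑ j, S.Γ i j k * S.xi j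

/-- The derivation `∇̄^i`. -/
def nab (i : ι) : Derivation ℝ H H := ∑ j, S.π i j • S.bd j + ∑ k, S.G i k • S.fd k

theorem sum_derivation_apply {κ : Type*} (s : Finset κ) (f : κ → Derivation ℝ H H) (F : H) :
    (∑ j ∈ s, f j) F = ∑ j ∈ s, f j F := by
  classical
  induction s using Finset.induction_on with
  | empty => simp
  | insert a s ha ih => rw [Finset.sum_insert ha, Finset.sum_insert ha, Derivation.add_apply, ih]

theorem nab_apply (i : ι) (F : H) :
    S.nab i F = ∑ j, S.π i j * S.bd j F + ∑ k, S.G i k * S.fd k F := by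
  simp [nab, sum_derivation_apply]

theorem nab_base (i : ι) {F : H} (hF : ∀ k, S.fd k F = 0) :
    S.nab i F = ∑ j, S.π i j * S.bd j F := by
  simp [nab_apply, hF]

theorem fd_nab_base (s i : ι) {F : H} (hF : ∀ k, S.fd k F = 0) : S.fd s (S.nab i F) = 0 := by
  rw [S.nab_base i hF]
  simp [map_sum, S.fd_bd, hF, S.fd_π]

theorem fd_bd_pi (s l i j : ι) : S.fd s (S.bd l (S.π i j)) = 0 := by
  simp [S.fd_bd, S.fd_π]

theorem nab_xi (i k : ι) : S.nab i (S.xi k) = S.G i k := by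
  simp [nab_apply, S.bd_xi, S.fd_xi]

theorem fd_G (s i k : ι) : S.fd s (S.G i k) = S.Γ i s k := by
  simp [G, map_sum, S.fd_Γ, S.fd_xi]

theorem fd_nab (s i : ι) (F : H) :
    S.fd s (S.nab i F) = S.nab i (S.fd s F) + ∑ l, S.Γ i s l * S.fd l F := by
  simp only [nab_apply, map_add, map_sum, Derivation.leibniz, smul_eq_mul, S.fd_π, S.fd_G, S.fd_bd,
    mul_zero, add_zero, Finset.sum_add_distrib, S.fd_comm s]
  simp only [mul_comm (S.fd _ F)]
  ring

/-- In other words, ∇̄^i preserves Ω. The torsion identity writes the derivatives of π as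
differences of Γ', and association turns each contraction of π with Γ' into one of π with Γ. -/
theorem nab_pi (i k l : ι) :
    S.nab i (S.π k l) = ∑ m, S.Γ i k m * S.π l m - ∑ m, S.Γ i l m * S.π k m := by
  rw [S.nab_base i fun s => S.fd_π s k l]
  simp only [← S.torsion, mul_sub, Finset.sum_sub_distrib, ← S.assoc]
  simp only [mul_comm]

/-- The Jacobi identity in the form [#dx^j, #dx^k] = #[dx^j, dx^k]. -/
theorem nab_pi_sub (j k m : ι) :
    S.nab j (S.π k m) - S.nab k (S.π j m) = ∑ l, S.bd l (S.π j k) * S.π l m := by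
  rw [S.nab_base j fun s => S.fd_π s k m, S.nab_base k fun s => S.fd_π s j m]
  have h := S.jacobi j k m
  have h1 : ∀ l, S.bd l (S.π m j) = - S.bd l (S.π j m) := fun l => by rw [S.antisymm m j, map_neg]
  have h2 : ∑ l, S.π m l * S.bd l (S.π j k) = - ∑ l, S.bd l (S.π j k) * S.π l m := by
    rw [← Finset.sum_neg_distrib]
    exact Finset.sum_congr rfl fun l _ => by rw [S.antisymm m l]; ring
  simp only [h1, h2, mul_neg, Finset.sum_neg_distrib] at h
  linear_combination h

/-- The components `R_b` of the curvature `R^{jk} = [∇̄^j, ∇̄^k] - ∇̄^{[dx^j, dx^k]}`. -/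
def curv (j k b : ι) : H :=
  S.nab j (S.G k b) - S.nab k (S.G j b) - ∑ l, S.bd l (S.π j k) * S.G l b

/-- The curvature tensor: `R^{jk}_b = ξ_a K^{jk,a}_b`. -/
def curvTensor (j k a b : ι) : H :=
  S.nab j (S.Γ k a b) - S.nab k (S.Γ j a b) + ∑ l, S.Γ j a l * S.Γ k l b
    - ∑ l, S.Γ k a l * S.Γ j l b - ∑ l, S.bd l (S.π j k) * S.Γ l a b

/-- These are the second-order terms of ∇̄^j ∇̄^k F, symmetric in j and k because all base and fibre
derivations commute; the commutator is therefore of first order. -/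
theorem secondOrder_symm (j k : ι) (F : H) :
    ∑ m, S.π k m * S.nab j (S.bd m F) + ∑ b, S.G k b * S.nab j (S.fd b F) =
      ∑ m, S.π j m * S.nab k (S.bd m F) + ∑ b, S.G j b * S.nab k (S.fd b F) := by
  simp only [nab_apply, mul_add, Finset.mul_sum, Finset.sum_add_distrib]
  have h1 : ∑ x, ∑ y, S.π k x * (S.π j y * S.bd y (S.bd x F)) =
      ∑ x, ∑ y, S.π j x * (S.π k y * S.bd y (S.bd x F)) := by
    rw [Finset.sum_comm]
    refine Finset.sum_congr rfl fun x _ => Finset.sum_congr rfl fun y _ => ?_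
    rw [S.bd_comm]; ring
  have h2 : ∑ x, ∑ y, S.G k x * (S.G j y * S.fd y (S.fd x F)) =
      ∑ x, ∑ y, S.G j x * (S.G k y * S.fd y (S.fd x F)) := by
    rw [Finset.sum_comm]
    refine Finset.sum_congr rfl fun x _ => Finset.sum_congr rfl fun y _ => ?_
    rw [S.fd_comm]; ring
  have h3 : ∀ j k, ∑ x, ∑ y, S.π k x * (S.G j y * S.fd y (S.bd x F)) =
      ∑ x, ∑ y, S.G j x * (S.π k y * S.bd y (S.fd x F)) := by
    intro j k
    rw [Finset.sum_comm]
    refine Finset.sum_congr rfl fun x _ => Finset.sum_congr rfl fun y _ => ?_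
    rw [S.fd_bd]; ring
  rw [h1, h2, h3, h3]
  ring

/-- The base components of the commutator cancel against the bracket term by `nab_pi_sub`, so the
curvature is vertical. -/
theorem curv_apply (j k : ι) (F : H) :
    S.nab j (S.nab k F) - S.nab k (S.nab j F) - ∑ l, S.bd l (S.π j k) * S.nab l F =
      ∑ b, S.curv j k b * S.fd b F := by
  have e : ∀ j k, S.nab j (S.nab k F) = ∑ m, S.nab j (S.π k m) * S.bd m F
      + ∑ b, S.nab j (S.G k b) * S.fd b F
      + (∑ m, S.π k m * S.nab j (S.bd m F) + ∑ b, S.G k b * S.nab j (S.fd b F)) := by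
    intro j k
    rw [S.nab_apply k F]
    simp only [map_add, map_sum, Derivation.leibniz, smul_eq_mul, Finset.sum_add_distrib]
    simp only [mul_comm (S.bd _ F), mul_comm (S.fd _ F)]
    ring
  have e2 : ∑ l, S.bd l (S.π j k) * S.nab l F =
      ∑ m, (∑ l, S.bd l (S.π j k) * S.π l m) * S.bd m F
      + ∑ b, (∑ l, S.bd l (S.π j k) * S.G l b) * S.fd b F := by
    simp only [nab_apply, mul_add, Finset.mul_sum, Finset.sum_mul, Finset.sum_add_distrib]
    congr 1 <;>
    · rw [Finset.sum_comm]
      exact Finset.sum_congr rfl fun x _ => Finset.sum_congr rfl fun y _ => by ring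
  rw [e j k, e k j, S.secondOrder_symm j k, e2]
  simp only [← nab_pi_sub, curv, sub_mul, Finset.sum_sub_distrib]
  ring

theorem nab_G (j k b : ι) :
    S.nab j (S.G k b) = ∑ a, S.xi a * (S.nab j (S.Γ k a b) + ∑ l, S.Γ j a l * S.Γ k l b) := by
  have h : ∑ a, S.Γ k a b * S.G j a = ∑ a, S.xi a * ∑ l, S.Γ j a l * S.Γ k l b := by
    simp only [G, Finset.mul_sum]
    rw [Finset.sum_comm]
    exact Finset.sum_congr rfl fun x _ => Finset.sum_congr rfl fun y _ => by ring
  conv_lhs => rw [G]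
  simp only [map_sum, Derivation.leibniz, smul_eq_mul, nab_xi, Finset.sum_add_distrib, mul_add, h]
  ring

theorem curv_eq (j k b : ι) : S.curv j k b = ∑ a, S.xi a * S.curvTensor j k a b := by
  have h : ∑ l, S.bd l (S.π j k) * S.G l b =
      ∑ a, S.xi a * ∑ l, S.bd l (S.π j k) * S.Γ l a b := by
    simp only [G, Finset.mul_sum]
    rw [Finset.sum_comm]
    exact Finset.sum_congr rfl fun x _ => Finset.sum_congr rfl fun y _ => by ring
  rw [curv, nab_G, nab_G, h, ← Finset.sum_sub_distrib, ← Finset.sum_sub_distrib]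
  exact Finset.sum_congr rfl fun x _ => by rw [curvTensor]; ring

theorem fd_curvTensor (s j k a b : ι) : S.fd s (S.curvTensor j k a b) = 0 := by
  simp [curvTensor, map_sum, S.fd_nab_base s _ fun t => S.fd_Γ t _ _ _, S.fd_Γ, S.fd_bd_pi]

theorem fd_curv (s j k b : ι) : S.fd s (S.curv j k b) = S.curvTensor j k s b := by
  simp [curv_eq, map_sum, S.fd_curvTensor, S.fd_xi]

/-- The curvature is infinitesimally symplectic for Ω. The vertical field R kills π^{st}, so
`curv_apply` on π^{st} gives zero, while expanding both derivatives by `nab_pi` gives the difference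
of the two sides. -/
theorem curvTensor_symm (j k s t : ι) :
    ∑ r, S.π t r * S.curvTensor j k s r = ∑ r, S.π s r * S.curvTensor j k t r := by
  have key := S.curv_apply j k (S.π s t)
  simp only [S.fd_π, mul_zero, Finset.sum_const_zero] at key
  have hB : ∀ j k s t, S.nab j (∑ m, S.Γ k s m * S.π t m) =
      ∑ m, S.π t m * S.nab j (S.Γ k s m)
        + ∑ m, ∑ r, S.Γ k s m * S.Γ j t r * S.π m r
        - ∑ m, S.π t m * ∑ r, S.Γ k s r * S.Γ j r m := by
    intro j k s t
    have h : ∑ m, S.π t m * ∑ r, S.Γ k s r * S.Γ j r m =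
        ∑ m, ∑ r, S.Γ k s m * S.Γ j m r * S.π t r := by
      simp only [Finset.mul_sum]
      rw [Finset.sum_comm]
      exact Finset.sum_congr rfl fun x _ => Finset.sum_congr rfl fun y _ => by ring
    rw [h]
    simp only [map_sum, Derivation.leibniz, smul_eq_mul, nab_pi, Finset.sum_add_distrib, mul_sub,
      Finset.mul_sum, Finset.sum_sub_distrib, ← mul_assoc]
    ring
  -- The terms with two Christoffel symbols on different indices of π change sign under (j,t) ↔
  -- (k,s), so they drop out of the commutator.
  have hX : ∀ j k s t, ∑ m, ∑ r, S.Γ k s m * S.Γ j t r * S.π m r =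
      - ∑ m, ∑ r, S.Γ j t m * S.Γ k s r * S.π m r := by
    intro j k s t
    rw [Finset.sum_comm, ← Finset.sum_neg_distrib]
    refine Finset.sum_congr rfl fun x _ => ?_
    rw [← Finset.sum_neg_distrib]
    exact Finset.sum_congr rfl fun y _ => by rw [S.antisymm y x]; ring
  have hL : ∀ s t, ∑ l, S.bd l (S.π j k) * ∑ m, S.Γ l s m * S.π t m =
      ∑ m, S.π t m * ∑ l, S.bd l (S.π j k) * S.Γ l s m := by
    intro s t
    simp only [Finset.mul_sum]
    rw [Finset.sum_comm]
    exact Finset.sum_congr rfl fun x _ => Finset.sum_congr rfl fun y _ => by ring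
  simp only [nab_pi, map_sub, hB, mul_sub, Finset.sum_sub_distrib, hL] at key
  simp only [curvTensor, mul_sub, mul_add, Finset.sum_sub_distrib, Finset.sum_add_distrib]
  rw [hX j k s t, hX k j s t] at key
  linear_combination key

/-- The components `ξ_a π^{ab}` of `ι(𝓔) Ω`. -/
def eulerForm (b : ι) : H := ∑ a, S.xi a * S.π a b

theorem fd_eulerForm (s b : ι) : S.fd s (S.eulerForm b) = S.π s b := by
  simp [eulerForm, map_sum, S.fd_π, S.fd_xi]

/-- ∇̄ is linear along the fibres, hence commutes with 𝓔, and it preserves Ω; so ι(𝓔)Ω is parallel.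
-/
theorem nab_eulerForm (i b : ι) : S.nab i (S.eulerForm b) = - ∑ m, S.Γ i b m * S.eulerForm m := by
  have h1 : ∑ a, S.π a b * S.G i a = - ∑ a, S.xi a * ∑ m, S.Γ i a m * S.π b m := by
    simp only [G, Finset.mul_sum, ← Finset.sum_neg_distrib]
    rw [Finset.sum_comm]
    exact Finset.sum_congr rfl fun x _ => Finset.sum_congr rfl fun y _ => by
      rw [S.antisymm y b]; ring
  have h2 : ∑ m, S.Γ i b m * S.eulerForm m = ∑ a, S.xi a * ∑ m, S.Γ i b m * S.π a m := by
    simp only [eulerForm, Finset.mul_sum]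
    rw [Finset.sum_comm]
    exact Finset.sum_congr rfl fun x _ => Finset.sum_congr rfl fun y _ => by ring
  rw [h2]
  simp only [eulerForm, map_sum, Derivation.leibniz, smul_eq_mul, nab_xi, nab_pi, mul_sub,
    Finset.sum_add_distrib, Finset.sum_sub_distrib, h1]
  ring

/-- `Q̄(dx^j, dx^k)`. -/
def Q (j k : ι) : H := (1 / 2 : ℝ) • ∑ b, S.eulerForm b * S.curv j k b

/-- R is the Hamiltonian field of Q̄. By the symmetry of the curvature the two factors of the
quadratic function ½Ω(𝓔, R) contribute equally to the derivative, which absorbs the ½. -/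
theorem fd_Q (s j k : ι) : S.fd s (S.Q j k) = ∑ b, S.π s b * S.curv j k b := by
  have h : ∑ b, S.eulerForm b * S.curvTensor j k s b = ∑ b, S.π s b * S.curv j k b := by
    calc ∑ b, S.eulerForm b * S.curvTensor j k s b
        = ∑ a, S.xi a * ∑ b, S.π a b * S.curvTensor j k s b := by
          simp only [eulerForm, Finset.mul_sum, Finset.sum_mul]
          rw [Finset.sum_comm]
          exact Finset.sum_congr rfl fun x _ => Finset.sum_congr rfl fun y _ => by ring
      _ = ∑ a, S.xi a * ∑ b, S.π s b * S.curvTensor j k a b := by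
          simp only [S.curvTensor_symm j k s]
      _ = _ := by
          simp only [curv_eq, Finset.mul_sum]
          rw [Finset.sum_comm]
          exact Finset.sum_congr rfl fun x _ => Finset.sum_congr rfl fun y _ => by ring
  rw [Q, Derivation.map_smul]
  simp only [map_sum, Derivation.leibniz, smul_eq_mul, S.fd_curv, S.fd_eulerForm,
    Finset.sum_add_distrib, h]
  simp only [mul_comm (S.curv j k _)]
  rw [← two_smul ℝ, smul_smul]
  norm_num

/-- The Jacobi identity for the bracket of coordinate 1-forms, obtained by differentiating the one
for π. -/
theorem bd_jacobi (i j k m : ι) :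
    (S.nab i (S.bd m (S.π j k)) - ∑ l, S.bd l (S.π i j) * S.bd m (S.π l k))
    + (S.nab j (S.bd m (S.π k i)) - ∑ l, S.bd l (S.π j k) * S.bd m (S.π l i))
    + (S.nab k (S.bd m (S.π i j)) - ∑ l, S.bd l (S.π k i) * S.bd m (S.π l j)) = 0 := by
  have h := congrArg (S.bd m) (S.jacobi i j k)
  have e : ∀ i j k, S.bd m (∑ l, S.π i l * S.bd l (S.π j k)) =
      S.nab i (S.bd m (S.π j k)) - ∑ l, S.bd l (S.π j k) * S.bd m (S.π l i) := by
    intro i j k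
    rw [S.nab_base i fun s => S.fd_bd_pi s m j k, ← Finset.sum_sub_distrib, map_sum]
    refine Finset.sum_congr rfl fun l _ => ?_
    rw [Derivation.leibniz, S.bd_comm, S.antisymm l i, map_neg]
    simp only [smul_eq_mul]
    ring
  simp only [map_add, map_zero, e] at h
  linear_combination h

/-- The Jacobi identity for commutators of the operators ∇̄, evaluated on ξ_b; `bd_jacobi` disposes
of the iterated brackets of coordinate forms. -/
theorem curv_bianchi (i j k b : ι) :
    (S.nab i (S.curv j k b) - ∑ c, S.Γ i c b * S.curv j k c
      - ∑ l, S.bd l (S.π i j) * S.curv l k b)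
    + (S.nab j (S.curv k i b) - ∑ c, S.Γ j c b * S.curv k i c
      - ∑ l, S.bd l (S.π j k) * S.curv l i b)
    + (S.nab k (S.curv i j b) - ∑ c, S.Γ k c b * S.curv i j c
      - ∑ l, S.bd l (S.π k i) * S.curv l j b) = 0 := by
  have hN : ∀ i j k, S.nab i (S.curv j k b) = S.nab i (S.nab j (S.G k b))
      - S.nab i (S.nab k (S.G j b)) - ∑ l, S.nab i (S.bd l (S.π j k)) * S.G l b
      - ∑ l, S.bd l (S.π j k) * S.nab i (S.G l b) := by
    intro i j k
    simp only [curv, map_sub, map_sum, Derivation.leibniz, smul_eq_mul, Finset.sum_add_distrib]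
    simp only [mul_comm (S.G _ b)]
    ring
  have hF : ∀ i j k, ∑ l, S.bd l (S.π i j) * S.curv l k b =
      ∑ l, S.bd l (S.π i j) * S.nab l (S.G k b) - ∑ l, S.bd l (S.π i j) * S.nab k (S.G l b)
      - ∑ m, (∑ l, S.bd l (S.π i j) * S.bd m (S.π l k)) * S.G m b := by
    intro i j k
    simp only [curv, mul_sub, Finset.sum_sub_distrib, Finset.mul_sum, Finset.sum_mul]
    congr 1
    rw [Finset.sum_comm]
    exact Finset.sum_congr rfl fun x _ => Finset.sum_congr rfl fun y _ => by ring
  have hC : ∀ i j k, S.nab i (S.nab j (S.G k b)) - S.nab j (S.nab i (S.G k b)) =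
      ∑ l, S.bd l (S.π i j) * S.nab l (S.G k b) + ∑ c, S.Γ k c b * S.curv i j c := by
    intro i j k
    have := S.curv_apply i j (S.G k b)
    simp only [S.fd_G] at this
    rw [sub_eq_iff_eq_add'] at this
    rw [this]
    simp only [mul_comm]
  have hJ : ∑ m, ((S.nab i (S.bd m (S.π j k)) - ∑ l, S.bd l (S.π i j) * S.bd m (S.π l k))
    + (S.nab j (S.bd m (S.π k i)) - ∑ l, S.bd l (S.π j k) * S.bd m (S.π l i))
    + (S.nab k (S.bd m (S.π i j)) - ∑ l, S.bd l (S.π k i) * S.bd m (S.π l j))) * S.G m b = 0 := by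
    simp only [S.bd_jacobi, zero_mul, Finset.sum_const_zero]
  simp only [sub_mul, add_mul, Finset.sum_add_distrib, Finset.sum_sub_distrib] at hJ
  rw [hN, hN, hN, hF, hF, hF]
  linear_combination hC i j k + hC j k i + hC k i j - hJ

theorem nab_Q (i j k : ι) : S.nab i (S.Q j k) = (1 / 2 : ℝ) • ∑ b, S.eulerForm b *
    (S.nab i (S.curv j k b) - ∑ c, S.Γ i c b * S.curv j k c) := by
  have h : ∑ b, S.curv j k b * ∑ m, S.Γ i b m * S.eulerForm m =
      ∑ b, S.eulerForm b * ∑ c, S.Γ i c b * S.curv j k c := by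
    simp only [Finset.mul_sum]
    rw [Finset.sum_comm]
    exact Finset.sum_congr rfl fun x _ => Finset.sum_congr rfl fun y _ => by ring
  rw [Q, Derivation.map_smul]
  simp only [map_sum, Derivation.leibniz, smul_eq_mul, nab_eulerForm, mul_neg, mul_sub,
    Finset.sum_add_distrib, Finset.sum_sub_distrib, Finset.sum_neg_distrib, h]
  rw [sub_eq_add_neg]

/-- The contraction of `curv_bianchi` with the parallel form ι(𝓔)Ω. -/
theorem Q_bianchi (i j k : ι) :
    (S.nab i (S.Q j k) - ∑ l, S.bd l (S.π i j) * S.Q l k)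
    + (S.nab j (S.Q k i) - ∑ l, S.bd l (S.π j k) * S.Q l i)
    + (S.nab k (S.Q i j) - ∑ l, S.bd l (S.π k i) * S.Q l j) = 0 := by
  have h : ∀ i j k, ∑ l, S.bd l (S.π i j) * S.Q l k =
      (1 / 2 : ℝ) • ∑ b, S.eulerForm b * ∑ l, S.bd l (S.π i j) * S.curv l k b := by
    intro i j k
    simp only [Q, mul_smul_comm, ← Finset.smul_sum, Finset.mul_sum]
    congr 1
    rw [Finset.sum_comm]
    exact Finset.sum_congr rfl fun x _ => Finset.sum_congr rfl fun y _ => by ring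
  simp only [nab_Q, h, ← smul_sub, ← smul_add, ← Finset.sum_sub_distrib, ← Finset.sum_add_distrib,
    ← mul_sub, ← mul_add, S.curv_bianchi, mul_zero, Finset.sum_const_zero, smul_zero]

/-- The functions `U(dx^j) = π^{jk} u_k`. -/
def potential (u : ι → H) (j : ι) : H := ∑ k, S.π j k * u k

theorem potential_neg (u : ι → H) (j : ι) :
    S.potential (fun k => - u k) j = - ∑ k, S.π j k * u k := by
  simp only [potential, mul_neg, Finset.sum_neg_distrib]

/-- The Hamiltonian vector field `v_s ∂/∂ξ_s`. -/
def ham (v : ι → H) : Derivation ℝ H H := ∑ s, v s • S.fd s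

theorem ham_apply (v : ι → H) (F : H) : S.ham v F = ∑ s, v s * S.fd s F := by
  simp [ham, sum_derivation_apply]

/-- The defect of the Fundamental Equation on `dx^j`, `dx^k`. -/
def defect (u : ι → H) (v : ι → ι → H) (j k : ι) : H :=
  S.Q j k - S.nab j (S.potential u k) + S.nab k (S.potential u j)
    + ∑ m, S.bd m (S.π j k) * S.potential u m + S.ham (v j) (S.potential u k) - S.π j k

/-- `v j` is a Hamiltonian vector field of `U(dx^j)`. -/
def Compatible (u : ι → H) (v : ι → ι → H) : Prop :=
  ∀ i j, S.fd i (S.potential u j) = ∑ s, S.π i s * v j s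

/-! ### The Bianchi identity for the defect of the Fundamental Equation. -/

section Bianchi

variable {S} {u : ι → H} {v : ι → ι → H} (huv : S.Compatible u v)
include huv

/-- Trades a derivative of U_j along any vertical field for a pairing of that field with v_j under
Ω. -/
theorem Compatible.sum_fd (j : ι) (w : ι → H) :
    ∑ t, w t * S.fd t (S.potential u j) = - ∑ s, v j s * ∑ t, S.π s t * w t := by
  simp only [huv _ _, Finset.mul_sum, ← Finset.sum_neg_distrib]
  rw [Finset.sum_comm]
  exact Finset.sum_congr rfl fun x _ => Finset.sum_congr rfl fun y _ => by
    rw [S.antisymm y x]; ring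

theorem Compatible.ham_potential (j k : ι) :
    S.ham (v j) (S.potential u k) = ∑ s, v j s * ∑ t, S.π s t * v k t := by
  simp only [ham_apply, huv _ _]

theorem Compatible.ham_antisymm (j k : ι) :
    S.ham (v j) (S.potential u k) = - S.ham (v k) (S.potential u j) := by
  rw [huv.ham_potential k j, ham_apply, huv.sum_fd]

theorem Compatible.ham_Q (i j k : ι) :
    S.ham (v i) (S.Q j k) = - ∑ b, S.curv j k b * S.fd b (S.potential u i) := by
  rw [huv.sum_fd, ham_apply, neg_neg]
  simp only [S.fd_Q]

/-- Since ∇̄^i preserves Ω, it is a derivation of the fibrewise bracket. The term {∇̄^i U_j, U_k} is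
written as -{U_k, ∇̄^i U_j}, so that no Hamiltonian field of ∇̄^i U_j is required. -/
theorem Compatible.nab_ham (i j k : ι) :
    S.nab i (S.ham (v j) (S.potential u k)) =
      S.ham (v j) (S.nab i (S.potential u k)) - S.ham (v k) (S.nab i (S.potential u j)) := by
  have e : ∀ j k, S.ham (v j) (S.nab i (S.potential u k)) =
      ∑ s, v j s * ∑ t, S.π s t * S.nab i (v k t)
      + ∑ s, v j s * ∑ t, S.nab i (S.π s t) * v k t
      + ∑ s, v j s * ∑ l, S.Γ i s l * ∑ t, S.π l t * v k t := by
    intro j k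
    simp only [ham_apply, S.fd_nab, huv _ _, map_sum, Derivation.leibniz, smul_eq_mul, mul_add,
      Finset.sum_add_distrib, mul_comm (v k _) (S.nab i _)]
  have e1 : ∑ s, v k s * ∑ t, S.π s t * S.nab i (v j t) =
      - ∑ s, S.nab i (v j s) * ∑ t, S.π s t * v k t := by
    simp only [Finset.mul_sum, ← Finset.sum_neg_distrib]
    rw [Finset.sum_comm]
    exact Finset.sum_congr rfl fun x _ => Finset.sum_congr rfl fun y _ => by
      rw [S.antisymm y x]; ring
  have e2 : ∑ s, v j s * ∑ l, S.Γ i s l * ∑ t, S.π l t * v k t =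
      - ∑ s, v j s * ∑ t, (∑ l, S.Γ i s l * S.π t l) * v k t := by
    simp only [Finset.mul_sum, Finset.sum_mul, ← Finset.sum_neg_distrib]
    refine Finset.sum_congr rfl fun x _ => ?_
    rw [Finset.sum_comm]
    exact Finset.sum_congr rfl fun x _ => Finset.sum_congr rfl fun y _ => by
      rw [S.antisymm x y]; ring
  have e3 : ∑ s, v k s * ∑ l, S.Γ i s l * ∑ t, S.π l t * v j t =
      - ∑ s, v j s * ∑ t, (∑ l, S.Γ i t l * S.π s l) * v k t := by
    have : ∀ s, ∑ l, S.Γ i s l * ∑ t, S.π l t * v j t =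
        - ∑ t, v j t * ∑ l, S.Γ i s l * S.π t l := by
      intro s
      simp only [Finset.mul_sum, ← Finset.sum_neg_distrib]
      rw [Finset.sum_comm]
      exact Finset.sum_congr rfl fun x _ => Finset.sum_congr rfl fun y _ => by
        rw [S.antisymm y x]; ring
    simp_rw [this]
    simp only [Finset.mul_sum, mul_neg, ← Finset.sum_neg_distrib, Finset.sum_mul]
    rw [Finset.sum_comm]
    exact Finset.sum_congr rfl fun x _ => Finset.sum_congr rfl fun y _ =>
      Finset.sum_congr rfl fun z _ => by ring
  have e4 : ∑ s, v k s * ∑ t, S.nab i (S.π s t) * v j t =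
      - ∑ s, v j s * ∑ t, S.nab i (S.π s t) * v k t := by
    simp only [Finset.mul_sum, ← Finset.sum_neg_distrib]
    rw [Finset.sum_comm]
    exact Finset.sum_congr rfl fun x _ => Finset.sum_congr rfl fun y _ => by
      rw [S.antisymm y x, map_neg]; ring
  -- The two brackets on the right produce ∇̄^i π twice; by `nab_pi` one copy cancels against the
  -- Christoffel terms of `fd_nab`.
  have e5 : ∑ s, v j s * ∑ t, S.nab i (S.π s t) * v k t =
      ∑ s, v j s * ∑ t, (∑ l, S.Γ i s l * S.π t l) * v k t
      - ∑ s, v j s * ∑ t, (∑ l, S.Γ i t l * S.π s l) * v k t := by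
    simp only [nab_pi, sub_mul, Finset.sum_sub_distrib, mul_sub]
  rw [e j k, e k j, e1, e2, e3, e4, huv.ham_potential]
  simp only [map_sum, Derivation.leibniz, smul_eq_mul, Finset.sum_add_distrib, mul_add]
  simp only [mul_comm _ (S.nab i (v j _)), mul_comm (v k _) (S.nab i (S.π _ _))]
  linear_combination -e5

/-- Compatibility eliminates the derivatives of v, leaving second derivatives of the U_j. These are
symmetric, so they cancel in pairs in the cyclic sum of `Compatible.ham_jacobi`. -/
theorem Compatible.ham_ham (i j k : ι) :
    S.ham (v i) (S.ham (v j) (S.potential u k)) =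
      ∑ r, ∑ s, v i r * v j s * S.fd r (S.fd s (S.potential u k))
      - ∑ r, ∑ s, v i r * v k s * S.fd r (S.fd s (S.potential u j)) := by
  have h : ∀ r, S.fd r (S.ham (v j) (S.potential u k)) =
      ∑ s, v j s * S.fd r (S.fd s (S.potential u k))
      - ∑ t, v k t * S.fd r (S.fd t (S.potential u j)) := by
    intro r
    have h' : ∑ s, S.fd s (S.potential u k) * S.fd r (v j s) =
        - ∑ t, v k t * S.fd r (S.fd t (S.potential u j)) := by
      simp only [mul_comm _ (S.fd r (v j _))]
      rw [huv.sum_fd]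
      simp only [huv _ _, map_sum, Derivation.leibniz, smul_eq_mul, S.fd_π, mul_zero, add_zero]
    rw [ham_apply, map_sum]
    simp only [Derivation.leibniz, smul_eq_mul, Finset.sum_add_distrib, h']
    ring
  simp only [S.ham_apply (v i), h, mul_sub, Finset.sum_sub_distrib, Finset.mul_sum, mul_assoc]

theorem Compatible.ham_jacobi (i j k : ι) :
    S.ham (v i) (S.ham (v j) (S.potential u k)) + S.ham (v j) (S.ham (v k) (S.potential u i))
      + S.ham (v k) (S.ham (v i) (S.potential u j)) = 0 := by
  have h : ∀ i j k, ∑ r, ∑ s, v i r * v j s * S.fd r (S.fd s (S.potential u k)) =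
      ∑ r, ∑ s, v j r * v i s * S.fd r (S.fd s (S.potential u k)) := by
    intro i j k
    rw [Finset.sum_comm]
    exact Finset.sum_congr rfl fun x _ => Finset.sum_congr rfl fun y _ => by
      rw [S.fd_comm]; ring
  rw [huv.ham_ham, huv.ham_ham, huv.ham_ham, h i j k, h j k i, h k i j]
  ring

/-- The Bianchi identity for the defect of the Fundamental Equation. -/
theorem Compatible.defect_bianchi (i j k : ι) :
    (S.nab i (S.defect u v j k) - S.ham (v i) (S.defect u v j k)
      - ∑ l, S.bd l (S.π i j) * S.defect u v l k)
    + (S.nab j (S.defect u v k i) - S.ham (v j) (S.defect u v k i)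
      - ∑ l, S.bd l (S.π j k) * S.defect u v l i)
    + (S.nab k (S.defect u v i j) - S.ham (v k) (S.defect u v i j)
      - ∑ l, S.bd l (S.π k i) * S.defect u v l j) = 0 := by
  have hπ : ∀ i j k, S.ham (v i) (S.π j k) = 0 := fun i j k => by simp [ham_apply, S.fd_π]
  have hf : ∀ i l j k, S.ham (v i) (S.bd l (S.π j k)) = 0 := fun i l j k => by
    simp [ham_apply, S.fd_bd_pi]
  have hd : ∀ i j k, S.nab i (S.defect u v j k) - S.ham (v i) (S.defect u v j k)
      - ∑ l, S.bd l (S.π i j) * S.defect u v l k =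
      (S.nab i (S.Q j k) - ∑ l, S.bd l (S.π i j) * S.Q l k)
      - S.nab i (S.nab j (S.potential u k)) + S.nab i (S.nab k (S.potential u j))
      + ∑ m, S.nab i (S.bd m (S.π j k)) * S.potential u m
      + ∑ m, S.bd m (S.π j k) * S.nab i (S.potential u m)
      + (S.ham (v j) (S.nab i (S.potential u k)) - S.ham (v k) (S.nab i (S.potential u j)))
      - S.nab i (S.π j k)
      + ∑ b, S.curv j k b * S.fd b (S.potential u i)
      + S.ham (v i) (S.nab j (S.potential u k)) - S.ham (v i) (S.nab k (S.potential u j))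
      - ∑ m, S.bd m (S.π j k) * S.ham (v i) (S.potential u m)
      - S.ham (v i) (S.ham (v j) (S.potential u k))
      + ∑ l, S.bd l (S.π i j) * S.nab l (S.potential u k)
      - ∑ l, S.bd l (S.π i j) * S.nab k (S.potential u l)
      - ∑ m, (∑ l, S.bd l (S.π i j) * S.bd m (S.π l k)) * S.potential u m
      + ∑ l, S.bd l (S.π i j) * S.ham (v k) (S.potential u l)
      + ∑ l, S.bd l (S.π i j) * S.π l k := by
    intro i j k
    have hs : ∑ l, S.bd l (S.π i j) * ∑ m, S.bd m (S.π l k) * S.potential u m =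
        ∑ m, (∑ l, S.bd l (S.π i j) * S.bd m (S.π l k)) * S.potential u m := by
      simp only [Finset.mul_sum, Finset.sum_mul]
      rw [Finset.sum_comm]
      exact Finset.sum_congr rfl fun x _ => Finset.sum_congr rfl fun y _ => by ring
    have hl : ∑ l, S.bd l (S.π i j) * S.ham (v l) (S.potential u k) =
        - ∑ l, S.bd l (S.π i j) * S.ham (v k) (S.potential u l) := by
      rw [← Finset.sum_neg_distrib]
      exact Finset.sum_congr rfl fun l _ => by rw [huv.ham_antisymm l k]; ring
    simp only [defect, map_sub, map_add, map_sum, Derivation.leibniz, smul_eq_mul, huv.nab_ham i,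
      huv.ham_Q, hπ, hf, mul_add, mul_sub, Finset.sum_add_distrib, Finset.sum_sub_distrib, hs,
      mul_zero, hl, Finset.sum_const_zero]
    simp only [mul_comm (S.potential u _) (S.nab _ _)]
    ring
  -- In the cyclic sum the vertical part of these commutators cancels the terms {U_i, Q̄(dx^j,
  -- dx^k)} rewritten by `Compatible.ham_Q`: this is where it matters that Q̄ is the Hamiltonian of
  -- the curvature.
  have hR : ∀ i j k, S.nab i (S.nab j (S.potential u k)) - S.nab j (S.nab i (S.potential u k)) =
      ∑ l, S.bd l (S.π i j) * S.nab l (S.potential u k)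
      + ∑ b, S.curv i j b * S.fd b (S.potential u k) := by
    intro i j k
    have := S.curv_apply i j (S.potential u k)
    rw [sub_eq_iff_eq_add'] at this
    exact this
  have hJ : ∑ m, ((S.nab i (S.bd m (S.π j k)) - ∑ l, S.bd l (S.π i j) * S.bd m (S.π l k))
    + (S.nab j (S.bd m (S.π k i)) - ∑ l, S.bd l (S.π j k) * S.bd m (S.π l i))
    + (S.nab k (S.bd m (S.π i j)) - ∑ l, S.bd l (S.π k i) * S.bd m (S.π l j)))
      * S.potential u m = 0 := by
    simp only [S.bd_jacobi, zero_mul, Finset.sum_const_zero]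
  simp only [sub_mul, add_mul, Finset.sum_add_distrib, Finset.sum_sub_distrib] at hJ
  have hP : ∀ i j k, S.nab i (S.π j k) = ∑ l, S.π i l * S.bd l (S.π j k) :=
    fun i j k => S.nab_base i fun s => S.fd_π s j k
  have hP2 : ∀ i j k, ∑ l, S.bd l (S.π i j) * S.π l k = - ∑ l, S.π k l * S.bd l (S.π i j) := by
    intro i j k
    rw [← Finset.sum_neg_distrib]
    exact Finset.sum_congr rfl fun l _ => by rw [S.antisymm l k]; ring
  -- The constant term Π of the equation yields the Jacobi sum of π twice, through ∇̄^i π^{jk} and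
  -- through the contraction of ∂π with π; hence the factor 2 below.
  rw [hd, hd, hd, hP, hP, hP, hP2, hP2, hP2]
  linear_combination S.Q_bianchi i j k + hJ - hR i j k - hR j k i - hR k i j
    - huv.ham_jacobi i j k - 2 * S.jacobi i j k

theorem Compatible.defect_antisymm (j k : ι) : S.defect u v j k = - S.defect u v k j := by
  have hf : ∀ m, S.bd m (S.π j k) = - S.bd m (S.π k j) := fun m => by rw [S.antisymm j k, map_neg]
  have hc : ∀ b, S.curv j k b = - S.curv k j b := fun b => by
    simp only [curv, hf, neg_mul, Finset.sum_neg_distrib]; ring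
  have hQ : S.Q j k = - S.Q k j := by
    simp only [Q, hc, mul_neg, Finset.sum_neg_distrib, smul_neg]
  simp only [defect, hQ, hf, neg_mul, Finset.sum_neg_distrib]
  rw [huv.ham_antisymm j k, S.antisymm j k]
  ring

end Bianchi

/-! ### The defect lies in the image of π. -/

section Image

/-- The vector `f` has the form `f_j = π^{jk} c_k`. -/
def InImage (f : ι → H) : Prop := ∃ c : ι → H, ∀ j, f j = ∑ k, S.π j k * c k

variable {S}

theorem InImage.add {f g : ι → H} (hf : S.InImage f) (hg : S.InImage g) :
    S.InImage fun j => f j + g j := by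
  obtain ⟨c, hc⟩ := hf
  obtain ⟨d, hd⟩ := hg
  exact ⟨fun k => c k + d k, fun j => by simp only [hc, hd, mul_add, Finset.sum_add_distrib]⟩

theorem InImage.sub {f g : ι → H} (hf : S.InImage f) (hg : S.InImage g) :
    S.InImage fun j => f j - g j := by
  obtain ⟨c, hc⟩ := hf
  obtain ⟨d, hd⟩ := hg
  exact ⟨fun k => c k - d k, fun j => by simp only [hc, hd, mul_sub, Finset.sum_sub_distrib]⟩

theorem InImage.mul_left {f : ι → H} (hf : S.InImage f) (a : H) :
    S.InImage fun j => a * f j := by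
  obtain ⟨c, hc⟩ := hf
  refine ⟨fun k => a * c k, fun j => ?_⟩
  simp only [hc, Finset.mul_sum]
  exact Finset.sum_congr rfl fun k _ => by ring

theorem InImage.mul_right {f : ι → H} (hf : S.InImage f) (a : H) :
    S.InImage fun j => f j * a := by
  simpa only [mul_comm] using hf.mul_left a

theorem InImage.sum {κ : Type*} [Fintype κ] {f : κ → ι → H} (hf : ∀ b, S.InImage (f b)) :
    S.InImage fun j => ∑ b, f b j := by
  choose c hc using hf
  refine ⟨fun k => ∑ b, c b k, fun j => ?_⟩
  simp only [hc, Finset.mul_sum]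
  exact Finset.sum_comm

variable (S)

theorem inImage_sum (c : ι → H) : S.InImage fun j => ∑ k, S.π j k * c k := ⟨c, fun _ => rfl⟩

theorem inImage_pi (k : ι) : S.InImage fun j => S.π j k :=
  ⟨fun l => if l = k then 1 else 0, fun j => by simp⟩

theorem inImage_nab_base {F : H} (hF : ∀ k, S.fd k F = 0) : S.InImage fun j => S.nab j F := by
  simp only [S.nab_base _ hF]
  exact S.inImage_sum _

/-- Association moves the free index j from Γ to π, at the price of replacing Γ by Γ'. -/
theorem inImage_sum_Gamma (a c : ι) : S.InImage fun j => ∑ b, S.π a b * S.Γ j c b := by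
  simp only [S.assoc]
  exact S.inImage_sum _

/-- Differentiating the association identity moves the index j to π in the term with ∇̄^i Γ^{jc}.
The term with ∇̄^j Γ^{ic} is in the image because ∇̄^j acts on base functions as π^{jm} ∂_m. The
remaining derivatives of π are matched with the bracket term by `nab_pi_sub`. -/
theorem inImage_sum_curvTensor (i a c : ι) :
    S.InImage fun j => ∑ b, S.π a b * S.curvTensor i j c b := by
  have h1 : ∀ j, ∑ b, S.π a b * S.nab i (S.Γ j c b) =
      ∑ b, S.π j b * S.nab i (S.Γ' a c b) + ∑ b, S.nab i (S.π j b) * S.Γ' a c b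
      - ∑ b, S.nab i (S.π a b) * S.Γ j c b := by
    intro j
    have h := congrArg (S.nab i) (S.assoc a j c)
    simp only [map_sum, Derivation.leibniz, smul_eq_mul, Finset.sum_add_distrib] at h
    simp only [mul_comm (S.Γ _ _ _), mul_comm (S.Γ' _ _ _)] at h
    linear_combination h
  have h2 : ∀ j, ∑ b, S.nab i (S.π a b) * S.Γ j c b =
      - ∑ m, S.Γ i a m * ∑ b, S.π m b * S.Γ j c b
      - ∑ b, S.π a b * ∑ l, S.Γ j c l * S.Γ i l b := by
    intro j
    simp only [nab_pi, sub_mul, Finset.sum_sub_distrib, Finset.sum_mul, Finset.mul_sum]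
    rw [← Finset.sum_neg_distrib]
    congr 1
    · rw [Finset.sum_comm]
      refine Finset.sum_congr rfl fun x _ => ?_
      rw [← Finset.sum_neg_distrib]
      exact Finset.sum_congr rfl fun y _ => by rw [S.antisymm y x]; ring
    · rw [Finset.sum_comm]
      exact Finset.sum_congr rfl fun x _ => Finset.sum_congr rfl fun y _ => by ring
  have h3 : ∀ j, ∑ b, S.π a b * ∑ l, S.bd l (S.π i j) * S.Γ l c b =
      ∑ b, (∑ l, S.bd l (S.π i j) * S.π l b) * S.Γ' a c b := by
    intro j
    have : ∀ l, ∑ b, S.π a b * S.Γ l c b = ∑ b, S.π l b * S.Γ' a c b := fun l => S.assoc a l c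
    calc _ = ∑ l, S.bd l (S.π i j) * ∑ b, S.π a b * S.Γ l c b := by
          simp only [Finset.mul_sum]
          rw [Finset.sum_comm]
          exact Finset.sum_congr rfl fun x _ => Finset.sum_congr rfl fun y _ => by ring
      _ = _ := by
          simp only [this, Finset.mul_sum, Finset.sum_mul]
          rw [Finset.sum_comm]
          exact Finset.sum_congr rfl fun x _ => Finset.sum_congr rfl fun y _ => by ring
  have h4 : ∀ j, ∑ b, S.π a b * ∑ l, S.Γ i c l * S.Γ j l b =
      ∑ l, S.Γ i c l * ∑ b, S.π a b * S.Γ j l b := by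
    intro j
    simp only [Finset.mul_sum]
    rw [Finset.sum_comm]
    exact Finset.sum_congr rfl fun x _ => Finset.sum_congr rfl fun y _ => by ring
  have key : ∀ j, ∑ b, S.π a b * S.curvTensor i j c b =
      ∑ b, S.π j b * S.nab i (S.Γ' a c b) + ∑ b, S.nab j (S.π i b) * S.Γ' a c b
      + ∑ m, S.Γ i a m * ∑ b, S.π m b * S.Γ j c b - ∑ b, S.π a b * S.nab j (S.Γ i c b)
      + ∑ l, S.Γ i c l * ∑ b, S.π a b * S.Γ j l b := by
    intro j
    have h5 : ∑ b, S.nab i (S.π j b) * S.Γ' a c b - ∑ b, S.nab j (S.π i b) * S.Γ' a c b =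
        ∑ b, (∑ l, S.bd l (S.π i j) * S.π l b) * S.Γ' a c b := by
      simp only [← nab_pi_sub, sub_mul, Finset.sum_sub_distrib]
    simp only [curvTensor, mul_add, mul_sub, Finset.sum_add_distrib, Finset.sum_sub_distrib]
    rw [h1, h2, h3, h4]
    linear_combination h5
  simp only [key]
  refine ((((S.inImage_sum _).add ?_).add ?_).sub ?_).add ?_
  · exact .sum fun b => (S.inImage_nab_base fun s => S.fd_π s i b).mul_right _
  · exact .sum fun m => (S.inImage_sum_Gamma m c).mul_left _
  · exact .sum fun b => (S.inImage_nab_base fun s => S.fd_Γ s i c b).mul_left _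
  · exact .sum fun l => (S.inImage_sum_Gamma a l).mul_left _

theorem inImage_Q (i : ι) : S.InImage fun j => S.Q i j := by
  have h : ∀ j, ∑ b, S.eulerForm b * S.curv i j b =
      ∑ c, S.xi c * ∑ a, S.xi a * ∑ b, S.π a b * S.curvTensor i j c b := by
    intro j
    simp only [eulerForm, curv_eq, Finset.sum_mul, Finset.mul_sum]
    rw [Finset.sum_comm]
    refine Finset.sum_congr rfl fun a _ => ?_
    rw [Finset.sum_comm]
    exact Finset.sum_congr rfl fun x _ => Finset.sum_congr rfl fun y _ => by ring
  simp only [Q, Algebra.smul_def, h]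
  exact InImage.mul_left (.sum fun c => InImage.mul_left (.sum fun a =>
    (S.inImage_sum_curvTensor i a c).mul_left _) _) _

-- The lowest component of the defect can thus be absorbed by u and v even where π is degenerate.
variable {S} in
theorem Compatible.inImage_defect {u : ι → H} {v : ι → ι → H} (huv : S.Compatible u v)
    (i : ι) : S.InImage fun j => S.defect u v i j := by
  -- By `nab_pi_sub` the derivatives of π combine to ∇̄^j π^{ik}, which equals π^{jm} ∂_m π^{ik}.
  have h1 : ∀ j, S.nab i (S.potential u j) - ∑ m, S.bd m (S.π i j) * S.potential u m =
      ∑ k, S.π j k * S.nab i (u k) + ∑ k, S.nab j (S.π i k) * u k := by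
    intro j
    have : ∑ m, S.bd m (S.π i j) * S.potential u m =
        ∑ k, (∑ m, S.bd m (S.π i j) * S.π m k) * u k := by
      simp only [potential, Finset.sum_mul, Finset.mul_sum]
      rw [Finset.sum_comm]
      exact Finset.sum_congr rfl fun x _ => Finset.sum_congr rfl fun y _ => by ring
    rw [this]
    simp only [← nab_pi_sub, potential, map_sum, Derivation.leibniz, smul_eq_mul, sub_mul,
      Finset.sum_add_distrib, Finset.sum_sub_distrib]
    simp only [mul_comm (u _)]
    ring
  -- In the vertical part of ∇̄^j U_i, compatibility exposes a factor π, and `inImage_sum_Gamma`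
  -- then applies to its contraction with Γ.
  have h2 : ∀ j, ∑ l, S.G j l * S.fd l (S.potential u i) =
      - ∑ s, v i s * ∑ c, S.xi c * ∑ l, S.π s l * S.Γ j c l := by
    intro j
    rw [huv.sum_fd]
    simp only [G, Finset.mul_sum]
    congr 1
    refine Finset.sum_congr rfl fun s _ => ?_
    rw [Finset.sum_comm]
    exact Finset.sum_congr rfl fun x _ => Finset.sum_congr rfl fun y _ => by ring
  have h3 : ∀ j, S.ham (v i) (S.potential u j) = ∑ k, S.π j k * S.ham (v i) (u k) := by
    intro j
    simp only [potential, map_sum, Derivation.leibniz, smul_eq_mul]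
    have : ∀ k, S.ham (v i) (S.π j k) = 0 := fun k => by simp [ham_apply, S.fd_π]
    simp [this]
  have key : ∀ j, S.defect u v i j = S.Q i j
      - (∑ k, S.π j k * S.nab i (u k) + ∑ k, S.nab j (S.π i k) * u k)
      + (∑ m, S.π j m * S.bd m (S.potential u i)
        - ∑ s, v i s * ∑ c, S.xi c * ∑ l, S.π s l * S.Γ j c l)
      + ∑ k, S.π j k * S.ham (v i) (u k) + S.π j i := by
    intro j
    rw [defect, S.nab_apply j (S.potential u i), h2, h3, ← h1, S.antisymm i j]
    ring
  simp only [key]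
  refine ((((S.inImage_Q i).sub ((S.inImage_sum _).add (.sum fun k =>
    (S.inImage_nab_base fun s => S.fd_π s i k).mul_right _))).add
    ((S.inImage_sum _).sub ?_)).add (S.inImage_sum _)).add (S.inImage_pi i)
  exact .sum fun s => InImage.mul_left (.sum fun c => (S.inImage_sum_Gamma s c).mul_left _) _

end Image

/-! ### From coordinate forms to arbitrary 1-forms; the curvature of ∇ on 1-forms. -/

section Forms

/-- The derivation `∇̄^α`. -/
def nabForm (α : ι → H) : Derivation ℝ H H := ∑ i, α i • S.nab i

theorem nabForm_apply (α : ι → H) (F : H) : S.nabForm α F = ∑ i, α i * S.nab i F := by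
  simp [nabForm, sum_derivation_apply]

/-- The bracket of 1-forms. -/
def bracket (α β : ι → H) (k : ι) : H :=
  ∑ i, ∑ j, α i * β j * S.bd k (S.π i j) + S.nabForm α (β k) - S.nabForm β (α k)

theorem sum_nabForm_mul (α β c : ι → H) :
    S.nabForm α (∑ j, β j * c j) = ∑ j, S.nabForm α (β j) * c j
      + ∑ i, ∑ j, α i * β j * S.nab i (c j) := by
  have h : ∑ i, ∑ j, α i * β j * S.nab i (c j) = ∑ j, β j * S.nabForm α (c j) := by
    simp only [nabForm_apply, Finset.mul_sum]
    rw [Finset.sum_comm]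
    exact Finset.sum_congr rfl fun x _ => Finset.sum_congr rfl fun y _ => by ring
  rw [h]
  simp only [map_sum, Derivation.leibniz, smul_eq_mul, Finset.sum_add_distrib,
    mul_comm (c _)]
  ring

theorem sum_bracket_mul (α β c : ι → H) :
    ∑ k, S.bracket α β k * c k = ∑ i, ∑ j, α i * β j * ∑ l, S.bd l (S.π i j) * c l
      + ∑ k, S.nabForm α (β k) * c k - ∑ k, S.nabForm β (α k) * c k := by
  have h : ∑ k, (∑ i, ∑ j, α i * β j * S.bd k (S.π i j)) * c k =
      ∑ i, ∑ j, α i * β j * ∑ l, S.bd l (S.π i j) * c l := by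
    simp only [Finset.mul_sum, Finset.sum_mul]
    rw [Finset.sum_comm]
    refine Finset.sum_congr rfl fun x _ => ?_
    rw [Finset.sum_comm]
    exact Finset.sum_congr rfl fun x _ => Finset.sum_congr rfl fun y _ => by ring
  simp only [bracket, add_mul, sub_mul, Finset.sum_add_distrib, Finset.sum_sub_distrib, h]

omit [DecidableEq ι] [Algebra ℝ H] in
theorem sum_sum_swap (α β : ι → H) (f : ι → ι → H) :
    ∑ i, ∑ j, β i * α j * f i j = ∑ i, ∑ j, α i * β j * f j i := by
  rw [Finset.sum_comm]
  exact Finset.sum_congr rfl fun x _ => Finset.sum_congr rfl fun y _ => by ring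

/-- The derivatives of the coefficients of α and β cancel against those contained in [α, β]; the
remaining expression is bilinear. -/
theorem nabForm_commutator (α β : ι → H) (F : H) :
    S.nabForm α (S.nabForm β F) - S.nabForm β (S.nabForm α F)
      - S.nabForm (S.bracket α β) F =
    ∑ i, ∑ j, α i * β j * (S.nab i (S.nab j F) - S.nab j (S.nab i F)
      - ∑ l, S.bd l (S.π i j) * S.nab l F) := by
  rw [S.nabForm_apply β F, S.nabForm_apply α F, S.nabForm_apply (S.bracket α β) F,
    sum_nabForm_mul, sum_nabForm_mul, sum_bracket_mul, sum_sum_swap α β]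
  simp only [mul_sub, Finset.sum_sub_distrib]
  ring

theorem nabForm_curvature (α β : ι → H) (b : ι) :
    S.nabForm α (S.nabForm β (S.xi b)) - S.nabForm β (S.nabForm α (S.xi b))
      - S.nabForm (S.bracket α β) (S.xi b) = ∑ i, ∑ j, α i * β j * S.curv i j b := by
  rw [nabForm_commutator]
  simp only [nab_xi, curv]

/-- The Fundamental Equation is tensorial. -/
theorem form_defect (α β u : ι → H) (v : ι → ι → H) :
    (1 / 2 : ℝ) • ∑ b, S.eulerForm b *
      (S.nabForm α (S.nabForm β (S.xi b)) - S.nabForm β (S.nabForm α (S.xi b))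
        - S.nabForm (S.bracket α β) (S.xi b))
      - S.nabForm α (∑ j, β j * S.potential u j) + S.nabForm β (∑ i, α i * S.potential u i)
      + ∑ k, S.bracket α β k * S.potential u k
      + ∑ i, ∑ j, α i * β j * S.ham (v i) (S.potential u j)
      - ∑ i, ∑ j, α i * β j * S.π i j = ∑ i, ∑ j, α i * β j * S.defect u v i j := by
  have hQ : (1 / 2 : ℝ) • ∑ b, S.eulerForm b * ∑ i, ∑ j, α i * β j * S.curv i j b =
      ∑ i, ∑ j, α i * β j * S.Q i j := by
    simp only [Q, mul_smul_comm, ← Finset.smul_sum, Finset.mul_sum]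
    congr 1
    rw [Finset.sum_comm]
    refine Finset.sum_congr rfl fun x _ => ?_
    rw [Finset.sum_comm]
    exact Finset.sum_congr rfl fun x _ => Finset.sum_congr rfl fun y _ => by ring
  simp only [nabForm_curvature, hQ]
  rw [sum_nabForm_mul, sum_nabForm_mul, sum_bracket_mul, sum_sum_swap α β]
  simp only [defect, mul_sub, mul_add, Finset.sum_sub_distrib, Finset.sum_add_distrib]
  ring

/-- The components of `∇^α Ξ`. -/
def cov (α Ξ : ι → H) (k : ι) : H :=
  ∑ i, α i * (S.nab i (Ξ k) - ∑ j, S.Γ i j k * Ξ j)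

/-- On components of 1-forms Γ enters with the sign opposite to that in ∇̄ ξ_k, so the curvature
appears as minus the tensor of ∇̄. On the base functions Ξ_k the derivations ∇̄ themselves have no
curvature. -/
theorem coordCov_commutator (Ξ : ι → H) (hΞ : ∀ s k, S.fd s (Ξ k) = 0) (i j k : ι) :
    (S.nab i (S.nab j (Ξ k) - ∑ c, S.Γ j c k * Ξ c)
      - ∑ d, S.Γ i d k * (S.nab j (Ξ d) - ∑ c, S.Γ j c d * Ξ c))
    - (S.nab j (S.nab i (Ξ k) - ∑ c, S.Γ i c k * Ξ c)
      - ∑ d, S.Γ j d k * (S.nab i (Ξ d) - ∑ c, S.Γ i c d * Ξ c))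
    - ∑ l, S.bd l (S.π i j) * (S.nab l (Ξ k) - ∑ c, S.Γ l c k * Ξ c) =
    - ∑ c, S.curvTensor i j c k * Ξ c := by
  have h := S.curv_apply i j (Ξ k)
  simp only [hΞ, mul_zero, Finset.sum_const_zero] at h
  have h1 : ∀ i j, ∑ d, S.Γ i d k * ∑ c, S.Γ j c d * Ξ c =
      ∑ c, (∑ l, S.Γ j c l * S.Γ i l k) * Ξ c := by
    intro i j
    simp only [Finset.mul_sum, Finset.sum_mul]
    rw [Finset.sum_comm]
    exact Finset.sum_congr rfl fun x _ => Finset.sum_congr rfl fun y _ => by ring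
  have h2 : ∑ l, S.bd l (S.π i j) * ∑ c, S.Γ l c k * Ξ c =
      ∑ c, (∑ l, S.bd l (S.π i j) * S.Γ l c k) * Ξ c := by
    simp only [Finset.mul_sum, Finset.sum_mul]
    rw [Finset.sum_comm]
    exact Finset.sum_congr rfl fun x _ => Finset.sum_congr rfl fun y _ => by ring
  simp only [map_sub, map_sum, Derivation.leibniz, smul_eq_mul, mul_sub, Finset.sum_sub_distrib,
    Finset.sum_add_distrib, h1, h2, curvTensor, add_mul, sub_mul, mul_comm (Ξ _)]
  linear_combination h

/-- Identifies the coordinate tensor in Q̄ with the curvature of ∇ on 1-forms, which needs no chart;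
`sum_curvTensor_formCoeff` uses it to make Q̄ intrinsic. -/
theorem cov_commutator (α β Ξ : ι → H) (hΞ : ∀ s k, S.fd s (Ξ k) = 0) (k : ι) :
    S.cov α (S.cov β Ξ) k - S.cov β (S.cov α Ξ) k - S.cov (S.bracket α β) Ξ k =
      - ∑ i, ∑ j, α i * β j * ∑ c, S.curvTensor i j c k * Ξ c := by
  have e : ∀ α β : ι → H, S.cov α (S.cov β Ξ) k =
      ∑ j, S.nabForm α (β j) * (S.nab j (Ξ k) - ∑ c, S.Γ j c k * Ξ c)
      + ∑ i, ∑ j, α i * β j * (S.nab i (S.nab j (Ξ k) - ∑ c, S.Γ j c k * Ξ c)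
        - ∑ d, S.Γ i d k * (S.nab j (Ξ d) - ∑ c, S.Γ j c d * Ξ c)) := by
    intro α β
    have h1 : S.cov α (S.cov β Ξ) k = S.nabForm α (S.cov β Ξ k)
        - ∑ i, α i * ∑ d, S.Γ i d k * S.cov β Ξ d := by
      rw [cov, nabForm_apply]
      simp only [mul_sub, Finset.sum_sub_distrib]
    have h2 : ∑ i, α i * ∑ d, S.Γ i d k * S.cov β Ξ d = ∑ i, ∑ j, α i * β j *
        ∑ d, S.Γ i d k * (S.nab j (Ξ d) - ∑ c, S.Γ j c d * Ξ c) := by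
      refine Finset.sum_congr rfl fun i _ => ?_
      simp only [cov, Finset.mul_sum]
      rw [Finset.sum_comm]
      exact Finset.sum_congr rfl fun x _ => Finset.sum_congr rfl fun y _ => by ring
    rw [h1, h2, cov, sum_nabForm_mul]
    simp only [mul_sub, Finset.sum_sub_distrib]
    ring
  rw [e, e, sum_sum_swap α β, cov, sum_bracket_mul]
  have h := fun i j => S.coordCov_commutator Ξ hΞ i j k
  have h' : - ∑ i, ∑ j, α i * β j * ∑ c, S.curvTensor i j c k * Ξ c =
      ∑ i, ∑ j, α i * β j * - ∑ c, S.curvTensor i j c k * Ξ c := by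
    simp only [mul_neg, Finset.sum_neg_distrib]
  rw [h']
  simp only [← h, mul_sub, Finset.sum_sub_distrib]
  ring

end Forms

end FibreCalculus

/-! ### The ring of formal functions over an open subset of ℝⁿ and its derivations. -/

section FormalRing

variable {n : ℕ} {V : TopologicalSpace.Opens (EuclideanSpace ℝ (Fin n))}

/-- The extension by zero of a function on `V × ℝⁿ`. -/
def extend (f : V × (Fin n → ℝ) → ℝ) : EuclideanSpace ℝ (Fin n) × (Fin n → ℝ) → ℝ :=
  open Classical in fun p => if h : p.1 ∈ V then f (⟨p.1, h⟩, p.2) else 0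

theorem extend_apply (f : V × (Fin n → ℝ) → ℝ) {y : EuclideanSpace ℝ (Fin n)} (hy : y ∈ V)
    (ξ : Fin n → ℝ) : extend f (y, ξ) = f (⟨y, hy⟩, ξ) := by
  simp [extend, hy]

theorem extend_of_notMem (f : V × (Fin n → ℝ) → ℝ) {y : EuclideanSpace ℝ (Fin n)} (hy : y ∉ V)
    (ξ : Fin n → ℝ) : extend f (y, ξ) = 0 := by
  simp [extend, hy]

theorem extend_add (f g : V × (Fin n → ℝ) → ℝ) : extend (f + g) = extend f + extend g := by
  ext ⟨y, ξ⟩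
  by_cases hy : y ∈ V <;> simp [extend, hy]

theorem extend_mul (f g : V × (Fin n → ℝ) → ℝ) : extend (f * g) = extend f * extend g := by
  ext ⟨y, ξ⟩
  by_cases hy : y ∈ V <;> simp [extend, hy]

theorem extend_smul (c : ℝ) (f : V × (Fin n → ℝ) → ℝ) : extend (c • f) = c • extend f := by
  ext ⟨y, ξ⟩
  by_cases hy : y ∈ V <;> simp [extend, hy]

/-- The open subset `V × ℝⁿ` of the cotangent bundle. -/
def tube (V : TopologicalSpace.Opens (EuclideanSpace ℝ (Fin n))) :
    Set (EuclideanSpace ℝ (Fin n) × (Fin n → ℝ)) := (V : Set (EuclideanSpace ℝ (Fin n))) ×ˢ Set.univ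

theorem isOpen_tube : IsOpen (tube V) := V.isOpen.prod isOpen_univ

theorem mem_tube (p : V × (Fin n → ℝ)) : ((p.1 : EuclideanSpace ℝ (Fin n)), p.2) ∈ tube V :=
  ⟨p.1.2, trivial⟩

/-- The smooth functions on `V × ℝⁿ`. -/
def smoothSubalgebra (V : TopologicalSpace.Opens (EuclideanSpace ℝ (Fin n))) :
    Subalgebra ℝ (V × (Fin n → ℝ) → ℝ) where
  carrier := {f | ContDiffOn ℝ ∞ (extend f) (tube V)}
  mul_mem' {f g} hf hg := by
    change ContDiffOn ℝ ∞ (extend (f * g)) (tube V)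
    rw [extend_mul]
    exact ContDiffOn.mul hf hg
  add_mem' {f g} hf hg := by
    change ContDiffOn ℝ ∞ (extend (f + g)) (tube V)
    rw [extend_add]
    exact ContDiffOn.add hf hg
  algebraMap_mem' c := by
    refine (contDiffOn_const (c := c)).congr fun p hp => ?_
    rw [← Prod.mk.eta (p := p), extend_apply _ hp.1]
    rfl

theorem contDiffAt_extend {f : V × (Fin n → ℝ) → ℝ} (hf : f ∈ smoothSubalgebra V)
    (p : V × (Fin n → ℝ)) : ContDiffAt ℝ ∞ (extend f) (p.1, p.2) :=
  ContDiffOn.contDiffAt hf (isOpen_tube.mem_nhds (mem_tube p))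

theorem differentiableAt_extend {f : V × (Fin n → ℝ) → ℝ} (hf : f ∈ smoothSubalgebra V)
    (p : V × (Fin n → ℝ)) : DifferentiableAt ℝ (extend f) (p.1, p.2) :=
  (contDiffAt_extend hf p).differentiableAt (by simp)

/-- The directional derivative of a function on `V × ℝⁿ`. -/
def dirDeriv (w : EuclideanSpace ℝ (Fin n) × (Fin n → ℝ)) (f : V × (Fin n → ℝ) → ℝ) :
    V × (Fin n → ℝ) → ℝ :=
  fun p => fderiv ℝ (extend f) (p.1, p.2) w

variable (w w' : EuclideanSpace ℝ (Fin n) × (Fin n → ℝ)) {f g : V × (Fin n → ℝ) → ℝ}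

theorem dirDeriv_add (hf : f ∈ smoothSubalgebra V) (hg : g ∈ smoothSubalgebra V) :
    dirDeriv w (f + g) = dirDeriv w f + dirDeriv w g := by
  ext p
  simp only [dirDeriv, extend_add, Pi.add_apply]
  rw [fderiv_add (differentiableAt_extend hf p) (differentiableAt_extend hg p)]
  rfl

theorem dirDeriv_mul (hf : f ∈ smoothSubalgebra V) (hg : g ∈ smoothSubalgebra V) :
    dirDeriv w (f * g) = f * dirDeriv w g + g * dirDeriv w f := by
  ext p
  simp only [dirDeriv, extend_mul, Pi.add_apply, Pi.mul_apply]
  rw [fderiv_mul (differentiableAt_extend hf p) (differentiableAt_extend hg p)]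
  simp [extend_apply _ p.1.2]

theorem dirDeriv_smul (c : ℝ) (f : V × (Fin n → ℝ) → ℝ) :
    dirDeriv w (c • f) = c • dirDeriv w f := by
  ext p
  simp only [dirDeriv, extend_smul, Pi.smul_apply]
  rw [fderiv_const_smul_field]
  rfl

theorem dirDeriv_zero : dirDeriv w (0 : V × (Fin n → ℝ) → ℝ) = 0 := by
  simpa using dirDeriv_smul w 0 (0 : V × (Fin n → ℝ) → ℝ)

theorem extend_dirDeriv_eqOn (f : V × (Fin n → ℝ) → ℝ) :
    Set.EqOn (extend (dirDeriv w f)) (fun p => fderiv ℝ (extend f) p w) (tube V) := by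
  rintro ⟨y, ξ⟩ hp
  rw [extend_apply _ hp.1]
  rfl

theorem dirDeriv_mem (hf : f ∈ smoothSubalgebra V) : dirDeriv w f ∈ smoothSubalgebra V := by
  have h : ContDiffOn ℝ ∞ (extend f) (tube V) := hf
  have h2 : ContDiffOn ℝ ∞ (fun p => fderiv ℝ (extend f) p w) (tube V) :=
    (h.fderiv_of_isOpen isOpen_tube (by simp)).clm_apply contDiffOn_const
  exact h2.congr (extend_dirDeriv_eqOn w f)

theorem dirDeriv_comm (hf : f ∈ smoothSubalgebra V) :
    dirDeriv w (dirDeriv w' f) = dirDeriv w' (dirDeriv w f) := by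
  have h : ∀ w w', dirDeriv w (dirDeriv w' f) = fun p : V × (Fin n → ℝ) =>
      fderiv ℝ (fderiv ℝ (extend f)) (p.1, p.2) w w' := by
    intro w w'
    ext p
    have h1 : extend (dirDeriv w' f) =ᶠ[𝓝 ((p.1 : EuclideanSpace ℝ (Fin n)), p.2)]
        fun p => fderiv ℝ (extend f) p w' :=
      (extend_dirDeriv_eqOn w' f).eventuallyEq_of_mem (isOpen_tube.mem_nhds (mem_tube p))
    have h2 : DifferentiableAt ℝ (fderiv ℝ (extend f)) (p.1, p.2) :=
      ((contDiffAt_extend hf p).fderiv_right (m := ∞) (by simp)).differentiableAt (by simp)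
    rw [dirDeriv, h1.fderiv_eq, fderiv_clm_apply h2 (by fun_prop)]
    simp
  rw [h, h]
  ext p
  have hs : IsSymmSndFDerivAt ℝ (extend f) (p.1, p.2) :=
    (contDiffAt_extend hf p).isSymmSndFDerivAt (by simp; exact WithTop.coe_le_coe.2 (le_top (a := (2 : ℕ∞))))
  exact hs.eq w w'

/-- Homogeneity of degree `s` in the fibre variables. -/
def IsHomog (s : ℕ) (f : V × (Fin n → ℝ) → ℝ) : Prop :=
  ∀ (y : V) (t : ℝ) (ξ : Fin n → ℝ), f (y, t • ξ) = t ^ s * f (y, ξ)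

/-- The chain rule for f(y, tξ) = t^s f(y, ξ) with t fixed; the extension by zero satisfies this
identity off V as well. -/
theorem IsHomog.fderiv_eq {s : ℕ} (h : IsHomog s f) (hf : f ∈ smoothSubalgebra V)
    (y : V) (t : ℝ) (ξ : Fin n → ℝ) :
    fderiv ℝ (extend f) (y, t • ξ) (w.1, t • w.2) = t ^ s * fderiv ℝ (extend f) (y, ξ) w := by
  let A : EuclideanSpace ℝ (Fin n) × (Fin n → ℝ) →L[ℝ] EuclideanSpace ℝ (Fin n) × (Fin n → ℝ) :=
    (ContinuousLinearMap.fst ℝ _ _).prod (t • ContinuousLinearMap.snd ℝ _ _)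
  have h1 : extend f ∘ A = t ^ s • extend f := by
    ext ⟨z, η⟩
    by_cases hz : z ∈ V
    · simpa [A, extend_apply _ hz] using h ⟨z, hz⟩ t η
    · simp [A, extend_of_notMem _ hz]
  have h2 := congrArg (fun g => fderiv ℝ g ((y : EuclideanSpace ℝ (Fin n)), ξ) w) h1
  simp only [fderiv_const_smul_field] at h2
  have hd := differentiableAt_extend hf (y, t • ξ)
  rw [fderiv_comp _ (g := extend f) (f := A) hd A.differentiableAt, A.fderiv] at h2
  exact h2

theorem IsHomog.dirDeriv_base {s : ℕ} (h : IsHomog s f) (hf : f ∈ smoothSubalgebra V)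
    (e : EuclideanSpace ℝ (Fin n)) : IsHomog s (dirDeriv (e, 0) f) := by
  intro y t ξ
  have h1 := h.fderiv_eq (e, 0) hf y t ξ
  rwa [smul_zero] at h1

theorem continuous_fibre (hf : f ∈ smoothSubalgebra V) (y : V) : Continuous fun ξ => f (y, ξ) := by
  have h : ContDiffOn ℝ ∞ (extend f) (tube V) := hf
  have h1 : Continuous fun ξ => extend f ((y : EuclideanSpace ℝ (Fin n)), ξ) :=
    h.continuousOn.comp_continuous (by fun_prop) fun ξ => ⟨y.2, trivial⟩
  refine h1.congr fun ξ => extend_apply f y.2 ξ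

theorem IsHomog.dirDeriv_fibre {s : ℕ} (h : IsHomog (s + 1) f) (hf : f ∈ smoothSubalgebra V)
    (e : Fin n → ℝ) : IsHomog s (dirDeriv (0, e) f) := by
  intro y t ξ
  have hc : Continuous fun t : ℝ => dirDeriv (0, e) f (y, t • ξ) :=
    (continuous_fibre (dirDeriv_mem (0, e) hf) y).comp (by fun_prop)
  have hc2 : Continuous fun t : ℝ => t ^ s * dirDeriv (0, e) f (y, ξ) := by fun_prop
  -- For t ≠ 0 one factor t cancels, which lowers the degree by one; the case t = 0 follows by
  -- continuity.
  refine congrFun (Continuous.ext_on (dense_compl_singleton (0 : ℝ)) hc hc2 fun r hr => ?_) t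
  have hr' : r ≠ 0 := hr
  have h1 := h.fderiv_eq (0, e) hf y r ξ
  have h2 : ((0 : EuclideanSpace ℝ (Fin n)), r • e) = r • (0, e) := by simp
  rw [h2, map_smul, smul_eq_mul, pow_succ', mul_assoc] at h1
  exact mul_left_cancel₀ hr' h1

theorem IsHomog.dirDeriv_fibre_zero (h : IsHomog 0 f)
    (e : Fin n → ℝ) : dirDeriv (0, e) f = 0 := by
  ext p
  -- Homogeneity of degree 0 is used at t = 0, where 0 ^ 0 = 1.
  have h1 : ∀ z ξ, extend f (z, ξ) = extend f (z, 0) := by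
    intro z ξ
    by_cases hz : z ∈ V
    · rw [extend_apply _ hz, extend_apply _ hz]
      simpa using (h ⟨z, hz⟩ 0 ξ).symm
    · rw [extend_of_notMem _ hz, extend_of_notMem _ hz]
  by_cases hd : DifferentiableAt ℝ (extend f) (p.1, p.2)
  · have h2 : (fun t : ℝ => extend f (((p.1 : EuclideanSpace ℝ (Fin n)), p.2) + t • (0, e))) =
        fun _ => extend f (p.1, p.2) := by
      ext t
      rw [Prod.smul_mk, Prod.mk_add_mk, smul_zero, add_zero, h1, ← h1 p.1 p.2]
    have h3 := hd.lineDeriv_eq_fderiv (v := ((0 : EuclideanSpace ℝ (Fin n)), e))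
    rw [lineDeriv, h2, deriv_const] at h3
    exact h3.symm
  · simp [dirDeriv, fderiv_zero_of_not_differentiableAt hd]

/-- The formal functions over `V`, as power series. -/
def formalSubalgebra (V : TopologicalSpace.Opens (EuclideanSpace ℝ (Fin n))) :
    Subalgebra ℝ (PowerSeries (V × (Fin n → ℝ) → ℝ)) where
  carrier := {F | ∀ s, PowerSeries.coeff s F ∈ smoothSubalgebra V ∧
    IsHomog s (PowerSeries.coeff s F)}
  mul_mem' {F G} hF hG := by
    intro s
    rw [PowerSeries.coeff_mul]
    refine ⟨sum_mem fun p _ => mul_mem (hF p.1).1 (hG p.2).1, fun y t ξ => ?_⟩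
    simp only [Finset.sum_apply, Pi.mul_apply, Finset.mul_sum]
    refine Finset.sum_congr rfl fun p hp => ?_
    rw [(hF p.1).2, (hG p.2).2, ← Finset.HasAntidiagonal.mem_antidiagonal.1 hp, pow_add]
    ring
  add_mem' {F G} hF hG := by
    intro s
    rw [map_add]
    refine ⟨add_mem (hF s).1 (hG s).1, fun y t ξ => ?_⟩
    simp only [Pi.add_apply, (hF s).2 y t ξ, (hG s).2 y t ξ, mul_add]
  algebraMap_mem' c := by
    intro s
    rw [PowerSeries.algebraMap_apply, PowerSeries.coeff_C]
    split_ifs with h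
    · refine ⟨Subalgebra.algebraMap_mem _ c, fun y t ξ => ?_⟩
      simp [h]
    · exact ⟨zero_mem _, fun y t ξ => by simp⟩

/-- The ring of formal functions over `V`. -/
abbrev FormalRing (V : TopologicalSpace.Opens (EuclideanSpace ℝ (Fin n))) : Type :=
  formalSubalgebra V

namespace FormalRing

/-- The homogeneous component of degree `s`. -/
def comp (s : ℕ) : FormalRing V →ₗ[ℝ] (V × (Fin n → ℝ) → ℝ) where
  toFun F := PowerSeries.coeff s F.1
  map_add' F G := by simp
  map_smul' c F := by
    ext p
    simp

theorem comp_mem (s : ℕ) (F : FormalRing V) : comp s F ∈ smoothSubalgebra V := (F.2 s).1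

theorem comp_homog (s : ℕ) (F : FormalRing V) : IsHomog s (comp s F) := (F.2 s).2

theorem comp_mul (s : ℕ) (F G : FormalRing V) :
    comp s (F * G) = ∑ p ∈ Finset.HasAntidiagonal.antidiagonal s, comp p.1 F * comp p.2 G :=
  PowerSeries.coeff_mul s F.1 G.1

theorem ext_comp {F G : FormalRing V} (h : ∀ s, comp s F = comp s G) : F = G :=
  Subtype.ext (PowerSeries.ext h)

theorem comp_one (s : ℕ) : comp s (1 : FormalRing V) = if s = 0 then 1 else 0 :=
  PowerSeries.coeff_one s

/-- A formal function from its homogeneous components. -/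
def ofComp (f : ℕ → V × (Fin n → ℝ) → ℝ) (hf : ∀ s, f s ∈ smoothSubalgebra V)
    (hf' : ∀ s, IsHomog s (f s)) : FormalRing V :=
  ⟨PowerSeries.mk f, fun s => by rw [PowerSeries.coeff_mk]; exact ⟨hf s, hf' s⟩⟩

theorem comp_ofComp (f : ℕ → V × (Fin n → ℝ) → ℝ) (hf : ∀ s, f s ∈ smoothSubalgebra V)
    (hf' : ∀ s, IsHomog s (f s)) (s : ℕ) : comp s (ofComp f hf hf') = f s :=
  PowerSeries.coeff_mk s f

theorem dirDeriv_sum {κ : Type*} (s : Finset κ) (w : EuclideanSpace ℝ (Fin n) × (Fin n → ℝ))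
    (f : κ → V × (Fin n → ℝ) → ℝ) (hf : ∀ i ∈ s, f i ∈ smoothSubalgebra V) :
    dirDeriv w (∑ i ∈ s, f i) = ∑ i ∈ s, dirDeriv w (f i) := by
  classical
  induction s using Finset.induction_on with
  | empty => simp [dirDeriv_zero]
  | insert a s ha ih =>
    rw [Finset.sum_insert ha, Finset.sum_insert ha,
      dirDeriv_add w (hf a (Finset.mem_insert_self a s))
        (sum_mem fun i hi => hf i (Finset.mem_insert_of_mem hi)),
      ih fun i hi => hf i (Finset.mem_insert_of_mem hi)]

theorem dirDeriv_comp_mul (w : EuclideanSpace ℝ (Fin n) × (Fin n → ℝ)) (s : ℕ)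
    (F G : FormalRing V) : dirDeriv w (comp s (F * G)) =
      ∑ p ∈ Finset.HasAntidiagonal.antidiagonal s, comp p.1 F * dirDeriv w (comp p.2 G)
      + ∑ p ∈ Finset.HasAntidiagonal.antidiagonal s, comp p.1 G * dirDeriv w (comp p.2 F) := by
  rw [comp_mul, dirDeriv_sum _ _ _ fun p _ => mul_mem (comp_mem _ _) (comp_mem _ _)]
  simp only [dirDeriv_mul w (comp_mem _ F) (comp_mem _ G), Finset.sum_add_distrib]
  congr 1
  rw [← Finset.Nat.sum_antidiagonal_swap]
  rfl

/-- The derivation `∂/∂y^j`. -/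
def bd (j : Fin n) : Derivation ℝ (FormalRing V) (FormalRing V) :=
  Derivation.mk'
    { toFun := fun F => ofComp (fun s => dirDeriv (EuclideanSpace.single j 1, 0) (comp s F))
        (fun s => dirDeriv_mem _ (comp_mem s F))
        (fun s => (comp_homog s F).dirDeriv_base (comp_mem s F) _)
      map_add' := fun F G => ext_comp fun s => by
        simp only [map_add, comp_ofComp, dirDeriv_add _ (comp_mem s F) (comp_mem s G)]
      map_smul' := fun c F => ext_comp fun s => by
        simp only [map_smul, comp_ofComp, dirDeriv_smul, RingHom.id_apply] }
    fun F G => ext_comp fun s => by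
      simp only [LinearMap.coe_mk, AddHom.coe_mk, smul_eq_mul, map_add, comp_ofComp,
        dirDeriv_comp_mul]
      simp only [comp_mul, comp_ofComp]

theorem comp_bd (s : ℕ) (j : Fin n) (F : FormalRing V) :
    comp s (bd j F) = dirDeriv (EuclideanSpace.single j 1, 0) (comp s F) :=
  comp_ofComp (fun s => dirDeriv (EuclideanSpace.single j 1, 0) (comp s F))
    (fun s => dirDeriv_mem _ (comp_mem s F))
    (fun s => (comp_homog s F).dirDeriv_base (comp_mem s F) _) s

/-- The derivation `∂/∂ξ_k`. -/
def fd (k : Fin n) : Derivation ℝ (FormalRing V) (FormalRing V) :=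
  Derivation.mk'
    { toFun := fun F => ofComp (fun s => dirDeriv (0, Pi.single k 1) (comp (s + 1) F))
        (fun s => dirDeriv_mem _ (comp_mem _ F))
        (fun s => (comp_homog _ F).dirDeriv_fibre (comp_mem _ F) _)
      map_add' := fun F G => ext_comp fun s => by
        simp only [map_add, comp_ofComp, dirDeriv_add _ (comp_mem _ F) (comp_mem _ G)]
      map_smul' := fun c F => ext_comp fun s => by
        simp only [map_smul, comp_ofComp, dirDeriv_smul, RingHom.id_apply] }
    fun F G => ext_comp fun s => by
      simp only [LinearMap.coe_mk, AddHom.coe_mk, smul_eq_mul, map_add, comp_ofComp,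
        dirDeriv_comp_mul]
      -- The antidiagonal of s + 1 has one pair too many in each sum, but there the differentiated
      -- factor has degree 0 and its fibre derivative vanishes.
      simp only [comp_mul, comp_ofComp, Finset.Nat.sum_antidiagonal_succ',
        (comp_homog 0 _).dirDeriv_fibre_zero, mul_zero, zero_add]

theorem comp_fd (s : ℕ) (k : Fin n) (F : FormalRing V) :
    comp s (fd k F) = dirDeriv (0, Pi.single k 1) (comp (s + 1) F) :=
  comp_ofComp (fun s => dirDeriv (0, Pi.single k 1) (comp (s + 1) F))
    (fun _ => dirDeriv_mem _ (comp_mem _ F))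
    (fun _ => (comp_homog _ F).dirDeriv_fibre (comp_mem _ F) _) s

theorem bd_comm (i j : Fin n) (F : FormalRing V) : bd i (bd j F) = bd j (bd i F) :=
  ext_comp fun s => by simp only [comp_bd]; exact dirDeriv_comm _ _ (comp_mem s F)

theorem fd_comm (i j : Fin n) (F : FormalRing V) : fd i (fd j F) = fd j (fd i F) :=
  ext_comp fun s => by simp only [comp_fd]; exact dirDeriv_comm _ _ (comp_mem _ F)

theorem fd_bd (i j : Fin n) (F : FormalRing V) : fd i (bd j F) = bd j (fd i F) :=
  ext_comp fun s => by simp only [comp_fd, comp_bd]; exact dirDeriv_comm _ _ (comp_mem _ F)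

/-- The fibre coordinate `ξ_k`. -/
def xi (k : Fin n) : FormalRing V :=
  ofComp (fun s p => if s = 1 then p.2 k else 0)
    (fun s => by
      change ContDiffOn ℝ ∞ _ _
      have h : ContDiff ℝ ∞ fun p : EuclideanSpace ℝ (Fin n) × (Fin n → ℝ) =>
          if s = 1 then p.2 k else 0 := by
        split_ifs
        · fun_prop
        · exact contDiff_const
      exact h.contDiffOn.congr fun p hp => by
        rw [← Prod.mk.eta (p := p), extend_apply _ hp.1])
    (fun s y t ξ => by by_cases h : s = 1 <;> simp [h])

theorem comp_xi (s : ℕ) (k : Fin n) (p : V × (Fin n → ℝ)) :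
    comp s (xi k) p = if s = 1 then p.2 k else 0 := by
  exact congrFun (comp_ofComp _ _ _ s) p

/-- The formal function of degree `0` defined by a smooth function on `V`. -/
def base (f : EuclideanSpace ℝ (Fin n) → ℝ) (hf : ContDiffOn ℝ ∞ f V) : FormalRing V :=
  ofComp (fun s p => if s = 0 then f p.1 else 0)
    (fun s => by
      have h : ContDiffOn ℝ ∞ (fun p : EuclideanSpace ℝ (Fin n) × (Fin n → ℝ) =>
          if s = 0 then f p.1 else 0) (tube V) := by
        split_ifs
        · exact hf.comp contDiff_fst.contDiffOn fun p hp => hp.1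
        · exact contDiffOn_const
      exact h.congr fun p hp => by
        rw [← Prod.mk.eta (p := p), extend_apply _ hp.1])
    (fun s y t ξ => by by_cases h : s = 0 <;> simp [h])

theorem comp_base (s : ℕ) (f : EuclideanSpace ℝ (Fin n) → ℝ) (hf : ContDiffOn ℝ ∞ f V)
    (p : V × (Fin n → ℝ)) : comp s (base f hf) p = if s = 0 then f p.1 else 0 := by
  exact congrFun (comp_ofComp _ _ _ s) p

theorem extend_eventuallyEq (f : V × (Fin n → ℝ) → ℝ)
    (g : EuclideanSpace ℝ (Fin n) × (Fin n → ℝ) → ℝ) (h : ∀ p : V × (Fin n → ℝ), f p = g (p.1, p.2))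
    (p : V × (Fin n → ℝ)) : extend f =ᶠ[𝓝 ((p.1 : EuclideanSpace ℝ (Fin n)), p.2)] g := by
  filter_upwards [isOpen_tube.mem_nhds (mem_tube p)] with q hq
  rw [← Prod.mk.eta (p := q), extend_apply _ hq.1, h]

theorem dirDeriv_congr (f : V × (Fin n → ℝ) → ℝ)
    (g : EuclideanSpace ℝ (Fin n) × (Fin n → ℝ) → ℝ) (h : ∀ p : V × (Fin n → ℝ), f p = g (p.1, p.2))
    (w : EuclideanSpace ℝ (Fin n) × (Fin n → ℝ)) (p : V × (Fin n → ℝ)) :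
    dirDeriv w f p = fderiv ℝ g (p.1, p.2) w := by
  rw [dirDeriv, (extend_eventuallyEq f g h p).fderiv_eq]

theorem fd_xi (i j : Fin n) : fd i (xi j : FormalRing V) = if i = j then 1 else 0 := by
  refine ext_comp fun s => ?_
  ext p
  rw [comp_fd, dirDeriv_congr _ (fun q => if s + 1 = 1 then q.2 j else 0)
    fun p => comp_xi (s + 1) j p]
  by_cases hs : s = 0
  · subst hs
    have : (fun q : EuclideanSpace ℝ (Fin n) × (Fin n → ℝ) => if 0 + 1 = 1 then q.2 j else 0) =
      ((ContinuousLinearMap.proj (R := ℝ) (φ := fun _ : Fin n => ℝ) j).comp (ContinuousLinearMap.snd ℝ _ _) : _ →L[ℝ] ℝ) := by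
      ext q; simp
    rw [this, ContinuousLinearMap.fderiv]
    by_cases hij : i = j
    · simp [hij, comp_one]
    · simp [hij, Ne.symm hij]
  · have : ∀ q : EuclideanSpace ℝ (Fin n) × (Fin n → ℝ), (if s + 1 = 1 then q.2 j else 0) = 0 :=
      fun q => by simp [hs]
    simp only [this]
    by_cases hij : i = j <;> simp [hij, comp_one, hs]

theorem bd_xi (i j : Fin n) : bd i (xi j : FormalRing V) = 0 := by
  refine ext_comp fun s => ?_
  ext p
  rw [comp_bd, dirDeriv_congr _ (fun q => if s = 1 then q.2 j else 0) fun p => comp_xi s j p]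
  by_cases hs : s = 1
  · have : (fun q : EuclideanSpace ℝ (Fin n) × (Fin n → ℝ) => if s = 1 then q.2 j else 0) =
      ((ContinuousLinearMap.proj (R := ℝ) (φ := fun _ : Fin n => ℝ) j).comp (ContinuousLinearMap.snd ℝ _ _) : _ →L[ℝ] ℝ) := by
      ext q; simp [hs]
    rw [this, ContinuousLinearMap.fderiv]
    simp
  · simp [hs]

theorem fd_base (k : Fin n) (f : EuclideanSpace ℝ (Fin n) → ℝ) (hf : ContDiffOn ℝ ∞ f V) :
    fd k (base f hf) = 0 := by
  refine ext_comp fun s => ?_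
  ext p
  rw [comp_fd, dirDeriv_congr _ (fun q => 0) fun p => comp_base (s + 1) f hf p]
  simp

end FormalRing

end FormalRing

/-! ### The filtration by order in ξ, homogeneous parts, and limits. -/

namespace FormalRing

variable {n : ℕ} {V : TopologicalSpace.Opens (EuclideanSpace ℝ (Fin n))}

/-- The ideal of formal functions of order at least `N` in the fibre variables. -/
def order (V : TopologicalSpace.Opens (EuclideanSpace ℝ (Fin n))) (N : ℕ) :
    Ideal (FormalRing V) where
  carrier := {F | ∀ r < N, comp r F = 0}
  add_mem' {F G} hF hG r hr := by rw [map_add, hF r hr, hG r hr, add_zero]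
  zero_mem' r _ := map_zero _
  smul_mem' F G hG r hr := by
    rw [smul_eq_mul, comp_mul]
    refine Finset.sum_eq_zero fun p hp => ?_
    have := Finset.HasAntidiagonal.mem_antidiagonal.1 hp
    rw [hG p.2 (by omega), mul_zero]

theorem order_anti {M N : ℕ} (h : M ≤ N) : order V N ≤ order V M :=
  fun _ hF r hr => hF r (hr.trans_le h)

theorem mem_order_zero (F : FormalRing V) : F ∈ order V 0 := fun r hr => absurd hr (by omega)

theorem mul_mem_order {M N : ℕ} {F G : FormalRing V} (hF : F ∈ order V M) (hG : G ∈ order V N) :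
    F * G ∈ order V (M + N) := by
  intro r hr
  rw [comp_mul]
  refine Finset.sum_eq_zero fun p hp => ?_
  have := Finset.HasAntidiagonal.mem_antidiagonal.1 hp
  by_cases h : p.1 < M
  · rw [hF p.1 h, zero_mul]
  · rw [hG p.2 (by omega), mul_zero]

theorem eq_zero_of_mem_order {F : FormalRing V} (h : ∀ N, F ∈ order V N) : F = 0 :=
  ext_comp fun s => by rw [h (s + 1) s (by omega), map_zero]

theorem bd_mem_order (j : Fin n) {N : ℕ} {F : FormalRing V} (hF : F ∈ order V N) :
    bd j F ∈ order V N := fun r hr => by rw [comp_bd, hF r hr, dirDeriv_zero]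

theorem fd_mem_order (k : Fin n) {N : ℕ} {F : FormalRing V} (hF : F ∈ order V (N + 1)) :
    fd k F ∈ order V N := fun r hr => by rw [comp_fd, hF (r + 1) (by omega), dirDeriv_zero]

theorem xi_mem_order (k : Fin n) : xi k ∈ order V 1 := fun r hr => by
  ext p
  rw [comp_xi, if_neg (by omega)]
  rfl

/-- The homogeneous part of degree `N`, as a formal function. -/
def hom (N : ℕ) : FormalRing V →ₗ[ℝ] FormalRing V where
  toFun F := ofComp (fun s => if s = N then comp s F else 0)
    (fun s => by split_ifs; exacts [comp_mem s F, zero_mem _])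
    (fun s => by split_ifs; exacts [comp_homog s F, fun y t ξ => by simp])
  map_add' F G := ext_comp fun s => by
    simp only [map_add, comp_ofComp]
    split_ifs <;> simp
  map_smul' c F := ext_comp fun s => by
    simp only [map_smul, comp_ofComp, RingHom.id_apply]
    split_ifs <;> simp

theorem comp_hom (s N : ℕ) (F : FormalRing V) :
    comp s (hom N F) = if s = N then comp s F else 0 :=
  comp_ofComp (fun s => if s = N then comp s F else 0)
    (fun s => by split_ifs; exacts [comp_mem s F, zero_mem _])
    (fun s => by split_ifs; exacts [comp_homog s F, fun y t ξ => by simp]) s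

theorem hom_mem_order (N : ℕ) (F : FormalRing V) : hom N F ∈ order V N := fun r hr => by
  rw [comp_hom, if_neg (by omega)]

theorem sub_hom_mem_order {N : ℕ} {F : FormalRing V} (hF : F ∈ order V N) :
    F - hom N F ∈ order V (N + 1) := fun r hr => by
  rw [map_sub, comp_hom]
  split_ifs with h
  · exact sub_self _
  · rw [hF r (by omega), sub_zero]

theorem hom_eq_zero {N : ℕ} {F : FormalRing V} (hF : F ∈ order V (N + 1)) : hom N F = 0 :=
  ext_comp fun s => by
    rw [comp_hom]
    split_ifs with h
    · rw [hF s (by omega), map_zero]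
    · rw [map_zero]

theorem fd_hom (k : Fin n) (N : ℕ) (F : FormalRing V) : fd k (hom (N + 1) F) = hom N (fd k F) :=
  ext_comp fun s => by
    rw [comp_fd, comp_hom, comp_hom, comp_fd]
    by_cases h : s = N <;> simp [h, dirDeriv_zero]

/-- `f` does not depend on the fibre variables. -/
def IsBase (f : FormalRing V) : Prop := ∀ s, s ≠ 0 → comp s f = 0

theorem isBase_base (f : EuclideanSpace ℝ (Fin n) → ℝ) (hf : ContDiffOn ℝ ∞ f V) :
    IsBase (base f hf) := fun s hs => by
  ext p
  rw [comp_base, if_neg hs]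
  rfl

theorem IsBase.comp_mul {f : FormalRing V} (hf : IsBase f) (s : ℕ) (F : FormalRing V) :
    comp s (f * F) = comp 0 f * comp s F := by
  rw [FormalRing.comp_mul, Finset.sum_eq_single (0, s)]
  · intro p hp hne
    have := Finset.HasAntidiagonal.mem_antidiagonal.1 hp
    rw [hf p.1 (fun h => hne (Prod.ext h (by simp only; omega))), zero_mul]
  · intro h
    exact absurd (Finset.HasAntidiagonal.mem_antidiagonal.2 (zero_add s)) h

theorem IsBase.hom_mul {f : FormalRing V} (hf : IsBase f) (N : ℕ) (F : FormalRing V) :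
    hom N (f * F) = f * hom N F :=
  ext_comp fun s => by
    rw [hf.comp_mul, comp_hom, comp_hom, hf.comp_mul]
    split_ifs <;> simp

theorem comp_xi_mul (s : ℕ) (k : Fin n) (F : FormalRing V) (p : V × (Fin n → ℝ)) :
    comp (s + 1) (xi k * F) p = p.2 k * comp s F p := by
  rw [FormalRing.comp_mul, Finset.sum_apply, Finset.sum_eq_single (1, s)]
  · rw [Pi.mul_apply, comp_xi, if_pos rfl]
  · intro q hq hne
    have := Finset.HasAntidiagonal.mem_antidiagonal.1 hq
    rw [Pi.mul_apply, comp_xi, if_neg fun h => hne (Prod.ext h (by simp only; omega)), zero_mul]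
  · intro h
    exact absurd (Finset.HasAntidiagonal.mem_antidiagonal.2 (add_comm 1 s)) h

/-- Euler's identity. -/
theorem sum_xi_mul_fd_hom (N : ℕ) (F : FormalRing V) :
    ∑ k, xi k * fd k (hom N F) = (N : ℝ) • hom N F := by
  refine ext_comp fun s => ?_
  ext p
  rw [map_sum, Finset.sum_apply, map_smul, comp_hom]
  rcases s with _ | s
  · have h : ∀ k : Fin n, comp 0 (xi k * fd k (hom N F)) p = 0 := fun k => by
      have := (Ideal.mul_mem_right (fd k (hom N F)) _ (xi_mem_order (V := V) k)) 0 (by omega)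
      rw [this]; rfl
    simp only [h, Finset.sum_const_zero]
    by_cases h0 : 0 = N
    · subst h0
      simp
    · simp [h0]
  · simp only [comp_xi_mul, comp_fd, comp_hom]
    split_ifs with hs
    · subst hs
      set f := comp (s + 1) F with hfdef
      have hf := comp_mem (s + 1) F
      have hh := comp_homog (s + 1) F
      have hd := differentiableAt_extend hf p
      -- The function t ↦ f(y, tξ) is differentiated at t = 1 in two ways: by the chain rule here,
      -- and as t^(s+1) f(y, ξ) in `h4`.
      have h1 : HasDerivAt (fun t : ℝ => extend f ((p.1 : EuclideanSpace ℝ (Fin n)), t • p.2))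
          (fderiv ℝ (extend f) (p.1, p.2) (0, p.2)) 1 := by
        have h2 : HasDerivAt (fun t : ℝ => ((p.1 : EuclideanSpace ℝ (Fin n)), t • p.2))
            (0, p.2) 1 := by
          have := (hasDerivAt_id (1 : ℝ)).smul_const p.2
          rw [one_smul] at this
          exact (hasDerivAt_const _ _).prodMk this
        have h3 : HasFDerivAt (extend f) (fderiv ℝ (extend f) (p.1, p.2))
            ((fun t : ℝ => ((p.1 : EuclideanSpace ℝ (Fin n)), t • p.2)) 1) := by
          simpa using hd.hasFDerivAt
        exact h3.comp_hasDerivAt 1 h2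
      have h4 : HasDerivAt (fun t : ℝ => extend f ((p.1 : EuclideanSpace ℝ (Fin n)), t • p.2))
          (((s + 1 : ℕ) : ℝ) * f p) 1 := by
        have h5 : (fun t : ℝ => extend f ((p.1 : EuclideanSpace ℝ (Fin n)), t • p.2)) =
            fun t => t ^ (s + 1) * f p := by
          ext t
          rw [extend_apply _ p.1.2]
          exact hh p.1 t p.2
        rw [h5]
        simpa using (hasDerivAt_pow (s + 1) (1 : ℝ)).mul_const (f p)
      have h6 := h1.unique h4
      have h7 : ((0 : EuclideanSpace ℝ (Fin n)), p.2) =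
          ∑ k, p.2 k • ((0 : EuclideanSpace ℝ (Fin n)), (Pi.single k 1 : Fin n → ℝ)) := by
        refine Prod.ext ?_ ?_
        · simp [Prod.fst_sum]
        · rw [Prod.snd_sum]
          simp only [Prod.smul_snd]
          exact (pi_eq_sum_univ' p.2)
      rw [h7, map_sum] at h6
      simp only [map_smul, smul_eq_mul] at h6
      simpa [dirDeriv] using h6
    · simp [dirDeriv_zero]

/-- Completeness for the filtration: the component of degree s no longer changes from F s on, so the
limit is taken diagonally. -/
theorem exists_limit (F : ℕ → FormalRing V)
    (h : ∀ N, F (N + 1) - F N ∈ order V (N + 1)) : ∃ G, ∀ N, G - F N ∈ order V (N + 1) := by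
  have h1 : ∀ r k, comp r (F (r + k)) = comp r (F r) := by
    intro r k
    induction k with
    | zero => rfl
    | succ k ih =>
      have := h (r + k) r (by omega)
      rw [map_sub, sub_eq_zero] at this
      rw [← add_assoc, this, ih]
  refine ⟨ofComp (fun s => comp s (F s)) (fun s => comp_mem s _) (fun s => comp_homog s _),
    fun N r hr => ?_⟩
  obtain ⟨k, rfl⟩ := Nat.exists_eq_add_of_le (Nat.lt_succ_iff.1 hr)
  rw [map_sub, comp_ofComp, h1, sub_self]

end FormalRing

/-! ### Solution of the Fundamental Equation over a chart, degree by degree. -/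

namespace FormalRing

variable {n : ℕ} {V : TopologicalSpace.Opens (EuclideanSpace ℝ (Fin n))}

/-- A calculus on the ring of formal functions, with its geometric derivations. -/
structure IsGeometric (S : FibreCalculus (Fin n) (FormalRing V)) : Prop where
  bd_eq : S.bd = bd
  fd_eq : S.fd = fd
  xi_eq : S.xi = xi
  base_π : ∀ i j, IsBase (S.π i j)

variable {S : FibreCalculus (Fin n) (FormalRing V)} (hS : IsGeometric S)
include hS

theorem IsGeometric.fd_mem {N : ℕ} {F : FormalRing V} (k : Fin n) (hF : F ∈ order V (N + 1)) :
    S.fd k F ∈ order V N := by rw [hS.fd_eq]; exact fd_mem_order k hF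

theorem IsGeometric.fd_mem' {N : ℕ} {F : FormalRing V} (k : Fin n) (hF : F ∈ order V N) :
    S.fd k F ∈ order V (N - 1) := by
  rcases N with _ | N
  · exact mem_order_zero _
  · exact hS.fd_mem k hF

theorem IsGeometric.xi_mem (k : Fin n) : S.xi k ∈ order V 1 := by
  rw [hS.xi_eq]; exact xi_mem_order k

theorem IsGeometric.xi_mul_mem {N : ℕ} {F : FormalRing V} (k : Fin n) (hF : F ∈ order V N) :
    S.xi k * F ∈ order V (N + 1) := by
  rw [add_comm]; exact mul_mem_order (hS.xi_mem k) hF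

theorem IsGeometric.nab_mem {N : ℕ} {F : FormalRing V} (i : Fin n) (hF : F ∈ order V N) :
    S.nab i F ∈ order V N := by
  rw [S.nab_apply]
  refine add_mem (sum_mem fun j _ => Ideal.mul_mem_left _ _ ?_) (sum_mem fun k _ => ?_)
  · rw [hS.bd_eq]; exact bd_mem_order j hF
  · rw [FibreCalculus.G, Finset.sum_mul]
    refine sum_mem fun j _ => ?_
    rw [mul_assoc]
    -- The factor ξ_j restores the order lost to ∂/∂ξ_k. For N = 0 the truncated N - 1 + 1 is larger
    -- than N, so only an inequality of orders holds.
    refine Ideal.mul_mem_left _ _ (order_anti (by omega) (hS.xi_mul_mem j (hS.fd_mem' k hF)))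

omit hS in
theorem potential_mem_order {N : ℕ} {u : Fin n → FormalRing V} (hu : ∀ k, u k ∈ order V N)
    (j : Fin n) : S.potential u j ∈ order V N :=
  sum_mem fun k _ => Ideal.mul_mem_left _ _ (hu k)

theorem IsGeometric.ham_mem {M N : ℕ} {v : Fin n → FormalRing V} {F : FormalRing V}
    (hv : ∀ s, v s ∈ order V M) (hF : F ∈ order V (N + 1)) : S.ham v F ∈ order V (M + N) := by
  rw [S.ham_apply]
  exact sum_mem fun s _ => mul_mem_order (hv s) (hS.fd_mem s hF)

omit hS in
theorem potential_add (u u' : Fin n → FormalRing V) (j : Fin n) :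
    S.potential (u + u') j = S.potential u j + S.potential u' j := by
  simp only [FibreCalculus.potential, Pi.add_apply, mul_add, Finset.sum_add_distrib]

omit hS in
theorem ham_add (v v' : Fin n → FormalRing V) (F : FormalRing V) :
    S.ham (v + v') F = S.ham v F + S.ham v' F := by
  simp only [S.ham_apply, Pi.add_apply, add_mul, Finset.sum_add_distrib]

omit hS in
-- Separates the increment into its ∇̄ part, which keeps the order of du, and its bracket part,
-- which can lower it by one and so governs the leading term.
theorem defect_add (u du : Fin n → FormalRing V) (v dv : Fin n → Fin n → FormalRing V)
    (i j : Fin n) : S.defect (u + du) (v + dv) i j = S.defect u v i j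
      + (- S.nab i (S.potential du j) + S.nab j (S.potential du i)
        + ∑ m, S.bd m (S.π i j) * S.potential du m)
      + (S.ham (v i + dv i) (S.potential du j) + S.ham (dv i) (S.potential u j)) := by
  simp only [FibreCalculus.defect, potential_add, map_add, mul_add, Finset.sum_add_distrib,
    Pi.add_apply, ham_add]
  ring

theorem IsGeometric.linear_mem {N : ℕ} {du : Fin n → FormalRing V} (hdu : ∀ k, du k ∈ order V N)
    (i j : Fin n) : - S.nab i (S.potential du j) + S.nab j (S.potential du i)
        + ∑ m, S.bd m (S.π i j) * S.potential du m ∈ order V N :=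
  add_mem (add_mem (neg_mem (hS.nab_mem i (potential_mem_order hdu j)))
    (hS.nab_mem j (potential_mem_order hdu i)))
    (sum_mem fun m _ => Ideal.mul_mem_left _ _ (potential_mem_order hdu m))

omit hS in
/-- `u`, `v` solve the normalized Fundamental Equation up to order `N`. -/
structure IsApprox (S : FibreCalculus (Fin n) (FormalRing V)) (N : ℕ)
    (u : Fin n → FormalRing V) (v : Fin n → Fin n → FormalRing V) : Prop where
  compat : S.Compatible u v
  normal : ∑ j, S.xi j * S.potential u j = 0
  defect_mem : ∀ i j, S.defect u v i j ∈ order V N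
  u_mem : ∀ k, u k + S.xi k ∈ order V 2
  v_mem : ∀ i k, v i k - (if i = k then 1 else 0) ∈ order V 1

omit hS in
-- When v is the identity modulo ξ, the second summand does not lower the order, and the Hamiltonian
-- field acts to leading order as ∂/∂ξ_i.
theorem ham_eq_fd_add (v : Fin n → Fin n → FormalRing V) (i : Fin n) (F : FormalRing V) :
    S.ham (v i) F = S.fd i F + S.ham (fun k => v i k - if i = k then 1 else 0) F := by
  simp [S.ham_apply, sub_mul, Finset.sum_sub_distrib]

/-- For u = -ξ the Hamiltonian field of U_i is ∂/∂ξ_i, and {U_i, U_j} = π^{ij} cancels Π; every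
other term of the defect contains a factor ξ. -/
theorem IsGeometric.isApprox_one :
    IsApprox S 1 (fun k => - S.xi k) (fun i k => if i = k then 1 else 0) := by
  have hU : ∀ j, S.potential (fun k => - S.xi k) j = - ∑ k, S.π j k * S.xi k := fun j => by
    rw [S.potential_neg]
  have hfd : ∀ i j, S.fd i (S.potential (fun k => - S.xi k) j) = S.π i j := fun i j => by
    rw [hU, S.antisymm i j]
    simp [map_sum, S.fd_π, S.fd_xi]
  have hm : ∀ j, S.potential (fun k => - S.xi k) j ∈ order V 1 :=
    potential_mem_order fun k => neg_mem (hS.xi_mem k)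
  refine ⟨fun i j => by simp [hfd], ?_, fun i j => ?_, fun k => by simp, fun i k => by simp⟩
  · have h : ∑ j, S.xi j * S.potential (fun k => - S.xi k) j =
        ∑ j, ∑ k, S.xi j * S.π k j * S.xi k := by
      refine Finset.sum_congr rfl fun j _ => ?_
      rw [hU, ← Finset.sum_neg_distrib, Finset.mul_sum]
      exact Finset.sum_congr rfl fun k _ => by rw [S.antisymm j k]; ring
    -- The quadratic form ξ_j π^{jk} ξ_k vanishes, being equal to its negative.
    have h2 : ∑ j, S.xi j * S.potential (fun k => - S.xi k) j =
        - ∑ j, S.xi j * S.potential (fun k => - S.xi k) j := by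
      conv_lhs => rw [h, Finset.sum_comm]
      simp only [hU, Finset.mul_sum, ← Finset.sum_neg_distrib]
      exact Finset.sum_congr rfl fun j _ => Finset.sum_congr rfl fun k _ => by ring
    have h3 := eq_neg_iff_add_eq_zero.1 h2
    rw [← two_smul ℝ, smul_eq_zero] at h3
    exact h3.resolve_left (by norm_num)
  · have h1 : S.ham (fun k => if i = k then 1 else 0) (S.potential (fun k => - S.xi k) j) =
        S.π i j := by simp [S.ham_apply, hfd]
    rw [FibreCalculus.defect, h1, add_sub_cancel_right]
    refine add_mem (add_mem (sub_mem ?_ (hS.nab_mem i (hm j))) (hS.nab_mem j (hm i)))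
      (sum_mem fun m _ => Ideal.mul_mem_left _ _ (hm m))
    rw [FibreCalculus.Q, Algebra.smul_def]
    refine Ideal.mul_mem_left _ _ (sum_mem fun b _ => Ideal.mul_mem_right _ _
      (sum_mem fun a _ => Ideal.mul_mem_right _ _ (hS.xi_mem a)))

/-- In the Bianchi identity all terms have order at least M + 1 except the derivatives ∂/∂ξ_i of the
defect, of order M. Its part of degree M says that the lowest component of the defect is a closed
2-form on the fibres. -/
theorem IsGeometric.defect_closed {M : ℕ} {u : Fin n → FormalRing V}
    {v : Fin n → Fin n → FormalRing V} (h : IsApprox S (M + 1) u v) (i j k : Fin n) :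
    S.fd i (hom (M + 1) (S.defect u v j k)) + S.fd j (hom (M + 1) (S.defect u v k i))
      + S.fd k (hom (M + 1) (S.defect u v i j)) = 0 := by
  have hb := h.compat.defect_bianchi i j k
  have hc : ∀ i j k, S.nab i (S.defect u v j k) - S.ham (v i) (S.defect u v j k)
      - ∑ l, S.bd l (S.π i j) * S.defect u v l k + S.fd i (S.defect u v j k) ∈
      order V (M + 1) := by
    intro i j k
    rw [ham_eq_fd_add]
    have h1 : S.nab i (S.defect u v j k)
        - S.ham (fun l => v i l - if i = l then 1 else 0) (S.defect u v j k)
        - ∑ l, S.bd l (S.π i j) * S.defect u v l k ∈ order V (M + 1) := by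
      refine sub_mem (sub_mem (hS.nab_mem i (h.defect_mem j k)) ?_)
        (sum_mem fun l _ => Ideal.mul_mem_left _ _ (h.defect_mem l k))
      rw [add_comm]
      exact hS.ham_mem (h.v_mem i) (h.defect_mem j k)
    convert h1 using 1
    ring
  have hd := add_mem (add_mem (hc i j k) (hc j k i)) (hc k i j)
  have he : S.fd i (S.defect u v j k) + S.fd j (S.defect u v k i) + S.fd k (S.defect u v i j) ∈
      order V (M + 1) := by
    convert hd using 1
    linear_combination -hb
  rw [hS.fd_eq] at he ⊢
  rw [fd_hom, fd_hom, fd_hom, ← map_add, ← map_add]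
  exact hom_eq_zero he

/-- The Poincaré lemma for the lowest component C of the defect: δU is a multiple of ι(𝓔)C with d_ξ
δU = -C. Since C_{ij} = π^{jk} c_{ik} with c homogeneous, δU is again of the form π^{jk} du_k. -/
theorem IsGeometric.exists_next {M : ℕ} {u : Fin n → FormalRing V}
    {v : Fin n → Fin n → FormalRing V} (h : IsApprox S (M + 1) u v) :
    ∃ u' v', IsApprox S (M + 2) u' v' ∧ (∀ k, u' k - u k ∈ order V (M + 2)) ∧
      ∀ i k, v' i k - v i k ∈ order V (M + 1) := by
  have hc := fun i => h.compat.inImage_defect i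
  choose c hc using hc
  set C : Fin n → Fin n → FormalRing V := fun i j => hom (M + 1) (S.defect u v i j) with hC
  have hCanti : ∀ i j, C i j = - C j i := fun i j => by
    simp only [hC]
    rw [h.compat.defect_antisymm i j, map_neg]
  have hCc : ∀ i j, C i j = ∑ k, S.π j k * hom (M + 1) (c i k) := fun i j => by
    simp only [hC, hc, map_sum, (hS.base_π _ _).hom_mul]
  -- The Lie derivative along 𝓔 multiplies a 2-form with coefficients of degree M + 1 by (M + 1) +
  -- 2.
  set a : ℝ := -(1 / (M + 3)) with ha
  set du : Fin n → FormalRing V := fun k => a • ∑ i, S.xi i * hom (M + 1) (c i k) with hdu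
  -- Dictated by ∂δU_j/∂ξ_i = ∂δU_i/∂ξ_j - C_{ij} = π^{is} (∂du_s/∂ξ_j + c_{js}).
  set dv : Fin n → Fin n → FormalRing V := fun i k => S.fd i (du k) + hom (M + 1) (c i k) with hdv
  have hdum : ∀ k, du k ∈ order V (M + 2) := fun k => by
    simp only [hdu, Algebra.smul_def]
    exact Ideal.mul_mem_left _ _ (sum_mem fun i _ => hS.xi_mul_mem i (hom_mem_order _ _))
  have hdvm : ∀ i k, dv i k ∈ order V (M + 1) := fun i k =>
    add_mem (hS.fd_mem i (hdum k)) (hom_mem_order _ _)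
  have hdU : ∀ j, S.potential du j = a • ∑ i, S.xi i * C i j := fun j => by
    simp only [FibreCalculus.potential, hdu, hCc, mul_smul_comm, ← Finset.smul_sum,
      Finset.mul_sum]
    congr 1
    rw [Finset.sum_comm]
    exact Finset.sum_congr rfl fun x _ => Finset.sum_congr rfl fun y _ => by ring
  -- Cartan's formula: `h2` combines closedness of C with Euler's identity, and the remaining 2
  -- C_{ij} come from differentiating the factor ξ in ι(𝓔)C.
  have hcl : ∀ i j, S.fd i (S.potential du j) - S.fd j (S.potential du i) = - C i j := by
    intro i j
    have h1 : ∀ i j, S.fd i (∑ b, S.xi b * C b j) = C i j + ∑ b, S.xi b * S.fd i (C b j) := by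
      intro i j
      simp only [map_sum, Derivation.leibniz, smul_eq_mul, S.fd_xi, Finset.sum_add_distrib,
        mul_ite, mul_one, mul_zero, Finset.sum_ite_eq, Finset.mem_univ, if_true]
      ring
    have h2 : ∑ b, S.xi b * S.fd i (C b j) - ∑ b, S.xi b * S.fd j (C b i) =
        ((M + 1 : ℕ) : ℝ) • C i j := by
      rw [hC, ← sum_xi_mul_fd_hom, ← Finset.sum_sub_distrib]
      refine Finset.sum_congr rfl fun b _ => ?_
      have h3 := hS.defect_closed h i b j
      have h4 : hom (M + 1) (S.defect u v j i) = - hom (M + 1) (S.defect u v i j) := by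
        rw [h.compat.defect_antisymm j i, map_neg]
      have h5 : hom (M + 1) (S.defect u v i b) = - hom (M + 1) (S.defect u v b i) := by
        rw [h.compat.defect_antisymm i b, map_neg]
      rw [h4, h5, map_neg, map_neg] at h3
      rw [← hS.xi_eq, ← hS.fd_eq]
      linear_combination (S.xi b) * h3
    rw [hdU, hdU, Derivation.map_smul, Derivation.map_smul, h1, h1, ← smul_sub]
    have h6 : C i j + ∑ b, S.xi b * S.fd i (C b j) - (C j i + ∑ b, S.xi b * S.fd j (C b i)) =
        ((M : ℝ) + 3) • C i j := by
      have h7 : ((M : ℝ) + 3) • C i j = ((M + 1 : ℕ) : ℝ) • C i j + 2 * C i j := by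
        rw [two_mul, ← two_smul ℝ (C i j), ← add_smul]
        congr 1
        push_cast
        ring
      rw [h7, ← h2, hCanti j i]
      ring
    rw [h6, smul_smul, ha]
    have : (-(1 / ((M : ℝ) + 3))) * (M + 3) = -1 := by
      have : (M : ℝ) + 3 ≠ 0 := by positivity
      field_simp
    rw [this, neg_one_smul]
  have hcompd : ∀ i j, S.fd i (S.potential du j) = ∑ s, S.π i s * dv j s := by
    intro i j
    have h1 : S.fd j (S.potential du i) = ∑ s, S.π i s * S.fd j (du s) := by
      simp only [FibreCalculus.potential, map_sum, Derivation.leibniz, smul_eq_mul, S.fd_π,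
        mul_zero, add_zero]
    have h2 := hcl i j
    rw [← hCanti j i, hCc j i, h1] at h2
    simp only [hdv, mul_add, Finset.sum_add_distrib]
    linear_combination h2
  refine ⟨u + du, v + dv, ⟨fun i j => ?_, ?_, fun i j => ?_, fun k => ?_, fun i k => ?_⟩,
    fun k => by simpa using hdum k, fun i k => by simpa using hdvm i k⟩
  · rw [potential_add, map_add, h.compat i j, hcompd]
    simp only [Pi.add_apply, mul_add, Finset.sum_add_distrib]
  · have h1 : ∑ j, S.xi j * S.potential du j = 0 := by
      have h2 : ∑ j, ∑ i, S.xi j * (S.xi i * C i j) = - ∑ j, ∑ i, S.xi j * (S.xi i * C i j) := by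
        conv_lhs => rw [Finset.sum_comm]
        simp only [← Finset.sum_neg_distrib]
        exact Finset.sum_congr rfl fun x _ => Finset.sum_congr rfl fun y _ => by
          rw [hCanti x y]; ring
      have h3 := eq_neg_iff_add_eq_zero.1 h2
      rw [← two_smul ℝ, smul_eq_zero] at h3
      simp only [hdU, mul_smul_comm, ← Finset.smul_sum, Finset.mul_sum]
      rw [h3.resolve_left (by norm_num), smul_zero]
    simp only [potential_add, mul_add, Finset.sum_add_distrib, h.normal, h1, add_zero]
  · rw [defect_add]
    -- Antisymmetry of the bracket between the old potential and the correction. Together with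
    -- `ham_eq_fd_add` it leaves d_ξ δU as the only new term of degree M + 1.
    have h1 : S.ham (dv i) (S.potential u j) = - S.ham (v j) (S.potential du i) := by
      rw [S.ham_apply, h.compat.sum_fd, S.ham_apply]
      simp only [hcompd]
    have h2 : S.ham (v i + dv i) (S.potential du j) = S.fd i (S.potential du j)
        + S.ham (fun k => (v i k - if i = k then 1 else 0) + dv i k) (S.potential du j) := by
      rw [ham_add, ham_eq_fd_add v, add_assoc, ← ham_add]
      rfl
    rw [h1, h2, ham_eq_fd_add v j]
    have h3 : S.defect u v i j - C i j ∈ order V (M + 2) := sub_hom_mem_order (h.defect_mem i j)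
    have hp := potential_mem_order (S := S) hdum
    have h4 := hS.ham_mem (M := 1) (N := M + 1)
      (fun k => add_mem (h.v_mem i k) (order_anti (by omega) (hdvm i k))) (hp j)
    have h5 := hS.ham_mem (M := 1) (N := M + 1) (h.v_mem j) (hp i)
    rw [show 1 + (M + 1) = M + 2 by omega] at h4 h5
    have h6 := add_mem (add_mem h3 (hS.linear_mem hdum i j)) (sub_mem h4 h5)
    convert h6 using 1
    linear_combination hcl i j
  · have := add_mem (h.u_mem k) (order_anti (show 2 ≤ M + 2 by omega) (hdum k))
    convert this using 1
    simp only [Pi.add_apply]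
    ring
  · have := add_mem (h.v_mem i k) (order_anti (show 1 ≤ M + 1 by omega) (hdvm i k))
    convert this using 1
    simp only [Pi.add_apply]
    ring

/-- The local solution of the normalized Fundamental Equation. -/
theorem IsGeometric.exists_solution : ∃ u v, S.Compatible u v ∧
    ∑ j, S.xi j * S.potential u j = 0 ∧ (∀ i j, S.defect u v i j = 0) ∧
    (∀ k, u k + S.xi k ∈ order V 2) ∧
    ∀ i k, v i k - (if i = k then 1 else 0) ∈ order V 1 := by
  -- The correction step is iterated from u = -ξ: `w N` solves the equation up to order N + 1. Each
  -- condition on the limit is then checked modulo order N for every N.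
  choose! f g hfg using fun (M : ℕ) (u : Fin n → FormalRing V)
    (v : Fin n → Fin n → FormalRing V) (h : IsApprox S (M + 1) u v) => hS.exists_next h
  let w : ℕ → (Fin n → FormalRing V) × (Fin n → Fin n → FormalRing V) := fun N =>
    Nat.rec (fun k => - S.xi k, fun i k => if i = k then 1 else 0)
      (fun N p => (f N p.1 p.2, g N p.1 p.2)) N
  have hw : ∀ N, IsApprox S (N + 1) (w N).1 (w N).2 := by
    intro N
    induction N with
    | zero => exact hS.isApprox_one
    | succ N ih => exact (hfg N _ _ ih).1
  have hu : ∀ k, ∃ G, ∀ N, G - (w N).1 k ∈ order V (N + 1) := fun k =>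
    exists_limit (fun N => (w N).1 k) fun N =>
      order_anti (by omega) ((hfg N _ _ (hw N)).2.1 k)
  have hv : ∀ i k, ∃ G, ∀ N, G - (w N).2 i k ∈ order V (N + 1) := fun i k =>
    exists_limit (fun N => (w N).2 i k) fun N => (hfg N _ _ (hw N)).2.2 i k
  choose u hu using hu
  choose v hv using hv
  have eu : ∀ N, u = (w N).1 + fun k => u k - (w N).1 k := fun N => by ext1 k; simp
  have ev : ∀ N, v = (w N).2 + fun i k => v i k - (w N).2 i k := fun N => by ext1 i; ext1 k; simp
  refine ⟨u, v, fun i j => ?_, ?_, fun i j => ?_, fun k => ?_, fun i k => ?_⟩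
  · rw [← sub_eq_zero]
    refine eq_zero_of_mem_order fun N => ?_
    have h1 := (hw N).compat i j
    have h2 : S.fd i (S.potential u j) - ∑ s, S.π i s * v j s =
        S.fd i (S.potential (fun k => u k - (w N).1 k) j)
        - ∑ s, S.π i s * (v j s - (w N).2 j s) := by
      rw [eu N, potential_add, map_add, h1]
      simp only [mul_sub, Finset.sum_sub_distrib, Pi.add_apply, add_sub_cancel_left]
      ring
    rw [h2]
    exact sub_mem (hS.fd_mem i (potential_mem_order (fun k => hu k N) j))
      (sum_mem fun s _ => Ideal.mul_mem_left _ _ (order_anti (by omega) (hv j s N)))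
  · refine eq_zero_of_mem_order fun N => ?_
    have h2 : ∑ j, S.xi j * S.potential u j =
        ∑ j, S.xi j * S.potential (fun k => u k - (w N).1 k) j := by
      conv_lhs => rw [eu N]
      simp only [potential_add, mul_add, Finset.sum_add_distrib, (hw N).normal, zero_add]
    rw [h2]
    exact sum_mem fun j _ => Ideal.mul_mem_left _ _ (order_anti (by omega)
      (potential_mem_order (fun k => hu k N) j))
  · refine eq_zero_of_mem_order fun N => ?_
    have hp := potential_mem_order (S := S) (fun k => hu k N)
    conv => rw [eu N, ev N, defect_add]
    -- No bound on the field is needed: the potential of the difference has order N + 1, and one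
    -- order is lost to ∂/∂ξ.
    have h1 := hS.ham_mem (M := 0) (v := (w N).2 i + fun k => v i k - (w N).2 i k)
      (fun k => mem_order_zero _) (hp j)
    have h2 : S.ham (fun k => v i k - (w N).2 i k) (S.potential (w N).1 j) ∈ order V N := by
      rw [S.ham_apply]
      exact sum_mem fun s _ => Ideal.mul_mem_right _ _ (order_anti (by omega) (hv i s N))
    rw [zero_add] at h1
    exact add_mem (add_mem (order_anti (by omega) ((hw N).defect_mem i j))
      (order_anti (by omega) (hS.linear_mem (fun k => hu k N) i j))) (add_mem h1 h2)
  · have := add_mem ((hw 1).u_mem k) (hu k 1)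
    convert this using 1
    ring
  · have := add_mem ((hw 0).v_mem i k) (hv i k 0)
    convert this using 1
    ring

end FormalRing

/-! ### Vectors and covectors in a chart. -/

section Charts

variable {n : ℕ} {M : Type*} [TopologicalSpace M] [ChartedSpace (EuclideanSpace ℝ (Fin n)) M]
  {e : OpenPartialHomeomorph M (EuclideanSpace ℝ (Fin n))} {y : EuclideanSpace ℝ (Fin n)}

section Coordinates

variable (he : e ∈ smoothCharts n M) (hy : y ∈ e.target)
include he hy

theorem hasMFDerivAt_chart_symm :
    HasMFDerivAt (𝓡 n) (𝓡 n) e.symm y (mfderiv (𝓡 n) (𝓡 n) e.symm y) :=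
  (((contMDiffOn_symm_of_mem_maximalAtlas he).contMDiffAt
    (e.open_target.mem_nhds hy)).mdifferentiableAt (by simp)).hasMFDerivAt

theorem contMDiffAt_chart : ContMDiffAt (𝓡 n) (𝓡 n) ∞ e (e.symm y) :=
  (contMDiffOn_of_mem_maximalAtlas he).contMDiffAt (e.open_source.mem_nhds (e.map_target hy))

theorem hasMFDerivAt_chart :
    HasMFDerivAt (𝓡 n) (𝓡 n) e (e.symm y) (mfderiv (𝓡 n) (𝓡 n) e (e.symm y)) :=
  ((contMDiffAt_chart he hy).mdifferentiableAt (by simp)).hasMFDerivAt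

omit he hy in
variable (e y) in
/-- The derivative of a chart at the point with coordinates `y`. -/
def chartDeriv : EuclideanSpace ℝ (Fin n) →L[ℝ] EuclideanSpace ℝ (Fin n) :=
  mfderiv (𝓡 n) (𝓡 n) e (e.symm y)

omit he hy in
variable (e y) in
/-- The derivative of the inverse of a chart at `y`. -/
def symmDeriv : EuclideanSpace ℝ (Fin n) →L[ℝ] EuclideanSpace ℝ (Fin n) :=
  mfderiv (𝓡 n) (𝓡 n) e.symm y

theorem chartDeriv_comp_symmDeriv : (chartDeriv e y).comp (symmDeriv e y) = .id ℝ _ := by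
  have h := ((hasMFDerivAt_chart he hy).comp _ (hasMFDerivAt_chart_symm he hy)).mfderiv
  have h2 : (e ∘ e.symm) =ᶠ[𝓝 y] id := by
    filter_upwards [e.open_target.mem_nhds hy] with z hz
    exact e.right_inv hz
  rw [h2.mfderiv_eq, mfderiv_id] at h
  exact h.symm

theorem symmDeriv_comp_chartDeriv : (symmDeriv e y).comp (chartDeriv e y) = .id ℝ _ := by
  -- The chain rule asks for the derivative of e.symm at e (e.symm y), which is equal to y but not
  -- definitionally.
  have h0 : ∀ z, z = y → HasMFDerivAt (𝓡 n) (𝓡 n) e.symm z (symmDeriv e y) := by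
    rintro _ rfl
    exact hasMFDerivAt_chart_symm he hy
  have h := ((h0 _ (e.right_inv hy)).comp _ (hasMFDerivAt_chart he hy)).mfderiv
  have h2 : (e.symm ∘ e) =ᶠ[𝓝 (e.symm y)] id := by
    filter_upwards [e.open_source.mem_nhds (e.map_target hy)] with z hz
    exact e.left_inv hz
  rw [h2.mfderiv_eq, mfderiv_id] at h
  exact h.symm

theorem coordCovector_apply (k : Fin n) (v : EuclideanSpace ℝ (Fin n)) :
    coordCovector e k (e.symm y) v = chartDeriv e y v k := by
  have h1 : HasMFDerivAt (𝓡 n) 𝓘(ℝ, ℝ) (fun z : EuclideanSpace ℝ (Fin n) => z k)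
      (e (e.symm y)) (EuclideanSpace.proj (𝕜 := ℝ) k : EuclideanSpace ℝ (Fin n) →L[ℝ] ℝ) :=
    (EuclideanSpace.proj (𝕜 := ℝ) k : EuclideanSpace ℝ (Fin n) →L[ℝ] ℝ).hasMFDerivAt
  have h2 := (h1.comp _ (hasMFDerivAt_chart he hy)).mfderiv
  exact congrArg (fun L : EuclideanSpace ℝ (Fin n) →L[ℝ] ℝ => L v) h2

theorem coordCovector_coordVector (i j : Fin n) :
    coordCovector e i (e.symm y) (coordVector e j y) = if i = j then 1 else 0 := by
  have h := congrArg (fun L => L (EuclideanSpace.single j 1) i) (chartDeriv_comp_symmDeriv he hy)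
  refine (coordCovector_apply he hy i _).trans (h.trans ?_)
  simp

theorem eq_sum_coordVector (v : TangentSpace (𝓡 n) (e.symm y)) :
    v = ∑ k, coordCovector e k (e.symm y) v • coordVector e k y := by
  have h := congrArg (fun L => L v) (symmDeriv_comp_chartDeriv he hy)
  have h4 : chartDeriv e y v = ∑ k, chartDeriv e y v k • EuclideanSpace.single k (1 : ℝ) := by
    ext i
    simp [Pi.single_apply]
  have h5 : symmDeriv e y (chartDeriv e y v) =
      ∑ k, chartDeriv e y v k • symmDeriv e y (EuclideanSpace.single k (1 : ℝ)) := by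
    conv_lhs => rw [h4, map_sum]
    simp only [map_smul]
  refine (h.symm.trans h5).trans ?_
  exact Finset.sum_congr rfl fun k _ =>
    congrArg (fun r : ℝ => r • symmDeriv e y (EuclideanSpace.single k (1 : ℝ)))
      (coordCovector_apply he hy k v).symm

theorem covectorOf_apply_coordVector (ξ : Fin n → ℝ) (k : Fin n) :
    covectorOf e (e.symm y) ξ (coordVector e k y) = ξ k := by
  rw [covectorOf, sum_apply]
  simp [coordCovector_coordVector he hy]

theorem covectorOf_coeff (η : Cot n (e.symm y)) :
    covectorOf e (e.symm y) (fun k => η (coordVector e k y)) = η := by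
  ext v
  conv_rhs => rw [eq_sum_coordVector he hy v, map_sum]
  rw [covectorOf, sum_apply]
  refine Finset.sum_congr rfl fun k _ => ?_
  rw [map_smul]
  simp [mul_comm]

theorem differential_coordVector {f : M → ℝ} (hf : MDifferentiableAt (𝓡 n) 𝓘(ℝ, ℝ) f (e.symm y))
    (k : Fin n) :
    differential n f (e.symm y) (coordVector e k y) = pdBase k (fun z => f (e.symm z)) y := by
  have h := (hf.hasMFDerivAt.comp _ (hasMFDerivAt_chart_symm he hy)).mfderiv
  rw [mfderiv_eq_fderiv] at h
  rw [pdBase]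
  exact congrArg (fun L : EuclideanSpace ℝ (Fin n) →L[ℝ] ℝ => L (EuclideanSpace.single k 1)) h.symm

theorem differential_eq {f : M → ℝ} (hf : MDifferentiableAt (𝓡 n) 𝓘(ℝ, ℝ) f (e.symm y)) :
    differential n f (e.symm y) =
      covectorOf e (e.symm y) fun k => pdBase k (fun z => f (e.symm z)) y := by
  rw [← covectorOf_coeff he hy (differential n f (e.symm y))]
  congr 1
  ext k
  exact differential_coordVector he hy hf k

end Coordinates

theorem covectorOf_smul (x : M) (t : ℝ) (ξ : Fin n → ℝ) :
    covectorOf e x (t • ξ) = t • covectorOf e x ξ := by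
  simp [covectorOf, Finset.smul_sum, mul_smul]

theorem covectorOf_add (x : M) (ξ η : Fin n → ℝ) :
    covectorOf e x (ξ + η) = covectorOf e x ξ + covectorOf e x η := by
  simp [covectorOf, add_smul, Finset.sum_add_distrib]

theorem covectorOf_single (x : M) (k : Fin n) :
    covectorOf e x (Pi.single k 1) = coordCovector e k x := by
  rw [covectorOf, Finset.sum_eq_single k]
  · simp
  · intro j _ hj
    simp [hj]
  · simp

theorem PoissonStructure.antisymm (P : PoissonStructure n M) (x : M) (η ζ : Cot n x) :
    P x η ζ = - P x ζ η := by
  have h := P.alternating' x (η + ζ)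
  rw [map_add, map_add, LinearMap.add_apply, LinearMap.add_apply, P.alternating', P.alternating',
    zero_add, add_zero] at h
  linarith

theorem PoissonStructure.apply_covectorOf (P : PoissonStructure n M) (ξ η : Fin n → ℝ) :
    P (e.symm y) (covectorOf e (e.symm y) ξ) (covectorOf e (e.symm y) η) =
      ∑ i, ∑ j, P.coeff e i j y * ξ i * η j := by
  simp only [covectorOf, map_sum, map_smul, LinearMap.sum_apply, LinearMap.smul_apply, smul_eq_mul,
    PoissonStructure.coeff]
  simp only [Finset.mul_sum]
  rw [Finset.sum_comm]
  exact Finset.sum_congr rfl fun i _ => Finset.sum_congr rfl fun j _ => by ring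

/-! ### Coordinate forms, extension of functions, and cutoffs. -/

section CoordForm

variable [IsManifold (𝓡 n) ∞ M] [T2Space M]

theorem coordForm_eventuallyEq (he : e ∈ smoothCharts n M) {x : M} (hx : x ∈ e.source) (i : Fin n) :
    ∀ᶠ p in 𝓝 x, coordForm e x i p = coordCovector e i p := by
  rw [coordForm, dif_pos ⟨he, hx⟩]
  exact (exists_oneForm_eventuallyEq he hx i).choose_spec

/-- A smooth function on a chart extends from a neighbourhood of a point to `M`. -/
theorem exists_contMDiffMap_eventuallyEq (he : e ∈ smoothCharts n M) {x : M} (hx : x ∈ e.source)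
    {f : EuclideanSpace ℝ (Fin n) → ℝ} (hf : ContDiffOn ℝ ∞ f e.target) :
    ∃ F : C^∞⟮𝓡 n, M; ℝ⟯, ∀ᶠ p in 𝓝 x, F p = f (e p) := by
  obtain ⟨χ, hχ, -⟩ := (SmoothBumpFunction.nhds_basis_support (I := 𝓡 n)
    (e.open_source.mem_nhds hx)).mem_iff.1 (e.open_source.mem_nhds hx)
  refine ⟨⟨fun p => χ p * f (e p), ?_⟩, ?_⟩
  · refine contMDiff_of_tsupport fun p hp => ?_
    have hp' : p ∈ e.source := hχ (closure_mono (Function.support_mul_subset_left _ _) hp)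
    have h1 : ContMDiffAt (𝓡 n) 𝓘(ℝ, ℝ) ∞ (fun p => f (e p)) p :=
      (hf.contDiffAt (e.open_target.mem_nhds (e.map_source hp'))).contMDiffAt.comp p
        ((contMDiffOn_of_mem_maximalAtlas he).contMDiffAt (e.open_source.mem_nhds hp'))
    exact χ.contMDiff.contMDiffAt.mul h1
  · filter_upwards [χ.eventuallyEq_one] with p hp
    simp [hp]

/-- A cutoff function. -/
theorem exists_cutoff {x : M} {U : Set M} (hU : U ∈ 𝓝 x) :
    ∃ F : C^∞⟮𝓡 n, M; ℝ⟯, F x = 1 ∧ ∀ p ∉ U, F p = 0 := by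
  obtain ⟨χ, hχ, -⟩ := (SmoothBumpFunction.nhds_basis_support (I := 𝓡 n) hU).mem_iff.1 hU
  refine ⟨⟨χ, χ.contMDiff⟩, χ.eq_one, fun p hp => ?_⟩
  exact image_eq_zero_of_notMem_tsupport fun h => hp (hχ h)

end CoordForm

namespace OneForm

@[ext]
theorem ext {α β : OneForm n M} (h : ∀ x, α x = β x) : α = β := by
  cases α
  cases β
  congr
  exact funext h

theorem add_apply (α β : OneForm n M) (x : M) : (α + β) x = α x + β x := rfl

theorem zero_apply (x : M) : (0 : OneForm n M) x = 0 := rfl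

theorem smul_apply (f : C^∞⟮𝓡 n, M; ℝ⟯) (α : OneForm n M) (x : M) : (f • α) x = f x • α x := rfl

instance : AddCommMonoid (OneForm n M) where
  add_assoc α β γ := ext fun x => add_assoc _ _ _
  zero_add α := ext fun x => zero_add _
  add_zero α := ext fun x => add_zero _
  add_comm α β := ext fun x => add_comm _ _
  nsmul := nsmulRec

theorem sum_apply {κ : Type*} (s : Finset κ) (α : κ → OneForm n M) (x : M) :
    (∑ i ∈ s, α i) x = ∑ i ∈ s, α i x := by
  classical
  induction s using Finset.induction_on with
  | empty => simp [zero_apply]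
  | insert a s ha ih => rw [Finset.sum_insert ha, Finset.sum_insert ha, add_apply, ih]

theorem covectorOf_coeff (he : e ∈ smoothCharts n M) (hy : y ∈ e.target)
    (α : OneForm n M) : covectorOf e (e.symm y) (fun k => α.coeff e k y) = α (e.symm y) :=
  FormalPoisson.covectorOf_coeff he hy _

end OneForm

/-! ### Locality of contravariant connections and their coordinate formula. -/

namespace ContravariantConnection

variable {P : PoissonStructure n M}

theorem map_zero_right (D : ContravariantConnection P) (α : OneForm n M) :
    D α 0 = 0 := by
  have h := D.add_right' α 0 0
  rw [add_zero] at h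
  ext1 x
  have h1 := congrArg (fun γ : OneForm n M => γ x) h
  exact (left_eq_add (a := D α 0 x)).1 h1

theorem map_zero_left (D : ContravariantConnection P) (β : OneForm n M) :
    D 0 β = 0 := by
  have h := D.add_left' 0 0 β
  rw [add_zero] at h
  ext1 x
  have h1 := congrArg (fun γ : OneForm n M => γ x) h
  exact (left_eq_add (a := D 0 β x)).1 h1

theorem map_sum_right (D : ContravariantConnection P) (α : OneForm n M)
    {κ : Type*} (s : Finset κ) (β : κ → OneForm n M) : D α (∑ i ∈ s, β i) = ∑ i ∈ s, D α (β i) :=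
  map_sum (⟨⟨D α, D.map_zero_right α⟩, D.add_right' α⟩ : OneForm n M →+ OneForm n M) β s

theorem map_sum_left (D : ContravariantConnection P) (β : OneForm n M)
    {κ : Type*} (s : Finset κ) (α : κ → OneForm n M) : D (∑ i ∈ s, α i) β = ∑ i ∈ s, D (α i) β :=
  map_sum (⟨⟨fun α => D α β, D.map_zero_left β⟩, fun α α' => D.add_left' α α' β⟩ :
    OneForm n M →+ OneForm n M) α s

variable [IsManifold (𝓡 n) ∞ M] [T2Space M] (D : ContravariantConnection P)

/-- With a cutoff χ, χ(x) = 1, the forms χβ and χβ' coincide globally, and in the Leibniz rule the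
terms Π(α, dχ)β and Π(α, dχ)β' agree at x. -/
theorem congr_right (α : OneForm n M) {β β' : OneForm n M} {x : M} (h : ∀ᶠ p in 𝓝 x, β p = β' p) :
    D α β x = D α β' x := by
  obtain ⟨χ, h1, h0⟩ := exists_cutoff (n := n) h
  have h2 : χ • β = χ • β' := by
    ext1 p
    rw [OneForm.smul_apply, OneForm.smul_apply]
    by_cases hp : β p = β' p
    · rw [hp]
    · rw [h0 p hp, zero_smul, zero_smul]
  have h3 := D.leibniz' χ α β x
  rw [h2, D.leibniz' χ α β' x, h1, one_smul, one_smul, h.self_of_nhds] at h3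
  exact (add_right_cancel h3).symm

theorem congr_left (β : OneForm n M) {α α' : OneForm n M} {x : M} (h : ∀ᶠ p in 𝓝 x, α p = α' p) :
    D α β x = D α' β x := by
  obtain ⟨χ, h1, h0⟩ := exists_cutoff (n := n) h
  have h2 : χ • α = χ • α' := by
    ext1 p
    rw [OneForm.smul_apply, OneForm.smul_apply]
    by_cases hp : α p = α' p
    · rw [hp]
    · rw [h0 p hp, zero_smul, zero_smul]
  have h3 := congrArg (fun γ : OneForm n M => γ x) (D.smul_left' χ α β)
  rw [h2, D.smul_left' χ α' β, OneForm.smul_apply, OneForm.smul_apply, h1, one_smul, one_smul] at h3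
  exact h3.symm

/-- The global extensions of dx^i in `christoffel` vary with the point. By locality those chosen at
y serve all nearby points, which yields smoothness of the symbols. -/
theorem christoffel_eventuallyEq (he : e ∈ smoothCharts n M) (hy : y ∈ e.target) (i j k : Fin n) :
    ∀ᶠ z in 𝓝 y, D.christoffel e i j k z =
      - (D (coordForm e (e.symm y) i) (coordForm e (e.symm y) j)).coeff e k z := by
  have hev : ∀ i, ∀ᶠ z in 𝓝 y, ∀ᶠ p in 𝓝 (e.symm z),
      coordForm e (e.symm y) i p = coordCovector e i p := fun i =>
    (e.continuousAt_symm hy).eventually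
      (coordForm_eventuallyEq he (e.map_target hy) i).eventually_nhds
  filter_upwards [hev i, hev j, e.open_target.mem_nhds hy] with z hi hj hz
  have hc : ∀ i, (∀ᶠ p in 𝓝 (e.symm z), coordForm e (e.symm y) i p = coordCovector e i p) →
      ∀ᶠ p in 𝓝 (e.symm z), coordForm e (e.symm z) i p = coordForm e (e.symm y) i p := fun i h => by
    filter_upwards [h, coordForm_eventuallyEq he (e.map_target hz) i] with p hp hp'
    rw [hp, hp']
  rw [christoffel, OneForm.coeff, OneForm.coeff, D.congr_left _ (hc i hi), D.congr_right _ (hc j hj)]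

theorem contDiffOn_christoffel (he : e ∈ smoothCharts n M) (i j k : Fin n) :
    ContDiffOn ℝ ∞ (D.christoffel e i j k) e.target := by
  intro y hy
  refine ContDiffAt.contDiffWithinAt ?_
  refine ContDiffAt.congr_of_eventuallyEq ?_ (D.christoffel_eventuallyEq he hy i j k)
  exact (((D _ _).smooth' e he k).contDiffAt (e.open_target.mem_nhds hy)).neg

theorem coeff_eq (he : e ∈ smoothCharts n M) (hy : y ∈ e.target) (α β : OneForm n M) (k : Fin n) :
    (D α β).coeff e k y = ∑ i, α.coeff e i y * (∑ j, P.coeff e i j y * pdBase j (β.coeff e k) y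
      - ∑ j, D.christoffel e i j k y * β.coeff e j y) := by
  set x := e.symm y with hx
  have hxs : x ∈ e.source := e.map_target hy
  -- Near x a form is a combination of global coordinate forms with globally smooth coefficients, to
  -- which the axioms of the connection apply; locality carries the result back to the original
  -- form.
  have hloc : ∀ α : OneForm n M, ∃ f : Fin n → C^∞⟮𝓡 n, M; ℝ⟯,
      (∀ᶠ p in 𝓝 x, α p = (∑ i, f i • coordForm e x i) p) ∧
      ∀ i, (∀ᶠ p in 𝓝 x, f i p = α.coeff e i (e p)) := by
    intro α
    choose f hf using fun i => exists_contMDiffMap_eventuallyEq he hxs (α.smooth' e he i)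
    refine ⟨f, ?_, hf⟩
    filter_upwards [Filter.eventually_all.2 hf,
      Filter.eventually_all.2 fun i => coordForm_eventuallyEq he hxs i,
      e.open_source.mem_nhds hxs] with p h1 h2 hp
    have h3 := OneForm.covectorOf_coeff he (e.map_source hp) α
    rw [e.left_inv hp] at h3
    rw [← h3, OneForm.sum_apply, covectorOf]
    refine Finset.sum_congr rfl fun i _ => ?_
    rw [OneForm.smul_apply, h2 i, h1 i]
    rfl
  obtain ⟨f, hf, hf'⟩ := hloc α
  obtain ⟨g, hg, hg'⟩ := hloc β
  have hfx : ∀ i, f i x = α.coeff e i y := fun i => by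
    rw [(hf' i).self_of_nhds, hx, e.right_inv hy]
  have hgx : ∀ i, g i x = β.coeff e i y := fun i => by
    rw [(hg' i).self_of_nhds, hx, e.right_inv hy]
  have hdg : ∀ i j, P x (coordForm e x i x) (differential n (g j) x) =
      ∑ l, P.coeff e i l y * pdBase l (β.coeff e j) y := by
    intro i j
    have hmd : MDifferentiableAt (𝓡 n) 𝓘(ℝ, ℝ) (g j) (e.symm y) :=
      (g j).contMDiff.contMDiffAt.mdifferentiableAt (by simp)
    have hpd : ∀ l, pdBase l (fun z => g j (e.symm z)) y = pdBase l (β.coeff e j) y := by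
      intro l
      have : (fun z => g j (e.symm z)) =ᶠ[𝓝 y] β.coeff e j := by
        filter_upwards [(e.continuousAt_symm hy).eventually (hg' j), e.open_target.mem_nhds hy]
          with z hz hzt
        rw [hz, e.right_inv hzt]
      rw [pdBase, pdBase, this.fderiv_eq]
    rw [(coordForm_eventuallyEq he hxs i).self_of_nhds, hx, differential_eq he hy hmd,
      ← covectorOf_single, P.apply_covectorOf]
    rw [Finset.sum_eq_single i]
    · simp [hpd]
    · intro b _ hb
      simp [hb]
    · simp
  have key : D α β x = ∑ i, f i x • ∑ j, (g j x • D (coordForm e x i) (coordForm e x j) x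
      + (∑ l, P.coeff e i l y * pdBase l (β.coeff e j) y) • coordForm e x j x) := by
    rw [D.congr_left β hf, D.map_sum_left, OneForm.sum_apply]
    refine Finset.sum_congr rfl fun i _ => ?_
    rw [D.smul_left', OneForm.smul_apply, D.congr_right _ hg, D.map_sum_right, OneForm.sum_apply]
    congr 1
    refine Finset.sum_congr rfl fun j _ => ?_
    rw [D.leibniz', hdg]
  have hcv : ∀ j, coordForm e x j x (coordVector e k y) = if j = k then 1 else 0 := fun j => by
    rw [(coordForm_eventuallyEq he hxs j).self_of_nhds]
    exact coordCovector_coordVector he hy j k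
  have hch : ∀ i j, D (coordForm e x i) (coordForm e x j) x (coordVector e k y) =
      - D.christoffel e i j k y := fun i j => by
    rw [christoffel, neg_neg]; rfl
  rw [OneForm.coeff, ← hx, key]
  simp only [sum_apply, smul_apply, add_apply, smul_eq_mul]
  refine Finset.sum_congr rfl fun i _ => ?_
  rw [hfx]
  congr 1
  have : ∀ j, g j x * D (coordForm e x i) (coordForm e x j) x (coordVector e k y)
      + (∑ l, P.coeff e i l y * pdBase l (β.coeff e j) y) * coordForm e x j x (coordVector e k y)
      = - (D.christoffel e i j k y * β.coeff e j y)
        + if j = k then ∑ l, P.coeff e i l y * pdBase l (β.coeff e j) y else 0 := fun j => by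
    rw [hcv, hch, hgx]
    split_ifs <;> ring
  refine (Finset.sum_congr rfl fun j _ => this j).trans ?_
  rw [Finset.sum_add_distrib, Finset.sum_neg_distrib]
  simp
  ring

end ContravariantConnection

end Charts

/-! ### Partial derivatives and the coordinate formula for the bracket of 1-forms. -/

section PdBase

variable {n : ℕ} {y : EuclideanSpace ℝ (Fin n)} {f g : EuclideanSpace ℝ (Fin n) → ℝ}

theorem pdBase_congr (k : Fin n) (h : f =ᶠ[𝓝 y] g) : pdBase k f y = pdBase k g y := by
  rw [pdBase, pdBase, h.fderiv_eq]

theorem pdBase_const (k : Fin n) (c : ℝ) : pdBase k (fun _ => c) y = 0 := by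
  simp [pdBase]

theorem pdBase_mul (k : Fin n) (hf : DifferentiableAt ℝ f y) (hg : DifferentiableAt ℝ g y) :
    pdBase k (fun z => f z * g z) y = f y * pdBase k g y + pdBase k f y * g y := by
  rw [pdBase, fderiv_fun_mul hf hg]
  simp [pdBase, mul_comm]

theorem pdBase_sum {κ : Type*} (s : Finset κ) (k : Fin n) {f : κ → EuclideanSpace ℝ (Fin n) → ℝ}
    (hf : ∀ i, DifferentiableAt ℝ (f i) y) :
    pdBase k (fun z => ∑ i ∈ s, f i z) y = ∑ i ∈ s, pdBase k (f i) y := by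
  rw [pdBase, fderiv_fun_sum fun i _ => hf i]
  simp [pdBase, sum_apply]

theorem pdBase_neg (k : Fin n) : pdBase k (fun z => - f z) y = - pdBase k f y := by
  simp [pdBase, fderiv_fun_neg]

/-- Among β_j ∂_k(#α)^j, -α_j ∂_k(#β)^j and -∂_k Π(α, β) the terms differentiating α or β cancel,
and one of the copies of α_i β_j ∂_k π^{ij} survives. -/
theorem bracketCoeff_eq {π : Fin n → Fin n → EuclideanSpace ℝ (Fin n) → ℝ}
    {α β : Fin n → EuclideanSpace ℝ (Fin n) → ℝ}
    (hπ : ∀ i j, DifferentiableAt ℝ (π i j) y) (hα : ∀ i, DifferentiableAt ℝ (α i) y)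
    (hβ : ∀ i, DifferentiableAt ℝ (β i) y) (ha : ∀ i j z, π i j z = - π j i z) (k : Fin n) :
    bracketCoeff π α β k y = ∑ i, ∑ j, α i y * β j y * pdBase k (π i j) y
      + ∑ i, α i y * ∑ j, π i j y * pdBase j (β k) y
      - ∑ i, β i y * ∑ j, π i j y * pdBase j (α k) y := by
  have hpa : ∀ i j, pdBase k (π i j) y = - pdBase k (π j i) y := fun i j => by
    rw [← pdBase_neg]; congr 1; ext z; exact ha i j z
  have h1 : ∀ α : Fin n → EuclideanSpace ℝ (Fin n) → ℝ, (∀ i, DifferentiableAt ℝ (α i) y) →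
      ∀ j, pdBase k (sharpCoeff π α j) y =
      ∑ i, (α i y * pdBase k (π i j) y + pdBase k (α i) y * π i j y) := by
    intro α hα j
    rw [show sharpCoeff π α j = fun z => ∑ i, α i z * π i j z from rfl,
      pdBase_sum _ _ fun i => (hα i).fun_mul (hπ i j)]
    exact Finset.sum_congr rfl fun i _ => pdBase_mul k (hα i) (hπ i j)
  have h2 : pdBase k (fun z => ∑ i, ∑ j, π i j z * α i z * β j z) y =
      ∑ i, ∑ j, (π i j y * α i y * pdBase k (β j) y
        + (π i j y * pdBase k (α i) y + pdBase k (π i j) y * α i y) * β j y) := by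
    rw [pdBase_sum _ _ fun i => DifferentiableAt.fun_sum fun j _ =>
      ((hπ i j).fun_mul (hα i)).fun_mul (hβ j)]
    refine Finset.sum_congr rfl fun i _ => ?_
    rw [pdBase_sum _ _ fun j => ((hπ i j).fun_mul (hα i)).fun_mul (hβ j)]
    refine Finset.sum_congr rfl fun j _ => ?_
    rw [pdBase_mul k ((hπ i j).fun_mul (hα i)) (hβ j), pdBase_mul k (hπ i j) (hα i)]
  have h3 : ∀ α β : Fin n → EuclideanSpace ℝ (Fin n) → ℝ,
      ∑ j, sharpCoeff π α j y * pdBase j (β k) y =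
      ∑ i, α i y * ∑ j, π i j y * pdBase j (β k) y := by
    intro α β
    simp only [sharpCoeff, Finset.sum_mul, Finset.mul_sum]
    rw [Finset.sum_comm]
    exact Finset.sum_congr rfl fun i _ => Finset.sum_congr rfl fun j _ => by ring
  have h4 : ∑ j, α j y * ∑ i, (β i y * pdBase k (π i j) y + pdBase k (β i) y * π i j y) =
      - ∑ i, ∑ j, (α i y * β j y * pdBase k (π i j) y + π i j y * α i y * pdBase k (β j) y) := by
    simp only [Finset.mul_sum, ← Finset.sum_neg_distrib]
    exact Finset.sum_congr rfl fun i _ => Finset.sum_congr rfl fun j _ => by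
      rw [hpa j i, ha j i]; ring
  have h5 : ∑ j, β j y * ∑ i, (α i y * pdBase k (π i j) y + pdBase k (α i) y * π i j y) =
      ∑ i, ∑ j, (α i y * β j y * pdBase k (π i j) y + π i j y * pdBase k (α i) y * β j y) := by
    simp only [Finset.mul_sum]
    rw [Finset.sum_comm]
    exact Finset.sum_congr rfl fun i _ => Finset.sum_congr rfl fun j _ => by ring
  rw [bracketCoeff, lieDerivCoeff, lieDerivCoeff, h2]
  simp only [h1 α hα, h1 β hβ]
  rw [Finset.sum_add_distrib, Finset.sum_add_distrib, h3, h3, h4, h5]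
  simp only [Finset.sum_add_distrib, add_mul]
  have h6 : ∑ i, ∑ j, pdBase k (π i j) y * α i y * β j y =
      ∑ i, ∑ j, α i y * β j y * pdBase k (π i j) y :=
    Finset.sum_congr rfl fun i _ => Finset.sum_congr rfl fun j _ => by ring
  rw [h6]
  ring

end PdBase

/-! ### The Jacobi, torsion and association identities in a chart. -/

section ChartIdentities

variable {n : ℕ} {M : Type*} [TopologicalSpace M] [ChartedSpace (EuclideanSpace ℝ (Fin n)) M]
  {e : OpenPartialHomeomorph M (EuclideanSpace ℝ (Fin n))} {y : EuclideanSpace ℝ (Fin n)}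
  {P : PoissonStructure n M}

theorem PoissonStructure.coeff_antisymm (P : PoissonStructure n M) (i j : Fin n)
    (z : EuclideanSpace ℝ (Fin n)) : P.coeff e i j z = - P.coeff e j i z :=
  P.antisymm _ _ _

theorem OneForm.coeff_differentiableAt (α : OneForm n M) (he : e ∈ smoothCharts n M)
    (hy : y ∈ e.target) (i : Fin n) : DifferentiableAt ℝ (α.coeff e i) y :=
  ((α.smooth' e he i).contDiffAt (e.open_target.mem_nhds hy)).differentiableAt (by simp)

theorem PoissonStructure.coeff_differentiableAt (P : PoissonStructure n M)
    (he : e ∈ smoothCharts n M) (hy : y ∈ e.target) (i j : Fin n) :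
    DifferentiableAt ℝ (P.coeff e i j) y :=
  ((P.smooth' e he i j).contDiffAt (e.open_target.mem_nhds hy)).differentiableAt (by simp)

theorem PoissonStructure.bracketCoeff_eq (P : PoissonStructure n M) (he : e ∈ smoothCharts n M)
    (hy : y ∈ e.target) (α β : OneForm n M) (k : Fin n) :
    bracketCoeff (P.coeff e) (α.coeff e) (β.coeff e) k y =
      ∑ i, ∑ j, α.coeff e i y * β.coeff e j y * pdBase k (P.coeff e i j) y
      + ∑ i, α.coeff e i y * ∑ j, P.coeff e i j y * pdBase j (β.coeff e k) y
      - ∑ i, β.coeff e i y * ∑ j, P.coeff e i j y * pdBase j (α.coeff e k) y :=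
  FormalPoisson.bracketCoeff_eq (P.coeff_differentiableAt he hy)
    (α.coeff_differentiableAt he hy) (β.coeff_differentiableAt he hy)
    (fun i j z => P.coeff_antisymm i j z) k

variable [IsManifold (𝓡 n) ∞ M] [T2Space M]

theorem coordForm_coeff (he : e ∈ smoothCharts n M) (hy : y ∈ e.target) (i j : Fin n) :
    (coordForm e (e.symm y) i).coeff e j =ᶠ[𝓝 y] fun _ => if i = j then 1 else 0 := by
  filter_upwards [(e.continuousAt_symm hy).eventually
    (coordForm_eventuallyEq he (e.map_target hy) i), e.open_target.mem_nhds hy] with z hz hzt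
  rw [OneForm.coeff, hz]
  exact coordCovector_coordVector he hzt i j

/-- The Jacobi identity is available for global functions; it is applied to global functions that
agree with the coordinates near the point, which suffices because brackets are local. -/
theorem PoissonStructure.coeff_jacobi (P : PoissonStructure n M) (he : e ∈ smoothCharts n M)
    (hy : y ∈ e.target) (i j k : Fin n) :
    ∑ l, P.coeff e i l y * pdBase l (P.coeff e j k) y
      + ∑ l, P.coeff e j l y * pdBase l (P.coeff e k i) y
      + ∑ l, P.coeff e k l y * pdBase l (P.coeff e i j) y = 0 := by
  have hx := e.map_target hy
  have hc : ∀ i : Fin n, ∃ F : C^∞⟮𝓡 n, M; ℝ⟯, ∀ᶠ p in 𝓝 (e.symm y), F p = e p i := fun i =>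
    exists_contMDiffMap_eventuallyEq he hx
      (EuclideanSpace.proj (𝕜 := ℝ) i : EuclideanSpace ℝ (Fin n) →L[ℝ] ℝ).contDiff.contDiffOn
  choose F hF using hc
  have hd : ∀ i, ∀ᶠ p in 𝓝 (e.symm y), differential n (F i) p = coordCovector e i p := by
    intro i
    filter_upwards [(hF i).eventually_nhds] with p hp
    exact Filter.EventuallyEq.mfderiv_eq hp
  have hb : ∀ j k, ∀ᶠ p in 𝓝 (e.symm y),
      functionBracket P.toFun (F j) (F k) p = P.coeff e j k (e p) := by
    intro j k
    filter_upwards [hd j, hd k, e.open_source.mem_nhds hx] with p h1 h2 hp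
    rw [functionBracket, h1, h2, PoissonStructure.coeff, e.left_inv hp]
  have hfin : ∀ i j k, functionBracket P.toFun (F i) (functionBracket P.toFun (F j) (F k))
      (e.symm y) = ∑ l, P.coeff e i l y * pdBase l (P.coeff e j k) y := by
    intro i j k
    have hmd : MDifferentiableAt (𝓡 n) 𝓘(ℝ, ℝ) (functionBracket P.toFun (F j) (F k))
        (e.symm y) := by
      have h1 : MDifferentiableAt (𝓡 n) 𝓘(ℝ, ℝ) (fun p => P.coeff e j k (e p)) (e.symm y) := by
        have h2 : DifferentiableAt ℝ (P.coeff e j k) (e (e.symm y)) := by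
          rw [e.right_inv hy]; exact P.coeff_differentiableAt he hy j k
        exact h2.mdifferentiableAt.comp _ (hasMFDerivAt_chart he hy).mdifferentiableAt
      exact h1.congr_of_eventuallyEq (hb j k)
    have hpd : ∀ l, pdBase l (fun z => functionBracket P.toFun (F j) (F k) (e.symm z)) y =
        pdBase l (P.coeff e j k) y := fun l => pdBase_congr l (by
      filter_upwards [(e.continuousAt_symm hy).eventually (hb j k), e.open_target.mem_nhds hy]
        with z hz hzt
      rw [hz, e.right_inv hzt])
    rw [functionBracket, differential_eq he hy hmd, (hd i).self_of_nhds, ← covectorOf_single,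
      P.apply_covectorOf, Finset.sum_eq_single i]
    · simp [hpd]
    · intro b _ hb
      simp [hb]
    · simp
  have := P.jacobi' (F i) (F j) (F k) (e.symm y)
  rw [hfin, hfin, hfin] at this
  exact this

theorem bracketCoeff_coordForm (he : e ∈ smoothCharts n M) (hy : y ∈ e.target) (i j k : Fin n) :
    bracketCoeff (P.coeff e) ((coordForm e (e.symm y) i).coeff e)
      ((coordForm e (e.symm y) j).coeff e) k y = pdBase k (P.coeff e i j) y := by
  have h0 : ∀ i k l, pdBase l ((coordForm e (e.symm y) i).coeff e k) y = 0 := fun i k l => by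
    rw [pdBase_congr l (coordForm_coeff he hy i k), pdBase_const]
  have h1 : ∀ i k, (coordForm e (e.symm y) i).coeff e k y = if i = k then 1 else 0 :=
    fun i k => (coordForm_coeff he hy i k).self_of_nhds
  rw [P.bracketCoeff_eq he hy]
  simp [h0, h1]

theorem ContravariantConnection.TorsionFree.christoffel_sub {D : ContravariantConnection P}
    (h : D.TorsionFree) (he : e ∈ smoothCharts n M) (hy : y ∈ e.target) (i j k : Fin n) :
    D.christoffel e j i k y - D.christoffel e i j k y = pdBase k (P.coeff e i j) y := by
  have h1 := h (coordForm e (e.symm y) i) (coordForm e (e.symm y) j) e he y hy k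
  rw [bracketCoeff_coordForm he hy] at h1
  rw [ContravariantConnection.christoffel, ContravariantConnection.christoffel]
  linarith

/-- On coordinate forms the derivatives of π in the association condition form exactly a Jacobi sum,
so an algebraic relation between Γ and Γ' remains. -/
theorem ContravariantConnection.Associated.sum_christoffel {D D' : ContravariantConnection P}
    (h : Associated D D') (he : e ∈ smoothCharts n M) (hy : y ∈ e.target) (i j k : Fin n) :
    ∑ l, P.coeff e i l y * D.christoffel e j k l y =
      ∑ l, P.coeff e j l y * D'.christoffel e i k l y := by
  have h1 := h (coordForm e (e.symm y) i) (coordForm e (e.symm y) j) e he y hy k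
  have hc : ∀ i k, (coordForm e (e.symm y) i).coeff e k y = if i = k then 1 else 0 :=
    fun i k => (coordForm_coeff he hy i k).self_of_nhds
  have hs : ∀ j k, sharpCoeff (P.coeff e) ((coordForm e (e.symm y) j).coeff e) k =ᶠ[𝓝 y]
      P.coeff e j k := by
    intro j k
    filter_upwards [Filter.eventually_all.2 fun l => coordForm_coeff he hy j l] with z hz
    simp [sharpCoeff, hz]
  have hv : ∀ (Γ : Fin n → Fin n → Fin n → EuclideanSpace ℝ (Fin n) → ℝ) i j,
      connVectorCoeff (P.coeff e) Γ ((coordForm e (e.symm y) i).coeff e)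
        (sharpCoeff (P.coeff e) ((coordForm e (e.symm y) j).coeff e)) k y =
      ∑ l, P.coeff e i l y * pdBase l (P.coeff e j k) y
        + ∑ l, P.coeff e j l y * Γ i k l y := by
    intro Γ i j
    simp only [connVectorCoeff, hc, pdBase_congr _ (hs j k), (hs j _).self_of_nhds]
    simp [Finset.sum_add_distrib, mul_comm]
  have hb : sharpCoeff (P.coeff e) (bracketCoeff (P.coeff e)
      ((coordForm e (e.symm y) i).coeff e) ((coordForm e (e.symm y) j).coeff e)) k y =
      ∑ l, pdBase l (P.coeff e i j) y * P.coeff e l k y := by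
    simp only [sharpCoeff, bracketCoeff_coordForm he hy]
  rw [hv, hv, hb] at h1
  have hJ := P.coeff_jacobi he hy i j k
  have h2 : ∀ l, pdBase l (P.coeff e k i) y = - pdBase l (P.coeff e i k) y := fun l => by
    rw [← pdBase_neg]; congr 1; ext z; exact P.coeff_antisymm k i z
  have h3 : ∑ l, P.coeff e k l y * pdBase l (P.coeff e i j) y =
      - ∑ l, pdBase l (P.coeff e i j) y * P.coeff e l k y := by
    rw [← Finset.sum_neg_distrib]
    exact Finset.sum_congr rfl fun l _ => by rw [P.coeff_antisymm k l]; ring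
  simp only [h2, h3, mul_neg, Finset.sum_neg_distrib] at hJ
  linarith

end ChartIdentities

/-! ### Correspondence between local formal functions and elements of the ring. -/

namespace FormalRing

variable {n : ℕ} {V : TopologicalSpace.Opens (EuclideanSpace ℝ (Fin n))}

/-- The local formal function `G` agrees with `F` over `V`. -/
def Represents (G : LocalFormal n) (F : FormalRing V) : Prop :=
  ∀ (s : ℕ) (y : EuclideanSpace ℝ (Fin n)) (hy : y ∈ V) (ξ : Fin n → ℝ),
    G s y ξ = comp s F (⟨y, hy⟩, ξ)

theorem comp_sum_apply {κ : Type*} (t : Finset κ) (s : ℕ) (F : κ → FormalRing V)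
    (p : V × (Fin n → ℝ)) : comp s (∑ i ∈ t, F i) p = ∑ i ∈ t, comp s (F i) p := by
  rw [map_sum, Finset.sum_apply]

theorem comp_xi_mul_fd (s : ℕ) (j k : Fin n) (F : FormalRing V) (p : V × (Fin n → ℝ)) :
    comp s (xi j * fd k F) p = p.2 j * dirDeriv (0, Pi.single k 1) (comp s F) p := by
  rcases s with _ | s
  · rw [(comp_homog 0 F).dirDeriv_fibre_zero, FormalRing.comp_mul]
    simp [comp_xi]
  · rw [comp_xi_mul, comp_fd]

theorem Represents.isFormalOn {G : LocalFormal n} {F : FormalRing V} (h : Represents G F) :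
    IsFormalOn V G := by
  intro s
  refine ⟨?_, fun y hy t ξ => ?_⟩
  · have h1 : ContDiffOn ℝ ∞ (extend (comp s F)) (tube V) := comp_mem s F
    refine h1.congr fun p hp => ?_
    exact (h s p.1 hp.1 p.2).trans (extend_apply _ hp.1 p.2).symm
  · rw [h s y hy, h s y hy]
    exact comp_homog s F ⟨y, hy⟩ t ξ

theorem exists_represents {G : LocalFormal n} (h : IsFormalOn V G) :
    ∃ F : FormalRing V, Represents G F := by
  refine ⟨ofComp (fun s p => G s p.1 p.2) (fun s => ?_) (fun s y t ξ => (h s).2 y y.2 t ξ),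
    fun s y hy ξ => ?_⟩
  · change ContDiffOn ℝ ∞ _ _
    refine (h s).1.congr fun p hp => ?_
    rw [← Prod.mk.eta (p := p), extend_apply _ hp.1]
  · exact (congrFun (comp_ofComp (fun s (p : V × (Fin n → ℝ)) => G s p.1 p.2) _ _ s)
      (⟨y, hy⟩, ξ)).symm

theorem Represents.pdBase_eq {G : LocalFormal n} {F : FormalRing V} (h : Represents G F) (s : ℕ)
    {y : EuclideanSpace ℝ (Fin n)} (hy : y ∈ V) (ξ : Fin n → ℝ) (j : Fin n) :
    pdBase j (fun z => G s z ξ) y =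
      dirDeriv (EuclideanSpace.single j 1, 0) (comp s F) (⟨y, hy⟩, ξ) := by
  have h1 : (fun z => G s z ξ) =ᶠ[𝓝 y] extend (comp s F) ∘ fun z => (z, ξ) := by
    filter_upwards [V.isOpen.mem_nhds hy] with z hz
    rw [h s z hz, Function.comp, extend_apply]
  have hd := differentiableAt_extend (comp_mem s F) (⟨y, hy⟩, ξ)
  rw [pdBase_congr j h1, pdBase, fderiv_comp (f := fun z => (z, ξ)) _ hd (by fun_prop),
    dirDeriv]
  have h2 : fderiv ℝ (fun z : EuclideanSpace ℝ (Fin n) => (z, ξ)) y =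
      ContinuousLinearMap.inl ℝ _ _ := (hasFDerivAt_prodMk_left y ξ).fderiv
  rw [h2]
  rfl

theorem Represents.hasFDerivAt_fibre {G : LocalFormal n} {F : FormalRing V} (h : Represents G F)
    (s : ℕ) {y : EuclideanSpace ℝ (Fin n)} (hy : y ∈ V) (ξ : Fin n → ℝ) :
    HasFDerivAt (G s y) ((fderiv ℝ (extend (comp s F)) (y, ξ)).comp
      (ContinuousLinearMap.inr ℝ _ _)) ξ := by
  have h1 : G s y = extend (comp s F) ∘ fun ζ => (y, ζ) := by
    ext ζ
    rw [h s y hy, Function.comp, extend_apply]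
  have hd := differentiableAt_extend (comp_mem s F) (⟨y, hy⟩, ξ)
  rw [h1]
  exact hd.hasFDerivAt.comp ξ (hasFDerivAt_prodMk_right y ξ)

theorem Represents.pdFibre_eq {G : LocalFormal n} {F : FormalRing V} (h : Represents G F) (s : ℕ)
    {y : EuclideanSpace ℝ (Fin n)} (hy : y ∈ V) (ξ : Fin n → ℝ) (k : Fin n) :
    pdFibre k (G s y) ξ = dirDeriv (0, Pi.single k 1) (comp s F) (⟨y, hy⟩, ξ) := by
  rw [pdFibre, (h.hasFDerivAt_fibre s hy ξ).fderiv]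
  rfl

theorem represents_xiCoord (k : Fin n) : Represents (xiCoord k) (xi k : FormalRing V) :=
  fun s y hy ξ => (comp_xi s k (⟨y, hy⟩, ξ)).symm

/-- `f` is the formal function of degree `0` given by `a` over `V`. -/
def RepresentsBase (a : EuclideanSpace ℝ (Fin n) → ℝ) (f : FormalRing V) : Prop :=
  ∀ (s : ℕ) (y : EuclideanSpace ℝ (Fin n)) (hy : y ∈ V) (ξ : Fin n → ℝ),
    (if s = 0 then a y else 0) = comp s f (⟨y, hy⟩, ξ)

theorem RepresentsBase.represents {a : EuclideanSpace ℝ (Fin n) → ℝ} {f : FormalRing V}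
    (h : RepresentsBase a f) : Represents (fun s y _ => if s = 0 then a y else 0) f := h

theorem representsBase_base (f : EuclideanSpace ℝ (Fin n) → ℝ) (hf : ContDiffOn ℝ ∞ f V) :
    RepresentsBase f (base f hf) := fun s y hy ξ => (comp_base s f hf (⟨y, hy⟩, ξ)).symm

theorem RepresentsBase.isBase {a : EuclideanSpace ℝ (Fin n) → ℝ} {f : FormalRing V}
    (h : RepresentsBase a f) : IsBase f := fun s hs => by
  ext p
  rw [← h s p.1 p.1.2 p.2, if_neg hs]
  rfl

theorem RepresentsBase.comp_zero {a : EuclideanSpace ℝ (Fin n) → ℝ} {f : FormalRing V}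
    (h : RepresentsBase a f) (p : V × (Fin n → ℝ)) : comp 0 f p = a p.1 := by
  rw [← h 0 p.1 p.1.2 p.2, if_pos rfl]

theorem RepresentsBase.comp_mul {a : EuclideanSpace ℝ (Fin n) → ℝ} {f : FormalRing V}
    (h : RepresentsBase a f) (s : ℕ) (F : FormalRing V) (p : V × (Fin n → ℝ)) :
    comp s (f * F) p = a p.1 * comp s F p := by
  rw [h.isBase.comp_mul, Pi.mul_apply, h.comp_zero]

theorem RepresentsBase.mul {a b : EuclideanSpace ℝ (Fin n) → ℝ} {f g : FormalRing V}
    (hf : RepresentsBase a f) (hg : RepresentsBase b g) : RepresentsBase (fun z => a z * b z)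
      (f * g) := fun s y hy ξ => by
  rw [hf.comp_mul, ← hg s y hy]
  split_ifs <;> simp

theorem RepresentsBase.sum {κ : Type*} (t : Finset κ) {a : κ → EuclideanSpace ℝ (Fin n) → ℝ}
    {f : κ → FormalRing V} (h : ∀ i ∈ t, RepresentsBase (a i) (f i)) :
    RepresentsBase (fun z => ∑ i ∈ t, a i z) (∑ i ∈ t, f i) := fun s y hy ξ => by
  rw [comp_sum_apply, ← Finset.sum_congr rfl fun i hi => h i hi s y hy ξ]
  split_ifs <;> simp

theorem RepresentsBase.add {a b : EuclideanSpace ℝ (Fin n) → ℝ} {f g : FormalRing V}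
    (hf : RepresentsBase a f) (hg : RepresentsBase b g) : RepresentsBase (fun z => a z + b z)
      (f + g) := fun s y hy ξ => by
  rw [map_add, Pi.add_apply, ← hf s y hy, ← hg s y hy]
  split_ifs <;> simp

theorem RepresentsBase.sub {a b : EuclideanSpace ℝ (Fin n) → ℝ} {f g : FormalRing V}
    (hf : RepresentsBase a f) (hg : RepresentsBase b g) : RepresentsBase (fun z => a z - b z)
      (f - g) := fun s y hy ξ => by
  rw [map_sub, Pi.sub_apply, ← hf s y hy, ← hg s y hy]
  split_ifs <;> simp

theorem RepresentsBase.bd {a : EuclideanSpace ℝ (Fin n) → ℝ} {f : FormalRing V}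
    (hf : RepresentsBase a f) (j : Fin n) : RepresentsBase (pdBase j a) (bd j f) :=
  fun s y hy ξ => by
    rw [comp_bd, ← hf.represents.pdBase_eq s hy]
    by_cases hs : s = 0
    · simp only [hs, if_true]
    · simp only [hs, if_false, pdBase_const]

theorem RepresentsBase.fd {a : EuclideanSpace ℝ (Fin n) → ℝ} {f : FormalRing V}
    (hf : RepresentsBase a f) (k : Fin n) : fd k f = 0 :=
  ext_comp fun s => by rw [comp_fd, hf.isBase _ (by omega), dirDeriv_zero, map_zero]

theorem RepresentsBase.ext {a : EuclideanSpace ℝ (Fin n) → ℝ} {f g : FormalRing V}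
    (hf : RepresentsBase a f) {b : EuclideanSpace ℝ (Fin n) → ℝ}
    (hg : RepresentsBase b g) (h : ∀ y ∈ V, a y = b y) : f = g := by
  refine ext_comp fun s => ?_
  ext p
  rw [← hf s p.1 p.1.2 p.2, ← hg s p.1 p.1.2 p.2, h p.1 p.1.2]

theorem representsBase_zero : RepresentsBase (fun _ => 0) (0 : FormalRing V) :=
  fun s y hy ξ => by simp

end FormalRing

/-! ### The calculus of a chart, and Q̄ and ∇̄ in it. -/

section ChartCalculus

variable {n : ℕ} {M : Type*} [TopologicalSpace M] [ChartedSpace (EuclideanSpace ℝ (Fin n)) M]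
  {P : PoissonStructure n M}

/-- The domain of the coordinates of a chart. -/
def chartOpens (e : OpenPartialHomeomorph M (EuclideanSpace ℝ (Fin n))) :
    TopologicalSpace.Opens (EuclideanSpace ℝ (Fin n)) := ⟨e.target, e.open_target⟩

open FormalRing

variable {e : OpenPartialHomeomorph M (EuclideanSpace ℝ (Fin n))}

theorem OneForm.contDiffOn_coeff (he : e ∈ smoothCharts n M) (α : OneForm n M) (k : Fin n) :
    ContDiffOn ℝ ∞ (α.coeff e k) (chartOpens e) := α.smooth' e he k

theorem PoissonStructure.contDiffOn_coeff (he : e ∈ smoothCharts n M) (P : PoissonStructure n M)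
    (i j : Fin n) : ContDiffOn ℝ ∞ (P.coeff e i j) (chartOpens e) := P.smooth' e he i j

/-- The components of a 1-form in a chart, as formal functions. -/
def formCoeff (he : e ∈ smoothCharts n M) (α : OneForm n M) (k : Fin n) :
    FormalRing (chartOpens e) :=
  base (α.coeff e k) (OneForm.contDiffOn_coeff he α k)

theorem representsBase_formCoeff (he : e ∈ smoothCharts n M) (α : OneForm n M) (k : Fin n) :
    RepresentsBase (α.coeff e k) (formCoeff he α k) := representsBase_base _ _

variable [IsManifold (𝓡 n) ∞ M] [T2Space M] {D D' : ContravariantConnection P}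

theorem ContravariantConnection.contDiffOn_christoffel_chartOpens
    (D : ContravariantConnection P) (he : e ∈ smoothCharts n M) (i j k : Fin n) :
    ContDiffOn ℝ ∞ (D.christoffel e i j k) (chartOpens e) := D.contDiffOn_christoffel he i j k

/-- The calculus defined by a chart. -/
def chartCalculus (he : e ∈ smoothCharts n M) (hassoc : ContravariantConnection.Associated D D')
    (htors : D'.TorsionFree) : FibreCalculus (Fin n) (FormalRing (chartOpens e)) where
  bd := bd
  fd := fd
  xi := xi
  π i j := base (P.coeff e i j) (P.contDiffOn_coeff he i j)
  Γ i j k := base (D.christoffel e i j k) (D.contDiffOn_christoffel_chartOpens he i j k)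
  Γ' i j k := base (D'.christoffel e i j k) (D'.contDiffOn_christoffel_chartOpens he i j k)
  bd_comm := bd_comm
  fd_comm := fd_comm
  fd_bd := fd_bd
  fd_xi := fd_xi
  bd_xi := bd_xi
  fd_π _ _ _ := fd_base _ _ _
  fd_Γ _ _ _ _ := fd_base _ _ _
  antisymm i j := ext_comp fun s => by
    ext p
    rw [map_neg, Pi.neg_apply, comp_base, comp_base, P.coeff_antisymm i j]
    split_ifs <;> simp
  jacobi i j k := by
    have h : ∀ i j k, RepresentsBase (fun z => ∑ l, P.coeff e i l z * pdBase l (P.coeff e j k) z)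
        (∑ l, base (P.coeff e i l) (P.contDiffOn_coeff he i l) *
          bd l (base (P.coeff e j k) (P.contDiffOn_coeff he j k)) : FormalRing (chartOpens e)) :=
      fun i j k => .sum _ fun l _ => (representsBase_base _ _).mul ((representsBase_base _ _).bd l)
    exact (((h i j k).add (h j k i)).add (h k i j)).ext representsBase_zero fun y hy =>
      P.coeff_jacobi he hy i j k
  assoc i j k := RepresentsBase.ext
    (.sum _ fun l _ => (representsBase_base _ _).mul (representsBase_base _ _))
    (.sum _ fun l _ => (representsBase_base _ _).mul (representsBase_base _ _))
    fun y hy => hassoc.sum_christoffel he hy i j k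
  torsion i j k := RepresentsBase.ext
    ((representsBase_base _ _).sub (representsBase_base _ _)) ((representsBase_base _ _).bd k)
    fun y hy => htors.christoffel_sub he hy i j k

variable (he : e ∈ smoothCharts n M) (hassoc : ContravariantConnection.Associated D D')
  (htors : D'.TorsionFree)

theorem isGeometric_chartCalculus : IsGeometric (chartCalculus he hassoc htors) :=
  ⟨rfl, rfl, rfl, fun i j => isBase_base _ (P.contDiffOn_coeff he i j)⟩

theorem representsBase_π (i j : Fin n) :
    RepresentsBase (P.coeff e i j) ((chartCalculus he hassoc htors).π i j) :=
  representsBase_base _ (P.contDiffOn_coeff he i j)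

theorem representsBase_Γ (i j k : Fin n) :
    RepresentsBase (D.christoffel e i j k) ((chartCalculus he hassoc htors).Γ i j k) :=
  representsBase_base _ (D.contDiffOn_christoffel_chartOpens he i j k)

theorem comp_nab (i : Fin n) (s : ℕ) (F : FormalRing (chartOpens e))
    (p : chartOpens e × (Fin n → ℝ)) :
    comp s ((chartCalculus he hassoc htors).nab i F) p =
      ∑ j, P.coeff e i j p.1 * dirDeriv (EuclideanSpace.single j 1, 0) (comp s F) p
      + ∑ j, ∑ k, D.christoffel e i j k p.1 * p.2 j
        * dirDeriv (0, Pi.single k 1) (comp s F) p := by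
  rw [FibreCalculus.nab_apply, map_add, Pi.add_apply, comp_sum_apply, comp_sum_apply]
  congr 1
  · refine Finset.sum_congr rfl fun j _ => ?_
    rw [(representsBase_π he hassoc htors i j).comp_mul, ← comp_bd]
    rfl
  · rw [Finset.sum_comm]
    refine Finset.sum_congr rfl fun k _ => ?_
    rw [FibreCalculus.G, Finset.sum_mul, comp_sum_apply]
    refine Finset.sum_congr rfl fun j _ => ?_
    rw [mul_assoc, mul_assoc, ← comp_xi_mul_fd]
    exact (representsBase_Γ he hassoc htors i j k).comp_mul _ _ _

theorem FormalRing.Represents.nablaBar {G : LocalFormal n} {F : FormalRing (chartOpens e)}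
    (h : Represents G F) {a : Fin n → EuclideanSpace ℝ (Fin n) → ℝ}
    {α : Fin n → FormalRing (chartOpens e)} (hα : ∀ i, RepresentsBase (a i) (α i)) :
    Represents (nablaBar (P.coeff e) (D.christoffel e) a G)
      ((chartCalculus he hassoc htors).nabForm α F) := by
  intro s y hy ξ
  rw [FibreCalculus.nabForm_apply, comp_sum_apply, FormalPoisson.nablaBar]
  refine Finset.sum_congr rfl fun i _ => ?_
  rw [(hα i).comp_mul, comp_nab]
  simp only [h.pdBase_eq s hy, h.pdFibre_eq s hy]

theorem representsBase_nabForm {f : EuclideanSpace ℝ (Fin n) → ℝ} {F : FormalRing (chartOpens e)}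
    (h : RepresentsBase f F) {a : Fin n → EuclideanSpace ℝ (Fin n) → ℝ}
    {α : Fin n → FormalRing (chartOpens e)} (hα : ∀ i, RepresentsBase (a i) (α i)) :
    RepresentsBase (fun z => ∑ i, a i z * ∑ j, P.coeff e i j z * pdBase j f z)
      ((chartCalculus he hassoc htors).nabForm α F) := by
  rw [FibreCalculus.nabForm_apply]
  refine .sum _ fun i _ => (hα i).mul ?_
  rw [FibreCalculus.nab_base _ i fun k => h.fd k]
  exact .sum _ fun j _ => (representsBase_π he hassoc htors i j).mul (h.bd j)

theorem representsBase_bracket (α β : OneForm n M) (k : Fin n) :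
    RepresentsBase (fun z => bracketCoeff (P.coeff e) (α.coeff e) (β.coeff e) k z)
      ((chartCalculus he hassoc htors).bracket (formCoeff he α) (formCoeff he β) k) := by
  have h1 : RepresentsBase _ ((chartCalculus he hassoc htors).bracket (formCoeff he α)
      (formCoeff he β) k) :=
    ((RepresentsBase.sum _ fun i _ => .sum _ fun j _ =>
      ((representsBase_formCoeff he α i).mul (representsBase_formCoeff he β j)).mul
        ((representsBase_base (P.coeff e i j) (P.contDiffOn_coeff he i j)).bd k)).add
    (representsBase_nabForm he hassoc htors (representsBase_formCoeff he β k)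
      (representsBase_formCoeff he α))).sub
    (representsBase_nabForm he hassoc htors (representsBase_formCoeff he α k)
      (representsBase_formCoeff he β))
  intro s y hy ξ
  rw [← h1 s y hy ξ]
  split_ifs
  · exact P.bracketCoeff_eq he hy α β k
  · rfl

theorem represents_qBar (α β : OneForm n M) :
    Represents (qBar (P.coeff e) (D.christoffel e) (α.coeff e) (β.coeff e))
      ((1 / 2 : ℝ) • ∑ b, (chartCalculus he hassoc htors).eulerForm b *
        ((chartCalculus he hassoc htors).nabForm (formCoeff he α)
            ((chartCalculus he hassoc htors).nabForm (formCoeff he β)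
              ((chartCalculus he hassoc htors).xi b))
          - (chartCalculus he hassoc htors).nabForm (formCoeff he β)
            ((chartCalculus he hassoc htors).nabForm (formCoeff he α)
              ((chartCalculus he hassoc htors).xi b))
          - (chartCalculus he hassoc htors).nabForm
            ((chartCalculus he hassoc htors).bracket (formCoeff he α) (formCoeff he β))
              ((chartCalculus he hassoc htors).xi b))) := by
  have hα := representsBase_formCoeff he α
  have hβ := representsBase_formCoeff he β
  have hc : ∀ b, Represents (curvatureBar (P.coeff e) (D.christoffel e) (α.coeff e) (β.coeff e) b)
      ((chartCalculus he hassoc htors).nabForm (formCoeff he α)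
            ((chartCalculus he hassoc htors).nabForm (formCoeff he β)
              ((chartCalculus he hassoc htors).xi b))
          - (chartCalculus he hassoc htors).nabForm (formCoeff he β)
            ((chartCalculus he hassoc htors).nabForm (formCoeff he α)
              ((chartCalculus he hassoc htors).xi b))
          - (chartCalculus he hassoc htors).nabForm
            ((chartCalculus he hassoc htors).bracket (formCoeff he α) (formCoeff he β))
              ((chartCalculus he hassoc htors).xi b)) := by
    intro b s y hy ξ
    have hx := represents_xiCoord (V := chartOpens e) b
    rw [curvatureBar, map_sub, map_sub, Pi.sub_apply, Pi.sub_apply]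
    congr 1
    · congr 1
      · exact (hx.nablaBar he hassoc htors hβ).nablaBar he hassoc htors hα s y hy ξ
      · exact (hx.nablaBar he hassoc htors hα).nablaBar he hassoc htors hβ s y hy ξ
    · exact hx.nablaBar he hassoc htors (representsBase_bracket he hassoc htors α β) s y hy ξ
  intro s y hy ξ
  rw [qBar, map_smul, Pi.smul_apply, smul_eq_mul, comp_sum_apply, omegaPairing]
  congr 1
  simp only [FormalRing.comp_mul, Finset.sum_apply]
  refine Eq.trans ?_ Finset.sum_comm
  refine Finset.sum_congr rfl fun q _ => ?_
  refine Finset.sum_comm.trans ?_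
  refine Finset.sum_congr rfl fun b _ => ?_
  rw [Pi.mul_apply, ← hc b q.2 y hy ξ, FibreCalculus.eulerForm, comp_sum_apply, Finset.sum_mul]
  refine Finset.sum_congr rfl fun a _ => ?_
  rw [mul_comm ((chartCalculus he hassoc htors).xi a)]
  congr 1
  rw [(representsBase_π he hassoc htors a b).comp_mul,
    represents_xiCoord (V := chartOpens e) a q.1 y hy ξ]
  rfl

end ChartCalculus

/-! ### Vertical 1-forms without regularity conditions, and the fibrewise bracket. -/

section FormFields

variable {n : ℕ} {M : Type*} [TopologicalSpace M] [ChartedSpace (EuclideanSpace ℝ (Fin n)) M]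

/-- The carrier of vertical formal 1-forms on `(T*M, Z)`. -/
abbrev FormField (n : ℕ) (M : Type*) [TopologicalSpace M]
    [ChartedSpace (EuclideanSpace ℝ (Fin n)) M] : Type _ :=
  ℕ → ∀ x : M, Cot n x → (Cot n x →ₗ[ℝ] ℝ)

namespace FormField

/-- The function `U(α)`. -/
def eval (U : FormField n M) (α : OneForm n M) : FormalFn n M := fun s x ξ => U s x ξ (α x)

/-- The expression of `U(dx^k)` in a chart. -/
def coeff (U : FormField n M) (e : OpenPartialHomeomorph M (EuclideanSpace ℝ (Fin n)))
    (k : Fin n) : LocalFormal n :=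
  FormalFn.inChart (fun s x ξ => U s x ξ (coordCovector e k x)) e

theorem eval_inChart {e : OpenPartialHomeomorph M (EuclideanSpace ℝ (Fin n))}
    (he : e ∈ smoothCharts n M) (U : FormField n M) (α : OneForm n M) (s : ℕ)
    {y : EuclideanSpace ℝ (Fin n)} (hy : y ∈ e.target) (ξ : Fin n → ℝ) :
    (U.eval α).inChart e s y ξ = ∑ k, α.coeff e k y * U.coeff e k s y ξ := by
  rw [FormalFn.inChart, eval, ← OneForm.covectorOf_coeff he hy α]
  conv_lhs => rw [covectorOf.eq_def e (e.symm y) fun k => α.coeff e k y, map_sum]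
  simp only [map_smul, smul_eq_mul]
  rfl

end FormField

theorem VerticalOneForm.eval_eq (U : VerticalOneForm n M) (α : OneForm n M) :
    U.eval α = FormField.eval U.toFun α := by
  ext s x ξ
  rw [VerticalOneForm.eval, VerticalOneForm.pairing, Finset.sum_eq_single (s, 0)]
  · rfl
  · rintro ⟨a, b⟩ hp hne
    have hab := Finset.HasAntidiagonal.mem_antidiagonal.1 hp
    have hb : b ≠ 0 := by
      rintro rfl
      exact hne (by simpa using hab)
    simp [OneForm.hat, hb]
  · intro h
    exact absurd (Finset.HasAntidiagonal.mem_antidiagonal.2 (by simp)) h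

/-- 𝓔 has degree 1 in ξ, hence the shift of degree. -/
theorem VerticalOneForm.pairing_euler_succ (U : VerticalOneForm n M) (s : ℕ) (x : M)
    (ξ : Cot n x) : U.pairing (eulerField n M) (s + 1) x ξ = U.toFun s x ξ ξ := by
  rw [VerticalOneForm.pairing, Finset.sum_eq_single (s, 1)]
  · simp [eulerField]
  · rintro ⟨a, b⟩ hp hne
    have hab := Finset.HasAntidiagonal.mem_antidiagonal.1 hp
    have hb : b ≠ 1 := by
      rintro rfl
      exact hne (by simpa using hab)
    simp [eulerField, hb]
  · intro h
    exact absurd (Finset.HasAntidiagonal.mem_antidiagonal.2 (by simp)) h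

theorem VerticalOneForm.pairing_euler_zero (U : VerticalOneForm n M) (x : M)
    (ξ : Cot n x) : U.pairing (eulerField n M) 0 x ξ = 0 := by
  simp [VerticalOneForm.pairing, eulerField]

theorem isNormalized_iff (U : VerticalOneForm n M) :
    IsNormalized U ↔ ∀ (s : ℕ) (x : M) (ξ : Cot n x), U.toFun s x ξ ξ = 0 := by
  refine ⟨fun h s x ξ => ?_, fun h s x ξ => ?_⟩
  · rw [← U.pairing_euler_succ, h]
  · rcases s with _ | s
    · exact U.pairing_euler_zero x ξ
    · rw [U.pairing_euler_succ, h]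

variable (P : PoissonStructure n M)

/-- By antisymmetry {F, G} = Ω(H_F, H_G) for any Hamiltonian fields, so the field chosen in the
definition may be replaced by an explicit one. -/
theorem PoissonStructure.bracketOmega_eq {F G : FormalFn n M} {x : M}
    {X Y : ℕ → Cot n x → Cot n x} (hX : P.IsHamiltonianAt F x X) (hY : P.IsHamiltonianAt G x Y)
    (s : ℕ) (ξ : Cot n x) : P.bracketOmega F G s x ξ =
      ∑ p ∈ Finset.HasAntidiagonal.antidiagonal s, P x (X p.1 ξ) (Y p.2 ξ) := by
  have hF : ∃ X : ℕ → Cot n x → Cot n x, P.IsHamiltonianAt F x X := ⟨X, hX⟩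
  rw [PoissonStructure.bracketOmega, dif_pos hF]
  refine Finset.sum_congr rfl fun p _ => ?_
  have h1 := hY p.2 ξ (hF.choose p.1 ξ)
  have h2 := hF.choose_spec p.1 ξ (Y p.2 ξ)
  rw [← hX, P.antisymm] at h2
  linarith

variable {P} [IsManifold (𝓡 n) ∞ M] [T2Space M]

/-- The difference of the two sides of the Fundamental Equation. -/
def feDefect (D : ContravariantConnection P) (U : FormField n M) (α β : OneForm n M)
    (e : OpenPartialHomeomorph M (EuclideanSpace ℝ (Fin n))) : LocalFormal n :=
  fun s y ξ =>
    qBar (P.coeff e) (D.christoffel e) (α.coeff e) (β.coeff e) s y ξ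
      - nablaBar (P.coeff e) (D.christoffel e) (α.coeff e) ((U.eval β).inChart e) s y ξ
      + nablaBar (P.coeff e) (D.christoffel e) (β.coeff e) ((U.eval α).inChart e) s y ξ
      + (∑ k, bracketCoeff (P.coeff e) (α.coeff e) (β.coeff e) k y * U.coeff e k s y ξ)
      + (P.bracketOmega (U.eval α) (U.eval β)).inChart e s y ξ
      - if s = 0 then P (e.symm y) (α (e.symm y)) (β (e.symm y)) else 0

theorem fundamentalEquation_iff (D : ContravariantConnection P) (U : VerticalOneForm n M) :
    FundamentalEquation D U ↔ ∀ α β : OneForm n M, ∀ e ∈ smoothCharts n M, ∀ y ∈ e.target,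
      ∀ (s : ℕ) (ξ : Fin n → ℝ), feDefect D U.toFun α β e s y ξ = 0 := by
  simp only [FundamentalEquation, feDefect, sub_eq_zero, ← U.eval_eq]
  refine forall_congr' fun α => forall_congr' fun β => forall_congr' fun e =>
    forall_congr' fun _ => forall_congr' fun y => forall_congr' fun _ => forall_congr' fun s =>
    forall_congr' fun ξ => eq_comm

end FormFields

namespace FormalRing

variable {n : ℕ} {V : TopologicalSpace.Opens (EuclideanSpace ℝ (Fin n))}

theorem RepresentsBase.congr {a b : EuclideanSpace ℝ (Fin n) → ℝ} {f : FormalRing V}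
    (h : RepresentsBase a f) (hab : ∀ y ∈ V, b y = a y) : RepresentsBase b f :=
  fun s y hy ξ => by rw [hab y hy, h s y hy ξ]

theorem RepresentsBase.mul_represents {a : EuclideanSpace ℝ (Fin n) → ℝ} {f : FormalRing V}
    (h : RepresentsBase a f) {G : LocalFormal n} {F : FormalRing V} (hG : Represents G F) :
    Represents (fun s y ξ => a y * G s y ξ) (f * F) :=
  fun s y hy ξ => by rw [h.comp_mul, ← hG s y hy]

theorem Represents.congr {G G' : LocalFormal n} {F : FormalRing V} (h : Represents G F)
    (hG : ∀ s, ∀ y ∈ V, ∀ ξ, G' s y ξ = G s y ξ) : Represents G' F :=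
  fun s y hy ξ => by rw [hG s y hy, h s y hy]

theorem Represents.sum {κ : Type*} (t : Finset κ) {G : κ → LocalFormal n} {F : κ → FormalRing V}
    (h : ∀ i ∈ t, Represents (G i) (F i)) :
    Represents (fun s y ξ => ∑ i ∈ t, G i s y ξ) (∑ i ∈ t, F i) := fun s y hy ξ => by
  rw [comp_sum_apply]
  exact Finset.sum_congr rfl fun i hi => h i hi s y hy ξ

theorem Represents.add {G G' : LocalFormal n} {F F' : FormalRing V} (h : Represents G F)
    (h' : Represents G' F') : Represents (fun s y ξ => G s y ξ + G' s y ξ) (F + F') :=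
  fun s y hy ξ => by rw [map_add, Pi.add_apply, ← h s y hy, ← h' s y hy]

theorem Represents.sub {G G' : LocalFormal n} {F F' : FormalRing V} (h : Represents G F)
    (h' : Represents G' F') : Represents (fun s y ξ => G s y ξ - G' s y ξ) (F - F') :=
  fun s y hy ξ => by rw [map_sub, Pi.sub_apply, ← h s y hy, ← h' s y hy]

end FormalRing

/-! ### The Fundamental Equation of a form with local potentials, in the ring of a chart. -/

section LocalForms

open FormalRing

variable {n : ℕ} {M : Type*} [TopologicalSpace M] [ChartedSpace (EuclideanSpace ℝ (Fin n)) M]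
  {P : PoissonStructure n M} {e : OpenPartialHomeomorph M (EuclideanSpace ℝ (Fin n))}

theorem FormField.represents_eval (he : e ∈ smoothCharts n M) {U : FormField n M}
    {W : Fin n → FormalRing (chartOpens e)} (hU : ∀ k, Represents (U.coeff e k) (W k))
    (α : OneForm n M) :
    Represents ((U.eval α).inChart e) (∑ k, formCoeff he α k * W k) :=
  (Represents.sum _ fun k _ => (representsBase_formCoeff he α k).mul_represents (hU k)).congr
    fun s _ hy ξ => U.eval_inChart he α s hy ξ

theorem fibreDeriv_covectorOf {F : FormalFn n M} {F' : FormalRing (chartOpens e)}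
    (h : Represents (F.inChart e) F') (s : ℕ) {y : EuclideanSpace ℝ (Fin n)} (hy : y ∈ e.target)
    (ξ η : Fin n → ℝ) :
    F.fibreDeriv s (e.symm y) (covectorOf e (e.symm y) ξ) (covectorOf e (e.symm y) η) =
      ∑ l, η l * dirDeriv (0, Pi.single l 1) (comp s F') (⟨y, hy⟩, ξ) := by
  have h1 := ((h.hasFDerivAt_fibre s hy ξ).hasLineDerivAt η).deriv
  have h2 : (fun t : ℝ => F s (e.symm y) (covectorOf e (e.symm y) ξ
      + t • covectorOf e (e.symm y) η)) = fun t : ℝ => F.inChart e s y (ξ + t • η) := by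
    ext t
    rw [FormalFn.inChart, covectorOf_add, covectorOf_smul]
  rw [FormalFn.fibreDeriv, h2, h1]
  have h3 : η = ∑ l, η l • Pi.single l (1 : ℝ) := by
    ext i
    simp [Pi.single_apply]
  conv_lhs => rw [h3, map_sum]
  simp only [map_smul]
  rfl

variable [IsManifold (𝓡 n) ∞ M] [T2Space M] {D D' : ContravariantConnection P}
  (he : e ∈ smoothCharts n M) (hassoc : ContravariantConnection.Associated D D')
  (htors : D'.TorsionFree)

theorem representsBase_apply (α β : OneForm n M) :
    RepresentsBase (fun y => P (e.symm y) (α (e.symm y)) (β (e.symm y)))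
      (∑ i, ∑ j, formCoeff he α i * formCoeff he β j * (chartCalculus he hassoc htors).π i j) := by
  refine RepresentsBase.congr (.sum _ fun i _ => .sum _ fun j _ =>
    ((representsBase_formCoeff he α i).mul (representsBase_formCoeff he β j)).mul
      (representsBase_π he hassoc htors i j)) fun y hy => ?_
  rw [← OneForm.covectorOf_coeff he hy α, ← OneForm.covectorOf_coeff he hy β, P.apply_covectorOf]
  exact Finset.sum_congr rfl fun i _ => Finset.sum_congr rfl fun j _ => by ring

/-- The Hamiltonian vector field of `U(α)` defined by local potentials. -/
def potentialField (α : OneForm n M) (v : Fin n → Fin n → FormalRing (chartOpens e))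
    {y : EuclideanSpace ℝ (Fin n)} (hy : y ∈ e.target) (s : ℕ) (ζ : Cot n (e.symm y)) :
    Cot n (e.symm y) :=
  covectorOf e (e.symm y) fun k =>
    comp s (∑ i, formCoeff he α i * v i k) (⟨y, hy⟩, fun l => ζ (coordVector e l y))

variable {he hassoc htors}
  {u : Fin n → FormalRing (chartOpens e)} {v : Fin n → Fin n → FormalRing (chartOpens e)}

theorem fd_sum_potential (huv : (chartCalculus he hassoc htors).Compatible u v) (α : OneForm n M)
    (l : Fin n) :
    fd l (∑ i, formCoeff he α i * (chartCalculus he hassoc htors).potential u i) =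
      - ∑ k, (chartCalculus he hassoc htors).π k l * ∑ i, formCoeff he α i * v i k := by
  have h : ∀ i, fd l ((chartCalculus he hassoc htors).potential u i) =
      ∑ k, (chartCalculus he hassoc htors).π l k * v i k := fun i => huv l i
  simp only [map_sum, Derivation.leibniz, smul_eq_mul, (representsBase_formCoeff he α _).fd, h,
    mul_zero, add_zero, Finset.mul_sum]
  rw [Finset.sum_comm, ← Finset.sum_neg_distrib]
  refine Finset.sum_congr rfl fun k _ => ?_
  rw [← Finset.sum_neg_distrib]
  refine Finset.sum_congr rfl fun i _ => ?_
  rw [(chartCalculus he hassoc htors).antisymm l k]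
  ring

theorem isHamiltonianAt_potentialField (huv : (chartCalculus he hassoc htors).Compatible u v)
    {U : FormField n M}
    (hU : ∀ k, Represents (U.coeff e k) ((chartCalculus he hassoc htors).potential u k))
    (α : OneForm n M) {y : EuclideanSpace ℝ (Fin n)} (hy : y ∈ e.target) :
    P.IsHamiltonianAt (U.eval α) (e.symm y) (potentialField he α v hy) := by
  intro s ζ η
  have h1 := fibreDeriv_covectorOf (FormField.represents_eval he hU α) (s + 1) hy
    (fun k => ζ (coordVector e k y)) (fun k => η (coordVector e k y))
  rw [covectorOf_coeff he hy, covectorOf_coeff he hy] at h1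
  rw [h1]
  conv_lhs => rw [← covectorOf_coeff he hy η, potentialField, P.apply_covectorOf]
  rw [Finset.sum_comm, ← Finset.sum_neg_distrib]
  refine Finset.sum_congr rfl fun l _ => ?_
  rw [← comp_fd, fd_sum_potential huv, map_neg, Pi.neg_apply, comp_sum_apply, mul_neg, neg_neg,
    Finset.mul_sum]
  refine Finset.sum_congr rfl fun k _ => ?_
  rw [(representsBase_π he hassoc htors k l).comp_mul]
  ring

/-- On each fibre α_i v^i_k ∂/∂ξ_k is an explicit Hamiltonian field of U(α), to be used in
`PoissonStructure.bracketOmega_eq`. -/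
theorem represents_bracketOmega (huv : (chartCalculus he hassoc htors).Compatible u v)
    {U : FormField n M}
    (hU : ∀ k, Represents (U.coeff e k) ((chartCalculus he hassoc htors).potential u k))
    (α β : OneForm n M) :
    Represents ((P.bracketOmega (U.eval α) (U.eval β)).inChart e)
      (∑ i, ∑ j, formCoeff he α i * formCoeff he β j *
        (chartCalculus he hassoc htors).ham (v i)
          ((chartCalculus he hassoc htors).potential u j)) := by
  have hr : ∑ i, ∑ j, formCoeff he α i * formCoeff he β j *
        (chartCalculus he hassoc htors).ham (v i)
          ((chartCalculus he hassoc htors).potential u j) =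
      ∑ k, ∑ l, (chartCalculus he hassoc htors).π k l * ((∑ i, formCoeff he α i * v i k)
        * ∑ j, formCoeff he β j * v j l) := by
    have h1 : ∀ i j, formCoeff he α i * formCoeff he β j *
        (chartCalculus he hassoc htors).ham (v i)
          ((chartCalculus he hassoc htors).potential u j) =
        ∑ k, ∑ l, (chartCalculus he hassoc htors).π k l * ((formCoeff he α i * v i k)
        * (formCoeff he β j * v j l)) := fun i j => by
      rw [huv.ham_potential, Finset.mul_sum]
      refine Finset.sum_congr rfl fun k _ => ?_
      rw [Finset.mul_sum, Finset.mul_sum]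
      exact Finset.sum_congr rfl fun l _ => by ring
    simp only [h1, Finset.sum_mul_sum]
    simp only [Finset.mul_sum]
    rw [Finset.sum_congr rfl fun i _ => Finset.sum_comm, Finset.sum_comm]
    refine Finset.sum_congr rfl fun k _ => ?_
    rw [Finset.sum_congr rfl fun i _ => Finset.sum_comm, Finset.sum_comm]
  intro s y hy ξ
  rw [FormalFn.inChart, P.bracketOmega_eq (isHamiltonianAt_potentialField huv hU α hy)
    (isHamiltonianAt_potentialField huv hU β hy), hr, comp_sum_apply]
  simp only [potentialField, P.apply_covectorOf, covectorOf_apply_coordVector he hy]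
  rw [Finset.sum_comm]
  refine Finset.sum_congr rfl fun k _ => ?_
  rw [comp_sum_apply, Finset.sum_comm]
  refine Finset.sum_congr rfl fun l _ => ?_
  rw [(representsBase_π he hassoc htors k l).comp_mul, FormalRing.comp_mul, Finset.sum_apply,
    Finset.mul_sum]
  exact Finset.sum_congr rfl fun p _ => by rw [Pi.mul_apply, mul_assoc]

/-- By tensoriality (`form_defect`) the equation for all 1-forms reduces to the vanishing of the
defect on coordinate forms. -/
theorem represents_feDefect (huv : (chartCalculus he hassoc htors).Compatible u v)
    {U : FormField n M}
    (hU : ∀ k, Represents (U.coeff e k) ((chartCalculus he hassoc htors).potential u k))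
    (α β : OneForm n M) :
    Represents (feDefect D U α β e) (∑ i, ∑ j, formCoeff he α i * formCoeff he β j *
      (chartCalculus he hassoc htors).defect u v i j) := by
  have hα := representsBase_formCoeff he α
  have hβ := representsBase_formCoeff he β
  rw [← FibreCalculus.form_defect]
  exact ((((((represents_qBar he hassoc htors α β).sub
    ((FormField.represents_eval he hU β).nablaBar he hassoc htors hα)).add
    ((FormField.represents_eval he hU α).nablaBar he hassoc htors hβ)).add
    (.sum _ fun k _ => (representsBase_bracket he hassoc htors α β k).mul_represents (hU k))).add
    (represents_bracketOmega huv hU α β)).sub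
    (representsBase_apply he hassoc htors α β).represents)

end LocalForms

namespace FormalRing

variable {n : ℕ} {V : TopologicalSpace.Opens (EuclideanSpace ℝ (Fin n))}

theorem isBase_of_fd_eq_zero {F : FormalRing V} (h : ∀ k, fd k F = 0) : IsBase F := by
  intro s hs
  obtain ⟨N, rfl⟩ := Nat.exists_eq_succ_of_ne_zero hs
  have h1 := sum_xi_mul_fd_hom (N + 1) F
  simp only [fd_hom, h, map_zero, mul_zero, Finset.sum_const_zero] at h1
  have h2 : ((N + 1 : ℕ) : ℝ) ≠ 0 := by positivity
  have h3 : hom (N + 1) F = 0 := (smul_eq_zero.1 h1.symm).resolve_left h2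
  have h4 := congrArg (comp (N + 1)) h3
  rwa [comp_hom, if_pos rfl, map_zero] at h4

theorem comp_zero_xi_mul (k : Fin n) (F : FormalRing V) : comp 0 (xi k * F) = 0 := by
  rw [FormalRing.comp_mul]
  ext p
  simp [comp_xi]

theorem comp_xi_mul_xi_mul {f : FormalRing V} (hf : IsBase f) (s : ℕ) (a c : Fin n)
    (p : V × (Fin n → ℝ)) :
    comp s (xi a * (xi c * f)) p = if s = 2 then p.2 a * (p.2 c * comp 0 f p) else 0 := by
  rcases s with _ | _ | s
  · rw [comp_zero_xi_mul]
    simp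
  · rw [comp_xi_mul, comp_zero_xi_mul]
    simp
  · rw [comp_xi_mul, comp_xi_mul]
    rcases s with _ | s
    · simp
    · rw [hf (s + 1) (by omega)]
      simp

end FormalRing

/-- The linear algebra of the chain rule for x ↦ F(x, Ξ(x)): a and ξ are the components of α and Ξ,
b and f the base and fibre derivatives of F, d the derivatives of Ξ. The subtracted sum pairs f with
∇^α Ξ. -/
theorem horizontal_sum {ι : Type*} [Fintype ι] (a ξ b f : ι → ℝ) (π : ι → ι → ℝ) (d : ι → ι → ℝ)
    (Γ : ι → ι → ι → ℝ) :
    ∑ i, a i * (∑ j, π i j * b j + ∑ j, ∑ k, Γ i j k * ξ j * f k) =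
      ∑ i, ∑ j, π i j * a i * (b j + ∑ k, d j k * f k)
        - ∑ k, (∑ i, a i * (∑ j, π i j * d j k - ∑ j, Γ i j k * ξ j)) * f k := by
  have h : ∑ k, (∑ i, a i * (∑ j, π i j * d j k - ∑ j, Γ i j k * ξ j)) * f k =
      ∑ i, ∑ j, π i j * a i * ∑ k, d j k * f k - ∑ i, a i * ∑ j, ∑ k, Γ i j k * ξ j * f k := by
    simp only [Finset.sum_mul, mul_sub, Finset.mul_sum, sub_mul, Finset.sum_sub_distrib]
    congr 1
    · rw [Finset.sum_comm]
      refine Finset.sum_congr rfl fun i _ => ?_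
      rw [Finset.sum_comm]
      exact Finset.sum_congr rfl fun j _ => Finset.sum_congr rfl fun k _ => by ring
    · rw [Finset.sum_comm]
      refine Finset.sum_congr rfl fun i _ => ?_
      rw [Finset.sum_comm]
      exact Finset.sum_congr rfl fun j _ => Finset.sum_congr rfl fun k _ => by ring
  rw [h]
  simp only [mul_add, Finset.sum_add_distrib]
  have h2 : ∑ i, a i * ∑ j, π i j * b j = ∑ i, ∑ j, π i j * a i * b j := by
    simp only [Finset.mul_sum]
    exact Finset.sum_congr rfl fun i _ => Finset.sum_congr rfl fun j _ => by ring
  rw [h2]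
  ring

/-! ### A chart-free form of the defect, along sections of T*M. -/

section Invariant

variable {n : ℕ} {M : Type*} [TopologicalSpace M] [ChartedSpace (EuclideanSpace ℝ (Fin n)) M]
  {P : PoissonStructure n M}

/-- The expression `∇^α ∇^β Ξ - ∇^β ∇^α Ξ - ∇^{[α, β]} Ξ`, where `[α, β]` is given by a torsion-free
connection. -/
def curvatureOn (D D' : ContravariantConnection P) (α β Ξ : OneForm n M) (x : M) : Cot n x :=
  D α (D β Ξ) x - D β (D α Ξ) x - (D (D' α β) Ξ x - D (D' β α) Ξ x)

/-- The values on the section `Ξ` of the horizontal derivative of a formal function along `α`. -/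
def horizontalOn (D : ContravariantConnection P) (α Ξ : OneForm n M) (F : FormalFn n M) (s : ℕ)
    (x : M) : ℝ :=
  P x (α x) (differential n (fun p => F s p (Ξ p)) x) - F.fibreDeriv s x (Ξ x) (D α Ξ x)

/-- The values on the section `Ξ` of the defect of the Fundamental Equation. -/
def defectOn (D D' : ContravariantConnection P) (U : FormField n M) (α β Ξ : OneForm n M) (s : ℕ)
    (x : M) : ℝ :=
  (if s = 2 then - (1 / 2 : ℝ) * P x (Ξ x) (curvatureOn D D' α β Ξ x) else 0)
    - horizontalOn D α Ξ (U.eval β) s x + horizontalOn D β Ξ (U.eval α) s x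
    + (U.eval (D' α β) s x (Ξ x) - U.eval (D' β α) s x (Ξ x))
    + P.bracketOmega (U.eval α) (U.eval β) s x (Ξ x)
    - if s = 0 then P x (α x) (β x) else 0

open FormalRing

variable {e : OpenPartialHomeomorph M (EuclideanSpace ℝ (Fin n))}
  [IsManifold (𝓡 n) ∞ M] [T2Space M] {D D' : ContravariantConnection P}
  (he : e ∈ smoothCharts n M) (hassoc : ContravariantConnection.Associated D D')
  (htors : D'.TorsionFree)

include he

/-- The derivative of F ∘ Ξ along #α contains the fibre derivative of F along the derivative of Ξ.
Subtracting the fibre derivative along ∇^α Ξ leaves ∇̄^α F, so ∇̄ does not depend on the chart. -/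
theorem horizontalOn_eq {F : FormalFn n M} {F' : FormalRing (chartOpens e)}
    (h : Represents (F.inChart e) F') (α Ξ : OneForm n M) (s : ℕ) {y : EuclideanSpace ℝ (Fin n)}
    (hy : y ∈ e.target) :
    nablaBar (P.coeff e) (D.christoffel e) (α.coeff e) (F.inChart e) s y
      (fun k => Ξ.coeff e k y) = horizontalOn D α Ξ F s (e.symm y) := by
  set g : EuclideanSpace ℝ (Fin n) → ℝ :=
    extend (comp s F') ∘ fun z => (z, fun k => Ξ.coeff e k z) with hg
  have hfg : ∀ z ∈ e.target, F s (e.symm z) (Ξ (e.symm z)) = g z := fun z hz => by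
    rw [← OneForm.covectorOf_coeff he hz Ξ, hg, Function.comp, extend_apply (V := chartOpens e) _ hz]
    exact h s z hz _
  have hΞ : HasFDerivAt (fun z k => Ξ.coeff e k z)
      (ContinuousLinearMap.pi fun k => fderiv ℝ (Ξ.coeff e k) y) y :=
    hasFDerivAt_pi.2 fun k => (Ξ.coeff_differentiableAt he hy k).hasFDerivAt
  have hd := differentiableAt_extend (comp_mem s F') (⟨y, hy⟩, fun k => Ξ.coeff e k y)
  have hgd : HasFDerivAt g _ y := hd.hasFDerivAt.comp y ((hasFDerivAt_id y).prodMk hΞ)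
  have hpd : ∀ l, pdBase l g y =
      dirDeriv (EuclideanSpace.single l 1, 0) (comp s F') (⟨y, hy⟩, fun k => Ξ.coeff e k y)
      + ∑ k, pdBase l (Ξ.coeff e k) y *
        dirDeriv (0, Pi.single k 1) (comp s F') (⟨y, hy⟩, fun k => Ξ.coeff e k y) := fun l => by
    rw [pdBase, hgd.fderiv]
    have h1 : ((EuclideanSpace.single l (1 : ℝ) : EuclideanSpace ℝ (Fin n)),
        fun k => pdBase l (Ξ.coeff e k) y) = (EuclideanSpace.single l (1 : ℝ), 0)
          + ∑ k, pdBase l (Ξ.coeff e k) y • ((0 : EuclideanSpace ℝ (Fin n)), Pi.single k (1 : ℝ)) := by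
      ext i
      · simp [Prod.fst_sum]
      · simp [Prod.snd_sum, Pi.single_apply]
    have h2 := congrArg (fderiv ℝ (extend (comp s F')) (y, fun k => Ξ.coeff e k y)) h1
    rw [map_add, map_sum] at h2
    simp only [map_smul] at h2
    exact h2
  have hmd : MDifferentiableAt (𝓡 n) 𝓘(ℝ, ℝ) (fun p => F s p (Ξ p)) (e.symm y) := by
    have h1 : MDifferentiableAt (𝓡 n) 𝓘(ℝ, ℝ) g (e (e.symm y)) := by
      rw [e.right_inv hy]
      exact hgd.differentiableAt.mdifferentiableAt
    have h2 := h1.comp _ (hasMFDerivAt_chart he hy).mdifferentiableAt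
    refine h2.congr_of_eventuallyEq ?_
    filter_upwards [e.open_source.mem_nhds (e.map_target hy)] with p hp
    have h3 := hfg (e p) (e.map_source hp)
    rwa [e.left_inv hp] at h3
  have hpf : ∀ l, pdBase l (fun z => F s (e.symm z) (Ξ (e.symm z))) y = pdBase l g y := fun l => by
    refine pdBase_congr l ?_
    filter_upwards [e.open_target.mem_nhds hy] with z hz
    exact hfg z hz
  have hfib := fibreDeriv_covectorOf h s hy (fun k => Ξ.coeff e k y) (fun k => (D α Ξ).coeff e k y)
  rw [OneForm.covectorOf_coeff he hy, OneForm.covectorOf_coeff he hy] at hfib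
  rw [horizontalOn, hfib, differential_eq he hy hmd]
  conv_rhs => rw [← OneForm.covectorOf_coeff he hy α]
  rw [P.apply_covectorOf]
  simp only [hpf, hpd, D.coeff_eq he hy, nablaBar, h.pdBase_eq s hy, h.pdFibre_eq s hy]
  exact horizontal_sum _ _ _ _ _ _ _

include hassoc htors

theorem formCoeff_connection (α β : OneForm n M) (k : Fin n) :
    formCoeff he (D α β) k =
      (chartCalculus he hassoc htors).cov (formCoeff he α) (formCoeff he β) k := by
  have h : RepresentsBase _ ((chartCalculus he hassoc htors).cov (formCoeff he α)
      (formCoeff he β) k) := RepresentsBase.sum _ fun i _ =>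
    (representsBase_formCoeff he α i).mul (RepresentsBase.sub (a := fun z =>
      ∑ j, P.coeff e i j z * pdBase j (β.coeff e k) z) (by
      rw [FibreCalculus.nab_base _ i fun l => (representsBase_formCoeff he β k).fd l]
      exact .sum _ fun j _ => (representsBase_π he hassoc htors i j).mul
        ((representsBase_formCoeff he β k).bd j))
      (.sum _ fun j _ => (representsBase_Γ he hassoc htors i j k).mul
        (representsBase_formCoeff he β j)))
  exact (representsBase_formCoeff he (D α β) k).ext h fun y hy => D.coeff_eq he hy α β k

/-- The bracket is defined in coordinates only; absence of torsion expresses it through the globally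
defined second connection. -/
theorem bracket_formCoeff (α β : OneForm n M) (k : Fin n) :
    (chartCalculus he hassoc htors).bracket (formCoeff he α) (formCoeff he β) k =
      formCoeff he (D' α β) k - formCoeff he (D' β α) k :=
  (representsBase_bracket he hassoc htors α β k).ext
    ((representsBase_formCoeff he (D' α β) k).sub (representsBase_formCoeff he (D' β α) k))
    fun y hy => (sub_eq_zero.1 (htors α β e he y hy k)).symm

theorem sum_curvTensor_formCoeff (α β Ξ : OneForm n M) (k : Fin n) :
    ∑ c, (∑ i, ∑ j, formCoeff he α i * formCoeff he β j *
      (chartCalculus he hassoc htors).curvTensor i j c k) * formCoeff he Ξ c =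
      - (formCoeff he (D α (D β Ξ)) k - formCoeff he (D β (D α Ξ)) k
        - (formCoeff he (D (D' α β) Ξ) k - formCoeff he (D (D' β α) Ξ) k)) := by
  have h1 := (chartCalculus he hassoc htors).cov_commutator (formCoeff he α) (formCoeff he β)
    (formCoeff he Ξ) (fun s k => (representsBase_formCoeff he Ξ k).fd s) k
  have h2 : (chartCalculus he hassoc htors).cov
      ((chartCalculus he hassoc htors).bracket (formCoeff he α) (formCoeff he β))
      (formCoeff he Ξ) k =
      formCoeff he (D (D' α β) Ξ) k - formCoeff he (D (D' β α) Ξ) k := by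
    rw [formCoeff_connection he hassoc htors, formCoeff_connection he hassoc htors,
      FibreCalculus.cov, FibreCalculus.cov, FibreCalculus.cov, ← Finset.sum_sub_distrib]
    exact Finset.sum_congr rfl fun i _ => by rw [bracket_formCoeff, sub_mul]
  have h3 : ∀ α β, (chartCalculus he hassoc htors).cov (formCoeff he α)
      ((chartCalculus he hassoc htors).cov (formCoeff he β) (formCoeff he Ξ)) k =
      formCoeff he (D α (D β Ξ)) k := fun α β => by
    rw [formCoeff_connection he hassoc htors]
    congr 1
    exact funext fun l => (formCoeff_connection he hassoc htors β Ξ l).symm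
  rw [h2, h3, h3] at h1
  rw [h1, neg_neg]
  simp only [Finset.mul_sum, Finset.sum_mul]
  rw [Finset.sum_comm]
  refine Finset.sum_congr rfl fun i _ => ?_
  rw [Finset.sum_comm]
  exact Finset.sum_congr rfl fun j _ => Finset.sum_congr rfl fun c _ => by ring

/-- Q̄ is quadratic in ξ. Along Ξ one factor is Ξ itself, and the curvature field becomes minus the
curvature of ∇ applied to Ξ. -/
theorem qBar_section (α β Ξ : OneForm n M) (s : ℕ) {y : EuclideanSpace ℝ (Fin n)}
    (hy : y ∈ e.target) :
    qBar (P.coeff e) (D.christoffel e) (α.coeff e) (β.coeff e) s y (fun k => Ξ.coeff e k y) =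
      if s = 2 then - (1 / 2 : ℝ) * P (e.symm y) (Ξ (e.symm y))
        (curvatureOn D D' α β Ξ (e.symm y)) else 0 := by
  set S := chartCalculus he hassoc htors with hS
  set K : Fin n → Fin n → FormalRing (chartOpens e) := fun c k => ∑ i, ∑ j,
    formCoeff he α i * formCoeff he β j * S.curvTensor i j c k with hK
  have hKb : ∀ c k, IsBase (K c k) := fun c k => isBase_of_fd_eq_zero fun l => by
    have h : ∀ i j, fd l (S.curvTensor i j c k) = 0 := fun i j => S.fd_curvTensor l i j c k
    simp only [hK, map_sum, Derivation.leibniz, smul_eq_mul, h,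
      (representsBase_formCoeff he _ _).fd, mul_zero, add_zero, Finset.sum_const_zero]
  have hc : ∀ b, ∑ i, ∑ j, formCoeff he α i * formCoeff he β j * S.curv i j b =
      ∑ c, S.xi c * K c b := fun b => by
    simp only [hK, FibreCalculus.curv_eq, Finset.mul_sum]
    rw [Finset.sum_congr rfl fun i _ => Finset.sum_comm, Finset.sum_comm]
    exact Finset.sum_congr rfl fun c _ => Finset.sum_congr rfl fun i _ =>
      Finset.sum_congr rfl fun j _ => by ring
  have hT : ∀ b, ∑ c, comp 0 (K c b) (⟨y, hy⟩, fun k => Ξ.coeff e k y) * Ξ.coeff e c y =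
      - curvatureOn D D' α β Ξ (e.symm y) (coordVector e b y) := fun b => by
    have h := congrArg (fun F => comp 0 F (⟨y, hy⟩, fun k => Ξ.coeff e k y))
      (sum_curvTensor_formCoeff he hassoc htors α β Ξ b)
    simp only [comp_sum_apply, map_neg, map_sub, Pi.neg_apply, Pi.sub_apply,
      (representsBase_formCoeff he _ _).comp_zero] at h
    refine Eq.trans (Finset.sum_congr rfl fun c _ => ?_) h
    rw [mul_comm (∑ i, _), (representsBase_formCoeff he _ _).comp_mul, mul_comm]
  rw [represents_qBar he hassoc htors α β s y hy]
  simp only [FibreCalculus.nabForm_curvature]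
  rw [map_smul, Pi.smul_apply, smul_eq_mul, comp_sum_apply]
  have hb : ∀ b, comp s (S.eulerForm b * ∑ i, ∑ j, formCoeff he α i * formCoeff he β j *
      S.curv i j b) (⟨y, hy⟩, fun k => Ξ.coeff e k y) = if s = 2 then
        - ∑ a, P.coeff e a b y * Ξ.coeff e a y *
          curvatureOn D D' α β Ξ (e.symm y) (coordVector e b y) else 0 := fun b => by
    have h1 : S.eulerForm b * ∑ c, S.xi c * K c b =
        ∑ a, ∑ c, S.π a b * (xi a * (xi c * K c b)) := by
      rw [FibreCalculus.eulerForm, Finset.sum_mul_sum]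
      refine Finset.sum_congr rfl fun a _ => Finset.sum_congr rfl fun c _ => ?_
      change xi a * S.π a b * (xi c * K c b) = _
      ring
    rw [hc, h1, comp_sum_apply]
    simp only [comp_sum_apply, (representsBase_π he hassoc htors _ _).comp_mul,
      comp_xi_mul_xi_mul (hKb _ _), hS]
    split_ifs
    · rw [← Finset.sum_neg_distrib]
      refine Finset.sum_congr rfl fun a _ => ?_
      rw [← mul_neg, ← hT, Finset.mul_sum]
      exact Finset.sum_congr rfl fun c _ => by ring
    · simp
  rw [Finset.sum_congr rfl fun b _ => hb b]
  split_ifs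
  · conv_rhs => rw [← OneForm.covectorOf_coeff he hy Ξ,
      ← covectorOf_coeff he hy (curvatureOn D D' α β _ _), P.apply_covectorOf, Finset.sum_comm]
    rw [Finset.sum_neg_distrib]
    ring
  · simp

/-- As every covector is the value of some 1-form, the vanishing of the defect is thereby
independent of the chart. Only formality of the components in the chart enters, not the existence of
potentials there. -/
theorem feDefect_section {U : FormField n M} {W : Fin n → FormalRing (chartOpens e)}
    (hU : ∀ k, Represents (U.coeff e k) (W k)) (α β Ξ : OneForm n M) (s : ℕ)
    {y : EuclideanSpace ℝ (Fin n)} (hy : y ∈ e.target) :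
    feDefect D U α β e s y (fun k => Ξ.coeff e k y) = defectOn D D' U α β Ξ s (e.symm y) := by
  have h : ∑ k, bracketCoeff (P.coeff e) (α.coeff e) (β.coeff e) k y
      * U.coeff e k s y (fun k => Ξ.coeff e k y) =
      U.eval (D' α β) s (e.symm y) (Ξ (e.symm y)) - U.eval (D' β α) s (e.symm y) (Ξ (e.symm y)) := by
    have h1 : ∀ γ : OneForm n M, U.eval γ s (e.symm y) (Ξ (e.symm y)) =
        ∑ k, γ.coeff e k y * U.coeff e k s y (fun k => Ξ.coeff e k y) := fun γ => by
      rw [← U.eval_inChart he γ s hy, FormalFn.inChart, OneForm.covectorOf_coeff he hy]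
    rw [h1, h1, ← Finset.sum_sub_distrib]
    exact Finset.sum_congr rfl fun k _ => by
      rw [← sub_mul, sub_eq_zero.1 (htors α β e he y hy k)]
  rw [feDefect, defectOn, qBar_section he hassoc htors α β Ξ s hy, h,
    horizontalOn_eq he (FormField.represents_eval he hU β) α Ξ s hy,
    horizontalOn_eq he (FormField.represents_eval he hU α) β Ξ s hy,
    FormalFn.inChart, OneForm.covectorOf_coeff he hy]

end Invariant

/-! ### Uniqueness of the normalized solution, degree by degree. -/

section Uniqueness

variable {n : ℕ} {M : Type*} [TopologicalSpace M] [ChartedSpace (EuclideanSpace ℝ (Fin n)) M]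
  {P : PoissonStructure n M}

/-- The properties at a point of a normalized vertical 1-form with local potentials. -/
structure IsAdmissibleAt (P : PoissonStructure n M) (U : FormField n M) (x : M) : Prop where
  zero : ∀ ξ η : Cot n x, U 0 x ξ η = 0
  one : ∀ ξ η : Cot n x, U 1 x ξ η = - P x η ξ
  homog : ∀ (s : ℕ) (t : ℝ) (ξ η : Cot n x), U s x (t • ξ) η = t ^ s * U s x ξ η
  cont : ∀ (s : ℕ) (ξ ζ η : Cot n x), Continuous fun t : ℝ => U s x (ξ + t • ζ) η
  normalized : ∀ (s : ℕ) (ξ : Cot n x), U s x ξ ξ = 0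
  ham : ∀ α : OneForm n M, ∃ X, P.IsHamiltonianAt (U.eval α) x X

theorem IsAdmissibleAt.fibreDeriv_self {U : FormField n M} {x : M} (h : IsAdmissibleAt P U x)
    (β : OneForm n M) (s : ℕ) (ξ : Cot n x) :
    (U.eval β).fibreDeriv s x ξ ξ = s * U s x ξ (β x) := by
  have h1 : (fun t : ℝ => U.eval β s x (ξ + t • ξ)) =
      fun t : ℝ => (1 + t) ^ s * U s x ξ (β x) := by
    ext t
    rw [← h.homog, add_smul, one_smul]
    rfl
  rw [FormalFn.fibreDeriv, h1]
  have h2 : HasDerivAt (fun t : ℝ => (1 + t) ^ s * U s x ξ (β x))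
      (s * (1 + 0) ^ (s - 1) * 1 * U s x ξ (β x)) 0 :=
    (((hasDerivAt_id (0 : ℝ)).const_add 1).pow s).mul_const _
  rw [h2.deriv]
  simp

/-- Normalization at ξ + tζ gives U(ξ + tζ)(ξ) = -t U(ξ + tζ)(ζ), and t g(t) has derivative g(0) at
0 as soon as g is continuous. -/
theorem IsAdmissibleAt.fibreDeriv_of_eq {U : FormField n M} {x : M} (h : IsAdmissibleAt P U x)
    (α : OneForm n M) (s : ℕ) (ξ ζ : Cot n x) (hα : α x = ξ) :
    (U.eval α).fibreDeriv s x ξ ζ = - U s x ξ ζ := by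
  have h1 : (fun t : ℝ => U.eval α s x (ξ + t • ζ)) =
      fun t : ℝ => t * - U s x (ξ + t • ζ) ζ := by
    ext t
    have h2 := h.normalized s (ξ + t • ζ)
    rw [map_add, map_smul, smul_eq_mul] at h2
    rw [FormField.eval, hα]
    linarith
  rw [FormalFn.fibreDeriv, h1]
  have h3 : HasDerivAt (fun t : ℝ => t * - U s x (ξ + t • ζ) ζ)
      (- U s x (ξ + (0 : ℝ) • ζ) ζ) 0 := by
    rw [hasDerivAt_iff_tendsto_slope]
    have h4 : Filter.Tendsto (fun t : ℝ => - U s x (ξ + t • ζ) ζ) (𝓝[≠] 0)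
        (𝓝 (- U s x (ξ + (0 : ℝ) • ζ) ζ)) :=
      ((h.cont s ξ ζ ζ).neg.tendsto 0).mono_left nhdsWithin_le_nhds
    refine h4.congr' ?_
    filter_upwards [self_mem_nhdsWithin] with t ht
    have ht' : t ≠ 0 := ht
    rw [slope_def_field, zero_mul, sub_zero, sub_zero, mul_div_cancel_left₀ _ ht']
  rw [h3.deriv, zero_smul, add_zero]

theorem IsAdmissibleAt.fibreDeriv_one {U : FormField n M} {x : M} (h : IsAdmissibleAt P U x)
    (α : OneForm n M) (ξ ζ : Cot n x) :
    (U.eval α).fibreDeriv 1 x ξ ζ = - P x (α x) ζ := by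
  have h1 : (fun t : ℝ => U.eval α 1 x (ξ + t • ζ)) =
      fun t : ℝ => - P x (α x) ξ + t * - P x (α x) ζ := by
    ext t
    rw [FormField.eval, h.one, map_add, map_smul, smul_eq_mul]
    ring
  rw [FormalFn.fibreDeriv, h1]
  have h2 : HasDerivAt (fun t : ℝ => - P x (α x) ξ + t * - P x (α x) ζ)
      (1 * - P x (α x) ζ) 0 := ((hasDerivAt_id (0 : ℝ)).mul_const _).const_add _
  rw [h2.deriv, one_mul]

theorem FormalFn.fibreDeriv_congr {F G : FormalFn n M} {s : ℕ} {x : M}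
    (h : ∀ ξ, F s x ξ = G s x ξ) (ξ ζ : Cot n x) : F.fibreDeriv s x ξ ζ = G.fibreDeriv s x ξ ζ := by
  simp only [FormalFn.fibreDeriv, h]

theorem horizontalOn_congr (D : ContravariantConnection P) (α Ξ : OneForm n M) {F G : FormalFn n M}
    {s : ℕ} {x : M} (h : ∀ᶠ p in 𝓝 x, ∀ ξ, F s p ξ = G s p ξ) :
    horizontalOn D α Ξ F s x = horizontalOn D α Ξ G s x := by
  have h1 : (fun p => F s p (Ξ p)) =ᶠ[𝓝 x] fun p => G s p (Ξ p) := h.mono fun p hp => hp _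
  rw [horizontalOn, horizontalOn, differential, differential, h1.mfderiv_eq,
    FormalFn.fibreDeriv_congr h.self_of_nhds]

/-- The components of degree s + 2 enter only through the extreme pairs of the antidiagonal. Euler's
identity for U(β) gives s + 2 copies, and the normalization together with α(x) = ξ gives one more.
The total s + 3 is the homotopy constant of `IsGeometric.exists_next`. -/
theorem IsAdmissibleAt.bracket_sub {U₁ U₂ : FormField n M} {x : M} (h₁ : IsAdmissibleAt P U₁ x)
    (h₂ : IsAdmissibleAt P U₂ x) {s : ℕ} (hs : ∀ r ≤ s + 1, ∀ ξ, U₁ r x ξ = U₂ r x ξ)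
    (α β : OneForm n M) (ξ : Cot n x) (hα : α x = ξ) :
    P.bracketOmega (U₁.eval α) (U₁.eval β) (s + 1) x ξ
        - P.bracketOmega (U₂.eval α) (U₂.eval β) (s + 1) x ξ =
      (s + 3) * (U₁ (s + 2) x ξ (β x) - U₂ (s + 2) x ξ (β x)) := by
  obtain ⟨X₁, hX₁⟩ := h₁.ham α
  obtain ⟨Y₁, hY₁⟩ := h₁.ham β
  obtain ⟨X₂, hX₂⟩ := h₂.ham α
  obtain ⟨Y₂, hY₂⟩ := h₂.ham β
  have first : ∀ {U : FormField n M} (_ : IsAdmissibleAt P U x) {X Y : ℕ → Cot n x → Cot n x}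
      (_ : P.IsHamiltonianAt (U.eval α) x X) (_ : P.IsHamiltonianAt (U.eval β) x Y),
      P x (X 0 ξ) (Y (s + 1) ξ) = (s + 2) * U (s + 2) x ξ (β x) := by
    intro U h X Y hX hY
    rw [hX, h.fibreDeriv_one, neg_neg, P.antisymm, hY, neg_neg, hα, h.fibreDeriv_self]
    push_cast
    ring
  have last : ∀ {U : FormField n M} (_ : IsAdmissibleAt P U x) {X Y : ℕ → Cot n x → Cot n x}
      (_ : P.IsHamiltonianAt (U.eval α) x X) (_ : P.IsHamiltonianAt (U.eval β) x Y),
      P x (X (s + 1) ξ) (Y 0 ξ) = U (s + 2) x ξ (β x) := by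
    intro U h X Y hX hY
    rw [P.antisymm, hY, h.fibreDeriv_one, neg_neg, P.antisymm, hX, neg_neg,
      h.fibreDeriv_of_eq α _ ξ _ hα, neg_neg]
  have agree : ∀ (γ : OneForm n M) {X X' : ℕ → Cot n x → Cot n x}
      (_ : P.IsHamiltonianAt (U₁.eval γ) x X) (_ : P.IsHamiltonianAt (U₂.eval γ) x X') (r : ℕ)
      (_ : r ≤ s) (η : Cot n x), P x (X r ξ) η = P x (X' r ξ) η := by
    intro γ X X' hX hX' r hr η
    rw [hX, hX', FormalFn.fibreDeriv_congr fun ξ => ?_]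
    rw [FormField.eval, FormField.eval, hs (r + 1) (by omega)]
  rw [P.bracketOmega_eq hX₁ hY₁, P.bracketOmega_eq hX₂ hY₂, ← Finset.sum_sub_distrib,
    Finset.sum_eq_add (0, s + 1) (s + 1, 0)]
  · rw [first h₁ hX₁ hY₁, first h₂ hX₂ hY₂, last h₁ hX₁ hY₁, last h₂ hX₂ hY₂]
    ring
  · simp
  · rintro ⟨a, b⟩ hab ⟨hne, hne'⟩
    have hab' : a + b = s + 1 := Finset.HasAntidiagonal.mem_antidiagonal.1 hab
    have ha : a ≠ 0 := by
      rintro rfl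
      exact hne (by simpa using hab')
    have hb : b ≠ 0 := by
      rintro rfl
      exact hne' (by simpa using hab')
    rw [sub_eq_zero, agree α hX₁ hX₂ a (by omega), P.antisymm, agree β hY₁ hY₂ b (by omega),
      ← P.antisymm]
  · intro h
    exact absurd (Finset.HasAntidiagonal.mem_antidiagonal.2 (by simp)) h
  · intro h
    exact absurd (Finset.HasAntidiagonal.mem_antidiagonal.2 (by simp)) h

variable [IsManifold (𝓡 n) ∞ M] [T2Space M]

theorem exists_oneForm_apply_eq (x : M) (η : Cot n x) : ∃ α : OneForm n M, α x = η := by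
  have he : chartAt (EuclideanSpace ℝ (Fin n)) x ∈ smoothCharts n M :=
    IsManifold.chart_mem_maximalAtlas x
  have hx := mem_chart_source (EuclideanSpace ℝ (Fin n)) x
  generalize chartAt (EuclideanSpace ℝ (Fin n)) x = e at he hx
  obtain ⟨y, hy, rfl⟩ : ∃ y ∈ e.target, e.symm y = x := ⟨e x, e.map_source hx, e.left_inv hx⟩
  let c : Fin n → C^∞⟮𝓡 n, M; ℝ⟯ := fun i => ⟨fun _ => η (coordVector e i y), contMDiff_const⟩
  refine ⟨∑ i, c i • coordForm e (e.symm y) i, ?_⟩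
  rw [OneForm.sum_apply]
  refine Eq.trans (Finset.sum_congr rfl fun i _ => ?_) (covectorOf_coeff he hy η)
  rw [OneForm.smul_apply, (coordForm_eventuallyEq he hx i).self_of_nhds]
  rfl

/-- Uniqueness of the normalized solution. -/
theorem eqOn_of_defectOn_eq_zero {D D' : ContravariantConnection P} {U₁ U₂ : FormField n M}
    {O : Set M} (hO : IsOpen O)
    (h₁ : ∀ x ∈ O, IsAdmissibleAt P U₁ x) (h₂ : ∀ x ∈ O, IsAdmissibleAt P U₂ x)
    (hd₁ : ∀ α β Ξ s, ∀ x ∈ O, defectOn D D' U₁ α β Ξ s x = 0)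
    (hd₂ : ∀ α β Ξ s, ∀ x ∈ O, defectOn D D' U₂ α β Ξ s x = 0) (s : ℕ) :
    ∀ x ∈ O, ∀ ξ, U₁ s x ξ = U₂ s x ξ := by
  induction s using Nat.strong_induction_on with
  | _ s ih =>
    intro x hx ξ
    rcases s with _ | _ | s
    · ext η
      rw [(h₁ x hx).zero, (h₂ x hx).zero]
    · ext η
      rw [zero_add, (h₁ x hx).one, (h₂ x hx).one]
    · ext η
      -- The equation is evaluated on α and β along the section Ξ = α, in degree s + 1; this is what
      -- makes the normalization applicable.
      obtain ⟨α, hα⟩ := exists_oneForm_apply_eq x ξ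
      obtain ⟨β, hβ⟩ := exists_oneForm_apply_eq x η
      have hlow : ∀ r ≤ s + 1, ∀ ξ, U₁ r x ξ = U₂ r x ξ := fun r hr ξ =>
        ih r (by omega) x hx ξ
      -- The horizontal terms differentiate U^{(s+1)} along the base, so agreement at x alone would
      -- not suffice; hence the induction runs over an open set.
      have hev : ∀ γ : OneForm n M, ∀ᶠ p in 𝓝 x, ∀ ξ,
          U₁.eval γ (s + 1) p ξ = U₂.eval γ (s + 1) p ξ := fun γ => by
        filter_upwards [hO.mem_nhds hx] with p hp ξ
        rw [FormField.eval, FormField.eval, ih (s + 1) (by omega) p hp]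
      have hb := (h₁ x hx).bracket_sub (h₂ x hx) hlow α β ξ hα
      have e₁ := hd₁ α β α (s + 1) x hx
      have e₂ := hd₂ α β α (s + 1) x hx
      rw [defectOn, horizontalOn_congr D α α (hev β), horizontalOn_congr D β α (hev α),
        (hev _).self_of_nhds, (hev _).self_of_nhds] at e₁
      rw [defectOn] at e₂
      rw [hα] at e₁ e₂
      have h0 : ((s : ℝ) + 3) * (U₁ (s + 2) x ξ (β x) - U₂ (s + 2) x ξ (β x)) = 0 := by
        rw [← hb]
        linarith
      have h3 : (s : ℝ) + 3 ≠ 0 := by positivity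
      have h4 := (mul_eq_zero.1 h0).resolve_left h3
      rw [hβ] at h4
      exact sub_eq_zero.1 h4

end Uniqueness

/-! ### Pointwise properties of normalized forms with local potentials. -/

section Admissible

open FormalRing

variable {n : ℕ} {M : Type*} [TopologicalSpace M] [ChartedSpace (EuclideanSpace ℝ (Fin n)) M]
  {P : PoissonStructure n M} {e : OpenPartialHomeomorph M (EuclideanSpace ℝ (Fin n))}
  [IsManifold (𝓡 n) ∞ M] [T2Space M] {D D' : ContravariantConnection P}
  {he : e ∈ smoothCharts n M} {hassoc : ContravariantConnection.Associated D D'}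
  {htors : D'.TorsionFree}
  {u : Fin n → FormalRing (chartOpens e)} {v : Fin n → Fin n → FormalRing (chartOpens e)}

omit [IsManifold (𝓡 n) ∞ M] [T2Space M] in
theorem FormField.apply_eq (he : e ∈ smoothCharts n M) (U : FormField n M)
    {W : Fin n → FormalRing (chartOpens e)} (hU : ∀ k, Represents (U.coeff e k) (W k)) (s : ℕ)
    {y : EuclideanSpace ℝ (Fin n)} (hy : y ∈ e.target) (ξ η : Cot n (e.symm y)) :
    U s (e.symm y) ξ η = ∑ k, η (coordVector e k y) *
      comp s (W k) (⟨y, hy⟩, fun l => ξ (coordVector e l y)) := by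
  have h : ∀ k, comp s (W k) (⟨y, hy⟩, fun l => ξ (coordVector e l y)) =
      U s (e.symm y) ξ (coordCovector e k (e.symm y)) := fun k => by
    rw [← hU k s y hy, FormField.coeff, FormalFn.inChart, covectorOf_coeff he hy]
  conv_lhs => rw [← covectorOf_coeff he hy η, covectorOf, map_sum]
  simp only [map_smul, smul_eq_mul, h]

theorem isAdmissibleAt_of_represents (huv : (chartCalculus he hassoc htors).Compatible u v)
    {U : FormField n M}
    (hU : ∀ k, Represents (U.coeff e k) ((chartCalculus he hassoc htors).potential u k))
    (hu : ∀ k, u k + xi k ∈ order (chartOpens e) 2) {y : EuclideanSpace ℝ (Fin n)}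
    (hy : y ∈ e.target) (hn : ∀ (s : ℕ) (ξ : Cot n (e.symm y)), U s (e.symm y) ξ ξ = 0) :
    IsAdmissibleAt P U (e.symm y) := by
  have hu' : ∀ s < 2, ∀ k p, comp s (u k) p = - comp s (xi k) p := fun s hs k p => by
    have h := congrFun (hu k s hs) p
    rw [map_add, Pi.add_apply, Pi.zero_apply] at h
    linarith
  have hp : ∀ s k p, comp s ((chartCalculus he hassoc htors).potential u k) p =
      ∑ l, P.coeff e k l p.1 * comp s (u l) p := fun s k p => by
    rw [FibreCalculus.potential, comp_sum_apply]
    exact Finset.sum_congr rfl fun l _ => (representsBase_π he hassoc htors k l).comp_mul _ _ _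
  refine ⟨fun ξ η => ?_, fun ξ η => ?_, fun s t ξ η => ?_, fun s ξ ζ η => ?_, hn, fun α => ?_⟩
  · rw [U.apply_eq he hU 0 hy]
    simp [hp, hu' 0 (by omega), comp_xi]
  · rw [U.apply_eq he hU 1 hy]
    conv_rhs => rw [← covectorOf_coeff he hy ξ, ← covectorOf_coeff he hy η, P.apply_covectorOf]
    simp only [hp, hu' 1 (by omega), comp_xi, if_true]
    rw [← Finset.sum_neg_distrib]
    refine Finset.sum_congr rfl fun k _ => ?_
    rw [Finset.mul_sum, ← Finset.sum_neg_distrib]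
    exact Finset.sum_congr rfl fun l _ => by ring
  · rw [U.apply_eq he hU s hy, U.apply_eq he hU s hy, Finset.mul_sum]
    refine Finset.sum_congr rfl fun k _ => ?_
    have h := comp_homog s ((chartCalculus he hassoc htors).potential u k) ⟨y, hy⟩ t
      fun l => ξ (coordVector e l y)
    have h2 : (fun l => (t • ξ) (coordVector e l y)) = t • fun l => ξ (coordVector e l y) := rfl
    rw [h2, h]
    ring
  · simp only [U.apply_eq he hU s hy]
    refine continuous_finsetSum _ fun k _ => continuous_const.mul ?_
    refine (continuous_fibre (comp_mem s _) ⟨y, hy⟩).comp ?_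
    refine continuous_pi fun l => ?_
    change Continuous fun t : ℝ => ξ (coordVector e l y) + t * ζ (coordVector e l y)
    fun_prop
  · exact ⟨_, isHamiltonianAt_potentialField huv hU α hy⟩

end Admissible

/-! ### Chart solutions and their gluing. -/

section Gluing

open FormalRing

variable {n : ℕ} {M : Type*} [TopologicalSpace M] [ChartedSpace (EuclideanSpace ℝ (Fin n)) M]
  {P : PoissonStructure n M} {e : OpenPartialHomeomorph M (EuclideanSpace ℝ (Fin n))}

/-- The fibre coordinate `ξ_k` of a chart as a linear function on the cotangent space at `x`. -/
def fibreCoord (e : OpenPartialHomeomorph M (EuclideanSpace ℝ (Fin n))) (k : Fin n) (x : M) :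
    Cot n x →ₗ[ℝ] ℝ where
  toFun η := (show EuclideanSpace ℝ (Fin n) →L[ℝ] ℝ from η)
    (symmDeriv e (e x) (EuclideanSpace.single k 1))
  map_add' _ _ := rfl
  map_smul' _ _ := rfl

theorem fibreCoord_symm (k : Fin n) {y : EuclideanSpace ℝ (Fin n)} (hy : y ∈ e.target)
    (η : Cot n (e.symm y)) : fibreCoord e k (e.symm y) η = η (coordVector e k y) := by
  change (show EuclideanSpace ℝ (Fin n) →L[ℝ] ℝ from η)
    (symmDeriv e (e (e.symm y)) (EuclideanSpace.single k 1)) = _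
  rw [e.right_inv hy]
  rfl

/-- The vertical 1-form with given components in a chart. -/
def chartField (W : Fin n → FormalRing (chartOpens e)) : FormField n M := fun s x ξ =>
  ∑ k, extend (comp s (W k)) (e x, fun l => fibreCoord e l x ξ) • fibreCoord e k x

theorem represents_chartField (he : e ∈ smoothCharts n M) (W : Fin n → FormalRing (chartOpens e))
    (k : Fin n) : Represents ((chartField W).coeff e k) (W k) := by
  intro s y hy ξ
  have hy' : y ∈ e.target := hy
  rw [FormField.coeff, FormalFn.inChart, chartField, LinearMap.sum_apply]
  simp only [LinearMap.smul_apply, smul_eq_mul, fibreCoord_symm _ hy',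
    covectorOf_apply_coordVector he hy', coordCovector_coordVector he hy', e.right_inv hy',
    extend_apply _ hy]
  simp

/-- The local formal function defined by a formal function over an open set. -/
def toLocal {V : TopologicalSpace.Opens (EuclideanSpace ℝ (Fin n))} (F : FormalRing V) :
    LocalFormal n := fun s y ξ => extend (comp s F) (y, ξ)

theorem represents_toLocal {V : TopologicalSpace.Opens (EuclideanSpace ℝ (Fin n))}
    (F : FormalRing V) : Represents (toLocal F) F := fun _ _ hy ξ => extend_apply _ hy ξ

variable [IsManifold (𝓡 n) ∞ M] [T2Space M] {D D' : ContravariantConnection P}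
  (he : e ∈ smoothCharts n M) (hassoc : ContravariantConnection.Associated D D')
  (htors : D'.TorsionFree)

theorem fd_potential (u : Fin n → FormalRing (chartOpens e)) (i j : Fin n) :
    fd i ((chartCalculus he hassoc htors).potential u j) =
      ∑ s, (chartCalculus he hassoc htors).π j s * fd i (u s) := by
  simp only [FibreCalculus.potential, map_sum, Derivation.leibniz, smul_eq_mul,
    (representsBase_π he hassoc htors _ _).fd, mul_zero, add_zero]

theorem represents_sum_π_mul {G : Fin n → LocalFormal n}
    {F : Fin n → FormalRing (chartOpens e)} (h : ∀ s, Represents (G s) (F s)) (i : Fin n) :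
    Represents (fun d y ξ => ∑ s, P.coeff e i s y * G s d y ξ)
      (∑ s, (chartCalculus he hassoc htors).π i s * F s) :=
  .sum _ fun s _ => (representsBase_π he hassoc htors i s).mul_represents (h s)

omit [IsManifold (𝓡 n) ∞ M] [T2Space M] in
theorem represents_dFibre {V : TopologicalSpace.Opens (EuclideanSpace ℝ (Fin n))}
    {G : LocalFormal n} {F : FormalRing V} (h : Represents G F) (k : Fin n) :
    Represents (G.dFibre k) (fd k F) := fun s y hy ξ => by
  rw [comp_fd, ← h.pdFibre_eq (s + 1) hy]
  rfl

theorem IsLocalPotential.exists_formalRing {U : VerticalOneForm n M} {u : Fin n → LocalFormal n}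
    {v : Fin n → Fin n → LocalFormal n} (h : IsLocalPotential P U e u v) :
    ∃ (u' : Fin n → FormalRing (chartOpens e)) (v' : Fin n → Fin n → FormalRing (chartOpens e)),
      (chartCalculus he hassoc htors).Compatible u' v' ∧
      (∀ k, Represents (FormField.coeff U.toFun e k)
        ((chartCalculus he hassoc htors).potential u' k)) ∧
      ∀ k, u' k + xi k ∈ order (chartOpens e) 2 := by
  choose u' hu' using fun k => exists_represents (V := chartOpens e) (h.formal_u k)
  choose v' hv' using fun i k => exists_represents (V := chartOpens e) (h.formal_v i k)
  refine ⟨u', v', fun i j => ?_, fun k => ?_, fun k r hr => ?_⟩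
  · refine (fd_potential he hassoc htors u' i j).trans (ext_comp fun d => ?_)
    ext ⟨⟨y, hy⟩, ξ⟩
    rw [← represents_sum_π_mul he hassoc htors (fun s => hv' j s) i d y hy ξ,
      ← represents_sum_π_mul he hassoc htors (fun s => represents_dFibre (hu' s) i) j d y hy ξ]
    exact (h.compatible i j d y hy ξ).symm
  · exact (represents_sum_π_mul he hassoc htors hu' k).congr fun d y hy ξ => h.eval_eq k d y hy ξ
  · ext ⟨⟨y, hy⟩, ξ⟩
    rw [map_add, Pi.add_apply, ← hu' k r y hy ξ, comp_xi]
    rcases r with _ | _ | r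
    · simp [h.u_zero k y hy ξ]
    · simp [h.u_one k y hy ξ]
    · omega

/-- `U` is given in a chart by a solution of the normalized Fundamental Equation. -/
def IsChartSolution (U : FormField n M) : Prop :=
  ∃ (u : Fin n → FormalRing (chartOpens e)) (v : Fin n → Fin n → FormalRing (chartOpens e)),
    (chartCalculus he hassoc htors).Compatible u v ∧
    (∀ k, Represents (U.coeff e k) ((chartCalculus he hassoc htors).potential u k)) ∧
    ∑ j, xi j * (chartCalculus he hassoc htors).potential u j = 0 ∧
    (∀ i j, (chartCalculus he hassoc htors).defect u v i j = 0) ∧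
    (∀ k, u k + xi k ∈ order (chartOpens e) 2) ∧
    ∀ i k, v i k - (if i = k then 1 else 0) ∈ order (chartOpens e) 1

theorem exists_isChartSolution : ∃ U : FormField n M, IsChartSolution he hassoc htors U := by
  obtain ⟨u, v, h1, h2, h3, h4, h5⟩ :=
    (isGeometric_chartCalculus he hassoc htors).exists_solution
  exact ⟨chartField ((chartCalculus he hassoc htors).potential u), u, v, h1,
    represents_chartField he _, h2, h3, h4, h5⟩

variable {he hassoc htors} {U : FormField n M}

theorem IsChartSolution.congr (h : IsChartSolution he hassoc htors U) {U' : FormField n M}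
    (hU : ∀ s, ∀ x ∈ e.source, ∀ ξ, U' s x ξ = U s x ξ) : IsChartSolution he hassoc htors U' := by
  obtain ⟨u, v, h1, h2, h3⟩ := h
  refine ⟨u, v, h1, fun k => (h2 k).congr fun s y hy ξ => ?_, h3⟩
  rw [FormField.coeff, FormField.coeff, FormalFn.inChart, FormalFn.inChart,
    hU s _ (e.map_target hy)]

theorem IsChartSolution.isFormalOn (h : IsChartSolution he hassoc htors U) (k : Fin n) :
    IsFormalOn e.target (U.coeff e k) := by
  obtain ⟨u, v, -, h2, -⟩ := h
  exact (h2 k).isFormalOn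

theorem IsChartSolution.normalized (h : IsChartSolution he hassoc htors U)
    {y : EuclideanSpace ℝ (Fin n)} (hy : y ∈ e.target) (s : ℕ) (ξ : Cot n (e.symm y)) :
    U s (e.symm y) ξ ξ = 0 := by
  obtain ⟨u, v, -, h2, h3, -⟩ := h
  rw [U.apply_eq he h2 s hy]
  have h4 := congrArg (fun F => comp (s + 1) F (⟨y, hy⟩, fun l => ξ (coordVector e l y))) h3
  simpa only [comp_sum_apply, comp_xi_mul, map_zero, Pi.zero_apply] using h4

theorem IsChartSolution.feDefect_eq_zero (h : IsChartSolution he hassoc htors U)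
    (α β : OneForm n M) {y : EuclideanSpace ℝ (Fin n)} (hy : y ∈ e.target) (s : ℕ)
    (ξ : Fin n → ℝ) : feDefect D U α β e s y ξ = 0 := by
  obtain ⟨u, v, h1, h2, -, h3, -⟩ := h
  rw [represents_feDefect h1 h2 α β s y hy ξ]
  simp [h3]

theorem IsChartSolution.isAdmissibleAt (h : IsChartSolution he hassoc htors U) {x : M}
    (hx : x ∈ e.source) : IsAdmissibleAt P U x := by
  obtain ⟨y, hy, rfl⟩ : ∃ y ∈ e.target, e.symm y = x := ⟨e x, e.map_source hx, e.left_inv hx⟩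
  have hn := fun s ξ => h.normalized hy s ξ
  obtain ⟨u, v, h1, h2, -, -, h3, -⟩ := h
  exact isAdmissibleAt_of_represents h1 h2 h3 hy hn

theorem IsChartSolution.defectOn_eq_zero (h : IsChartSolution he hassoc htors U) {x : M}
    (hx : x ∈ e.source) (α β Ξ : OneForm n M) (s : ℕ) : defectOn D D' U α β Ξ s x = 0 := by
  obtain ⟨y, hy, rfl⟩ : ∃ y ∈ e.target, e.symm y = x := ⟨e x, e.map_source hx, e.left_inv hx⟩
  have h0 := h.feDefect_eq_zero α β hy s fun k => Ξ.coeff e k y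
  obtain ⟨u, v, h1, h2, -⟩ := h
  rwa [feDefect_section he hassoc htors h2 α β Ξ s hy] at h0

/-- Both solutions annihilate the chart-free defect on the open overlap, so uniqueness applies
there. -/
theorem IsChartSolution.eqOn (h : IsChartSolution he hassoc htors U)
    {f : OpenPartialHomeomorph M (EuclideanSpace ℝ (Fin n))} {hf : f ∈ smoothCharts n M}
    {U' : FormField n M} (h' : IsChartSolution hf hassoc htors U') (s : ℕ) :
    ∀ x ∈ e.source ∩ f.source, ∀ ξ, U s x ξ = U' s x ξ :=
  eqOn_of_defectOn_eq_zero (D := D) (D' := D') (e.open_source.inter f.open_source)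
    (fun _ hx => h.isAdmissibleAt hx.1) (fun _ hx => h'.isAdmissibleAt hx.2)
    (fun α β Ξ s _ hx => h.defectOn_eq_zero hx.1 α β Ξ s)
    (fun α β Ξ s _ hx => h'.defectOn_eq_zero hx.2 α β Ξ s) s

theorem IsChartSolution.exists_isLocalPotential {U : VerticalOneForm n M}
    (h : IsChartSolution he hassoc htors U.toFun) :
    ∃ (u : Fin n → LocalFormal n) (v : Fin n → Fin n → LocalFormal n),
      IsLocalPotential P U e u v := by
  obtain ⟨u, v, h1, h2, -, -, hu, hv⟩ := h
  have hu' : ∀ s < 2, ∀ k p, comp s (u k) p = - comp s (xi k) p := fun s hs k p => by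
    have h := congrFun (hu k s hs) p
    rw [map_add, Pi.add_apply, Pi.zero_apply] at h
    linarith
  refine ⟨fun k => toLocal (u k), fun i k => toLocal (v i k),
    fun k => (represents_toLocal (u k)).isFormalOn, fun i k => (represents_toLocal (v i k)).isFormalOn,
    fun i j d y hy ξ => ?_, fun i d y hy ξ => ?_, fun k y hy ξ => ?_, fun k y hy ξ => ?_,
    fun i k y hy ξ => ?_⟩
  · refine (represents_sum_π_mul he hassoc htors (fun s => represents_toLocal (v j s)) i d y hy
      ξ).trans (Eq.trans ?_ (represents_sum_π_mul he hassoc htors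
        (fun s => represents_dFibre (represents_toLocal (u s)) i) j d y hy ξ).symm)
    rw [← fd_potential]
    exact congrArg (fun F => comp d F (⟨y, hy⟩, ξ)) (h1 i j).symm
  · exact (h2 i d y hy ξ).trans (represents_sum_π_mul he hassoc htors
      (fun s => represents_toLocal (u s)) i d y hy ξ).symm
  · rw [represents_toLocal (u k) 0 y hy ξ, hu' 0 (by omega), comp_xi]
    simp
  · rw [represents_toLocal (u k) 1 y hy ξ, hu' 1 (by omega), comp_xi]
    simp
  · rw [represents_toLocal (v i k) 0 y hy ξ]
    have h := congrFun (hv i k 0 (by omega)) (⟨y, hy⟩, ξ)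
    rw [map_sub, Pi.sub_apply, Pi.zero_apply, sub_eq_zero] at h
    rw [h]
    split_ifs
    · simp [comp_one]
    · simp

/-- U is defined at x by the preferred chart at x. By uniqueness it coincides with the solution of
any chart throughout the domain of that chart, so it inherits smoothness and all properties of a
solution. -/
theorem exists_global_solution (hassoc : ContravariantConnection.Associated D D')
    (htors : D'.TorsionFree) : ∃ U : VerticalOneForm n M,
      ∀ e (he : e ∈ smoothCharts n M), IsChartSolution he hassoc htors U.toFun := by
  choose W hW using fun (e : OpenPartialHomeomorph M (EuclideanSpace ℝ (Fin n)))
    (he : e ∈ smoothCharts n M) => exists_isChartSolution he hassoc htors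
  have hc : ∀ x : M, chartAt (EuclideanSpace ℝ (Fin n)) x ∈ smoothCharts n M :=
    fun x => IsManifold.chart_mem_maximalAtlas x
  let U : FormField n M := fun s x => W _ (hc x) s x
  have hU : ∀ e (he : e ∈ smoothCharts n M), IsChartSolution he hassoc htors U := fun e he =>
    (hW e he).congr fun s x hx ξ =>
      (hW _ (hc x)).eqOn (hW e he) s x ⟨mem_chart_source _ x, hx⟩ ξ
  exact ⟨⟨U, fun e he k => (hU e he).isFormalOn k⟩, hU⟩

theorem VerticalOneForm.isAdmissibleAt_of_hasLocalPotentials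
    (hassoc : ContravariantConnection.Associated D D') (htors : D'.TorsionFree)
    {U : VerticalOneForm n M} (hn : IsNormalized U) (hp : HasLocalPotentials P U) (x : M) :
    IsAdmissibleAt P U.toFun x := by
  obtain ⟨e, he, hx, u, v, h⟩ := hp x
  obtain ⟨y, hy, rfl⟩ : ∃ y ∈ e.target, e.symm y = x := ⟨e x, e.map_source hx, e.left_inv hx⟩
  obtain ⟨u', v', h1, h2, h3⟩ := h.exists_formalRing he hassoc htors
  exact isAdmissibleAt_of_represents h1 h2 h3 hy fun s ξ => (isNormalized_iff U).1 hn s _ ξ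

/-- Any chart around x will do here, since the components of a vertical 1-form are formal in every
chart; it need not carry potentials. -/
theorem VerticalOneForm.defectOn_eq_zero
    (hassoc : ContravariantConnection.Associated D D') (htors : D'.TorsionFree)
    {U : VerticalOneForm n M} (hU : FundamentalEquation D U) (α β Ξ : OneForm n M) (s : ℕ) (x : M) :
    defectOn D D' U.toFun α β Ξ s x = 0 := by
  have he : chartAt (EuclideanSpace ℝ (Fin n)) x ∈ smoothCharts n M :=
    IsManifold.chart_mem_maximalAtlas x
  have hx := mem_chart_source (EuclideanSpace ℝ (Fin n)) x
  generalize chartAt (EuclideanSpace ℝ (Fin n)) x = e at he hx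
  obtain ⟨y, hy, rfl⟩ : ∃ y ∈ e.target, e.symm y = x := ⟨e x, e.map_source hx, e.left_inv hx⟩
  choose W hW using fun k => exists_represents (V := chartOpens e) (U.formal' e he k)
  rw [← feDefect_section he hassoc htors hW α β Ξ s hy]
  exact (fundamentalEquation_iff D U).1 hU α β e he y hy s _

end Gluing

end

end FormalPoisson

/-! ### The theorem. -/

theorem theoremT {n : ℕ} {M : Type*} [TopologicalSpace M]
    [ChartedSpace (EuclideanSpace ℝ (Fin n)) M] [IsManifold (𝓡 n) ∞ M] [T2Space M]
    (P : FormalPoisson.PoissonStructure n M)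
    (D D' : FormalPoisson.ContravariantConnection P)
    (hassoc : FormalPoisson.ContravariantConnection.Associated D D')
    (htors : D'.TorsionFree) :
    ∃! U : FormalPoisson.VerticalOneForm n M,
      FormalPoisson.FundamentalEquation D U ∧
      FormalPoisson.IsNormalized U ∧
      FormalPoisson.HasLocalPotentials P U := by
  open FormalPoisson in
  obtain ⟨U, hU⟩ := exists_global_solution hassoc htors
  have hc : ∀ x : M, chartAt (EuclideanSpace ℝ (Fin n)) x ∈ smoothCharts n M :=
    fun x => IsManifold.chart_mem_maximalAtlas x
  refine ⟨U, ⟨(fundamentalEquation_iff D U).2 fun α β e he y hy s ξ =>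
      (hU e he).feDefect_eq_zero α β hy s ξ, (isNormalized_iff U).2 fun s x ξ =>
      ((hU _ (hc x)).isAdmissibleAt (mem_chart_source _ x)).normalized s ξ,
      fun x => ⟨_, hc x, mem_chart_source _ x, (hU _ (hc x)).exists_isLocalPotential⟩⟩, ?_⟩
  rintro U' ⟨hfe, hn, hp⟩
  refine VerticalOneForm.ext (funext fun s => funext fun x => funext fun ξ => ?_)
  -- The competitor may have its potentials over other charts; the comparison uses only pointwise
  -- properties and the chart-free defect, on all of M.
  exact eqOn_of_defectOn_eq_zero (D := D) (D' := D') isOpen_univ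
    (fun x _ => VerticalOneForm.isAdmissibleAt_of_hasLocalPotentials hassoc htors hn hp x)
    (fun x _ => (hU _ (hc x)).isAdmissibleAt (mem_chart_source _ x))
    (fun α β Ξ s x _ => VerticalOneForm.defectOn_eq_zero hassoc htors hfe α β Ξ s x)
    (fun α β Ξ s x _ => (hU _ (hc x)).defectOn_eq_zero (mem_chart_source _ x) α β Ξ s)
    s x trivial ξ
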